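/- Let $K\subset\mathbb{C}$ be a compact set of positive logarithmic capacity $\operatorname{cap}(K)$ which is regular, that is, the Dirichlet problem is solvable, for all continuous boundary data, in the unbounded component $G$ of $\overline{\mathbb{C}}\setminus K$. Let $\mu_K$ be the equilibrium measure of $K$, let $P(\mu_K;z)=\int-\log|z-\zeta|\,d\mu_K(\zeta)$, and for $\theta>0$ put $E_{\mu_K}(\theta)=\{z\in\mathbb{C}:\exp(-P(\mu_K;z))<\theta\}$. For $A\subset\mathbb{C}$ let $\sigma(A)$ be the infimum of the sums of the radii over all countable coverings of $A$ by disks ($1$-dimensional Hausdorff content). Let $f$ be a complex function on $K$, let $m\ge0$, and let $\{r_n\}_{n\ge m}$ be rational functions $r_n=p_n/q_n$ with $\deg p_n\le n-m$, $\deg q_n\le m$, $q_n\not\equiv0$, such that, with the sup norm on $K$, $$\limsup_{n\to\infty}\|f-r_n\|_K^{1/n}\le\frac{\operatorname{cap}(K)}{\theta}<1 .$$ Then $r_n\to f$ in $\sigma$-content on compact subsets of $E_{\mu_K}(\theta)$, where $f$ also denotes its meromorphic continuation. Precisely: $K\subset E_{\mu_K}(\theta)$, and there is a meromorphic function $F$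 on $E_{\mu_K}(\theta)$ with at most $m$ poles, counted with multiplicity, such that - $F$ is analytic at $z$ with $F(z)=f(z)$ for every $z\in K$, with the possible exception of finitely many isolated points of $K$; - for every compact $C\subset E_{\mu_K}(\theta)$ and every $\varepsilon>0$, $\displaystyle\lim_{n\to\infty}\sigma(\{z\in C:|r_n(z)-F(z)|>\varepsilon\})=0$. -/

import Mathlib

open Filter Topology MeasureTheory Set Polynomial
open scoped ENNReal NNReal

noncomputable section

namespace SigmaContent

/-- The logarithmic kernel `log (1 / |z - w|)`, with the value `+∞` for `z = w`. -/
def logKernel (z w : ℂ) : EReal := -ENNReal.log ‖z - w‖ₑ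

/-- The logarithmic potential `P(μ; z) = ∫ -log |z - ζ| dμ(ζ)`, as the integral of the positive part
minus the integral of the negative part (the latter is finite when `μ` is finite with compact
support, so that the value lies in `(-∞, +∞]`). -/
def logPotential (μ : Measure ℂ) (z : ℂ) : EReal :=
  ((∫⁻ w, (logKernel z w).toENNReal ∂μ : ℝ≥0∞) : EReal) -
    ((∫⁻ w, (-logKernel z w).toENNReal ∂μ : ℝ≥0∞) : EReal)

/-- The logarithmic energy `I(μ) = ∬ log (1 / |z - w|) dμ(z) dμ(w)`. -/
def logEnergy (μ : Measure ℂ) : EReal :=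
  ((∫⁻ x, (logKernel x.1 x.2).toENNReal ∂(μ.prod μ) : ℝ≥0∞) : EReal) -
    ((∫⁻ x, (-logKernel x.1 x.2).toENNReal ∂(μ.prod μ) : ℝ≥0∞) : EReal)

/-- The Borel probability measures carried by `K`. -/
def probOn (K : Set ℂ) : Set (Measure ℂ) := {μ | IsProbabilityMeasure μ ∧ μ Kᶜ = 0}

/-- The minimal energy (Robin constant) of `K`; it is `+∞` if no probability measure on `K` has finite
energy. -/
def robinConst (K : Set ℂ) : EReal := ⨅ μ ∈ probOn K, logEnergy μ

/-- The logarithmic capacity of a compact set. -/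
def logCap (K : Set ℂ) : ℝ := (EReal.exp (-robinConst K)).toReal

/-- `μ` is an equilibrium measure of `K`: a probability measure on `K` of minimal energy
(it is unique if `K` is compact with positive capacity). -/
def IsEquilibriumMeasure (K : Set ℂ) (μ : Measure ℂ) : Prop :=
  μ ∈ probOn K ∧ logEnergy μ = robinConst K

/-- The set `E_μ(r) = {z : exp (-P(μ; z)) < r}`. -/
def levelSet (μ : Measure ℂ) (r : ℝ) : Set ℂ :=
  {z | EReal.exp (-logPotential μ z) < ENNReal.ofReal r}

/-- The finite part of the component of `∞` in the complement of `K` in the Riemann sphere. -/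
def outerDomain (K : Set ℂ) : Set ℂ :=
  {z | z ∈ Kᶜ ∧ ¬ Bornology.IsBounded (connectedComponentIn Kᶜ z)}

/-- Solvability of the Dirichlet problem in the component of `∞` of the complement of `K` for all
continuous boundary data. A function harmonic near `∞` in the plane is harmonic at `∞`
exactly if it has a finite limit there. -/
def IsDirichletRegular (K : Set ℂ) : Prop :=
  ∀ φ : ℂ → ℝ, ContinuousOn φ (frontier (outerDomain K)) →
    ∃ u : ℂ → ℝ, InnerProductSpace.HarmonicOnNhd u (outerDomain K) ∧
      ContinuousOn u (closure (outerDomain K)) ∧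
      (∀ z ∈ frontier (outerDomain K), u z = φ z) ∧
      ∃ c : ℝ, Tendsto u (cocompact ℂ) (𝓝 c)

/-- Regular compact sets. Positive capacity only excludes the empty set and the degenerate case where
the outer boundary is a single point. -/
structure IsRegularCompact (K : Set ℂ) : Prop where
  isCompact : IsCompact K
  logCap_pos : 0 < logCap K
  dirichlet : IsDirichletRegular K

/-- The rational functions `p / q` with `deg p ≤ n`, `deg q ≤ m` and `q ≠ 0`. -/
def ratClass (n m : ℕ) : Set (RatFunc ℂ) :=
  {r | ∃ p q : ℂ[X], p.natDegree ≤ n ∧ q.natDegree ≤ m ∧ q ≠ 0 ∧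
    r = algebraMap ℂ[X] (RatFunc ℂ) p / algebraMap ℂ[X] (RatFunc ℂ) q}

/-- The value of a rational function (in lowest terms) at a point; `0` at its poles. -/
def ratEval (r : RatFunc ℂ) (z : ℂ) : ℂ := r.eval (RingHom.id ℂ) z

open Classical in
/-- The sup norm `‖f - r‖_K`, which is `+∞` if `r` has a pole on `K`. -/
def supDist (K : Set ℂ) (f : ℂ → ℂ) (r : RatFunc ℂ) : ℝ≥0∞ :=
  ⨆ z ∈ K, if r.denom.eval z = 0 then ⊤ else ‖f z - ratEval r z‖ₑ

/-- The 1-dimensional Hausdorff content: the infimum of the sums of the radii over all countable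
coverings by disks (disks of radius zero are empty, so finite coverings are included). -/
def sigmaContent (A : Set ℂ) : ℝ≥0∞ :=
  ⨅ (c : ℕ → ℂ) (ρ : ℕ → ℝ≥0) (_ : A ⊆ ⋃ i, Metric.ball (c i) (ρ i)), ∑' i, (ρ i : ℝ≥0∞)

/-- Convergence in `σ`-content on compact subsets of `D`. (Values at finitely many points, such as the
poles of a rational function, are immaterial.) -/
def TendstoInSigmaContent (φ : ℕ → ℂ → ℂ) (ψ : ℂ → ℂ) (D : Set ℂ) : Prop :=
  ∀ C : Set ℂ, IsCompact C → C ⊆ D → ∀ ε : ℝ, 0 < ε →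
    Tendsto (fun n => sigmaContent {z | z ∈ C ∧ ε < ‖φ n z - ψ z‖}) atTop (𝓝 0)

/-- The order of the pole of `F` at `z` (`0` if `z` is not a pole). -/
def poleOrder (F : ℂ → ℂ) (z : ℂ) : ℕ := (-(meromorphicOrderAt F z).untop₀).toNat

/-- `F` is meromorphic on `D`, removable singularities being removed, with at most `m` poles on `D`
in all, counted with multiplicity. -/
def IsMeromorphicWithPoles (F : ℂ → ℂ) (D : Set ℂ) (m : ℕ) : Prop :=
  MeromorphicNFOn F D ∧ ∀ S : Finset ℂ, (S : Set ℂ) ⊆ D → ∑ z ∈ S, poleOrder F z ≤ m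

end SigmaContent

end

/-! Put g(z) = V + ∫ log|z - w| dμ(w), where cap(K) = exp(-V). The level set is {exp g < θ /
cap(K)}. Frostman's theorem gives g ≥ 0 everywhere (`exists_robin`). Regularity is used once, to
obtain g ≤ 0 on K (`logMean_le_of_mem`), which places K inside the level set.

To bound g near a boundary point z₀ of the outer domain, let ν be the harmonic measure of a nearby
point z, built from solvability of the Dirichlet problem and the Riesz representation theorem.
Testing the minimality of μ against ν gives μ(T) g(z) ≤ u(z) - U(z), where U is the potential of the
part of μ on a set T away from z₀, and u solves the Dirichlet problem with data just above U
(`restrict_mul_green_le`). Hence g tends to 0 at z₀ from the outer domain. Semicontinuity does not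
carry this limit to g(z₀) itself; an average over the radii of circles about z₀ does
(`logMean_le_of_mem_frontier`). The minimum principle handles the rest of K.

For the rational functions, scale the coefficient vector of each q_n to sup norm 1. The polynomial
p_{n+1} q_n - p_n q_{n+1} has degree at most n + 1 and is geometrically small on K, so the
Bernstein–Walsh inequality bounds it by A lⁿ exp((n+1) g) with l just above cap(K)/θ. A normalized
polynomial of degree at most m is small only near at most m points (`exists_roots_lower_bound`). Off
disks of slowly decaying radii and small total size, p_n/q_n therefore converges geometrically
(`IsGeometric.exists_good_set`).

Some circle about each point of the level set misses all these disks. By the maximum principle the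
numerators p_n then converge locally uniformly to an analytic h, along a subsequence on which q_n
tends to some Q (`IsGeometric.uniformCauchySeqOn`), and F = h/Q. The whole sequence already
converges off the disks, so the subsequence serves only to identify the limit. On K, F agrees with f
off the zeros of Q, and at accumulation points of K the continuity of f rules out a pole
(`analyticAt_of_accPt`). -/

noncomputable section

namespace SigmaContent

/-! ### Superharmonic functions and the minimum principle. -/

/-- Lower semicontinuous functions with the super mean value property on small circles. -/
def SuperharmonicOn (s : ℂ → ℝ) (Ω : Set ℂ) : Prop :=
  LowerSemicontinuousOn s Ω ∧ ∀ z ∈ Ω, ∀ᶠ r in 𝓝[>] (0 : ℝ),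
    CircleIntegrable s z r ∧ Real.circleAverage s z r ≤ s z

/-- A function bounded below by its own average equals it almost everywhere, in particular somewhere
on the right half of the circle. Moving to the right is what lets the minimum principle do without
connectedness. -/
lemma exists_sphere_le_of_circleAverage_le {s : ℂ → ℝ} {a : ℂ} {r c : ℝ} (hr : 0 < r)
    (hi : CircleIntegrable s a r) (hge : ∀ z ∈ Metric.sphere a r, c ≤ s z)
    (havg : Real.circleAverage s a r ≤ c) :
    ∃ z ∈ Metric.sphere a r, a.re < z.re ∧ s z ≤ c := by
  by_contra! hcon
  have h2pi : (0 : ℝ) < 2 * Real.pi := by positivity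
  have hI : IntervalIntegrable (fun θ => s (circleMap a r θ)) volume 0 (2 * Real.pi) := hi
  have hI' : IntervalIntegrable (fun θ => s (circleMap a r θ) - c) volume 0 (2 * Real.pi) :=
    hI.sub (by simp)
  have hnn : ∀ θ, 0 ≤ s (circleMap a r θ) - c := fun θ =>
    sub_nonneg.2 (hge _ (circleMap_mem_sphere a hr.le θ))
  have hint : ∫ θ in (0 : ℝ)..2 * Real.pi, (s (circleMap a r θ) - c) ≤ 0 := by
    rw [intervalIntegral.integral_sub hI (by simp), intervalIntegral.integral_const]
    rw [Real.circleAverage_def, smul_eq_mul, inv_mul_le_iff₀ h2pi] at havg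
    simp only [smul_eq_mul]
    linarith
  have hint0 : ∫ θ in (0 : ℝ)..2 * Real.pi, (s (circleMap a r θ) - c) = 0 :=
    le_antisymm hint (intervalIntegral.integral_nonneg h2pi.le fun θ _ => hnn θ)
  rw [intervalIntegral.integral_eq_zero_iff_of_le_of_nonneg_ae h2pi.le
    (Eventually.of_forall hnn) hI'] at hint0
  -- The arc of angles in (0, 1) has positive measure and lies to the right of the center, since the
  -- cosine is positive there.
  have hsub : Ioo (0 : ℝ) 1 ⊆ Ioc 0 (2 * Real.pi) := fun x hx =>
    ⟨hx.1, by have := Real.pi_gt_three; linarith [hx.2]⟩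
  have h3 := ae_restrict_of_ae_restrict_of_subset hsub hint0
  replace h3 := (ae_restrict_iff' measurableSet_Ioo).1 h3
  have h4 : ∀ᵐ x ∂(volume : Measure ℝ), x ∉ Ioo (0 : ℝ) 1 := by
    filter_upwards [h3] with x hx hmem
    have h0 := hx hmem
    have hcos : 0 < Real.cos x := Real.cos_pos_of_mem_Ioo
      ⟨by have := Real.pi_gt_three; linarith [hmem.1], by
        have := Real.pi_gt_three; linarith [hmem.2]⟩
    have hre : a.re < (circleMap a r x).re := by
      simp only [circleMap, Complex.add_re, Complex.re_ofReal_mul, Complex.exp_ofReal_mul_I_re]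
      nlinarith [mul_pos hr hcos]
    have := hcon _ (circleMap_mem_sphere a hr.le x) hre
    simp only [Pi.zero_apply] at h0
    linarith
  have h5 := measure_eq_zero_iff_ae_notMem.2 h4
  simp at h5

/-- The minimum principle. -/
theorem SuperharmonicOn.le_of_boundary {s : ℂ → ℝ} {Ω : Set ℂ} (hΩ : IsOpen Ω)
    (hs : SuperharmonicOn s Ω) {M : ℝ}
    (hb : ∀ w ∈ frontier Ω, ∀ c < M, ∀ᶠ z in 𝓝[Ω] w, c < s z)
    (hinf : ∀ c < M, ∀ᶠ z in cocompact ℂ ⊓ 𝓟 Ω, c < s z) :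
    ∀ z ∈ Ω, M ≤ s z := by
  intro z₁ hz₁
  by_contra! hlt
  -- Sublevel sets below M stay away from the frontier and from infinity, so a value below M forces
  -- the minimum to be attained.
  have hcomp : ∀ c < M, IsCompact {z | z ∈ Ω ∧ s z ≤ c} := by
    intro c hc
    obtain ⟨T, hT, hT'⟩ : ∃ T, IsCompact T ∧ ∀ z ∈ Ω, z ∉ T → c < s z := by
      have := hinf c hc
      rw [eventually_inf_principal, hasBasis_cocompact.eventually_iff] at this
      obtain ⟨T, hT, h⟩ := this
      exact ⟨T, hT, fun z hz hzT => h hzT hz⟩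
    refine hT.of_isClosed_subset ?_ fun z hz => by
      by_contra h
      exact absurd hz.2 (not_le.2 (hT' z hz.1 h))
    refine isClosed_of_closure_subset fun z hz => ?_
    have hzc : z ∈ closure Ω := closure_mono (fun x hx => hx.1) hz
    have key : (∀ᶠ y in 𝓝[Ω] z, c < s y) → False := fun h => by
      rw [eventually_nhdsWithin_iff] at h
      obtain ⟨y, hy1, hy2⟩ := ((mem_closure_iff_frequently.1 hz).and_eventually h).exists
      exact absurd hy1.2 (not_le.2 (hy2 hy1.1))
    by_cases hzΩ : z ∈ Ω
    · refine ⟨hzΩ, ?_⟩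
      by_contra! h
      exact key (hs.1 z hzΩ c h)
    · exact (key (hb z ⟨hzc, by rwa [hΩ.interior_eq]⟩ c hc)).elim
  obtain ⟨a₀, ha₀, hmin⟩ := LowerSemicontinuousOn.exists_isMinOn (s := {z | z ∈ Ω ∧ s z ≤ s z₁})
    ⟨z₁, hz₁, le_rfl⟩ (hcomp _ hlt) (hs.1.mono fun z hz => hz.1)
  have hge : ∀ z ∈ Ω, s a₀ ≤ s z := fun z hz => by
    rcases le_total (s z) (s z₁) with h | h
    · exact hmin ⟨hz, h⟩
    · exact ha₀.2.trans h
  -- Take the minimizer with the largest real part; a small circle about it carries a minimizer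
  -- further to the right.
  obtain ⟨a, ha, hmax⟩ := (hcomp (s a₀) (ha₀.2.trans_lt hlt)).exists_isMaxOn
    ⟨a₀, ha₀.1, le_rfl⟩ Complex.continuous_re.continuousOn
  obtain ⟨δ, hδ, hball⟩ := Metric.isOpen_iff.1 hΩ a ha.1
  obtain ⟨r, ⟨hr1, hr2⟩, hr⟩ := ((hs.2 a ha.1).and (Ioo_mem_nhdsGT hδ)).exists
  have hsph : ∀ z ∈ Metric.sphere a r, z ∈ Ω := fun z hz => hball (by
    rw [Metric.mem_ball, Metric.mem_sphere.1 hz]; exact hr.2)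
  obtain ⟨z, hz, hzre, hzs⟩ := exists_sphere_le_of_circleAverage_le hr.1 hr1
    (fun z hz => hge z (hsph z hz)) (hr2.trans ha.2)
  exact absurd (hmax (a := z) ⟨hsph z hz, hzs⟩) (not_le.2 hzre)

lemma SuperharmonicOn.add {s t : ℂ → ℝ} {Ω : Set ℂ} (hs : SuperharmonicOn s Ω)
    (ht : SuperharmonicOn t Ω) : SuperharmonicOn (fun z => s z + t z) Ω := by
  refine ⟨hs.1.add ht.1, fun z hz => ?_⟩
  filter_upwards [hs.2 z hz, ht.2 z hz] with r h1 h2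
  refine ⟨h1.1.add h2.1, ?_⟩
  rw [Real.circleAverage_fun_add h1.1 h2.1]
  exact add_le_add h1.2 h2.2

lemma SuperharmonicOn.mono {s : ℂ → ℝ} {Ω Ω' : Set ℂ} (hs : SuperharmonicOn s Ω)
    (h : Ω' ⊆ Ω) : SuperharmonicOn s Ω' :=
  ⟨hs.1.mono h, fun z hz => hs.2 z (h hz)⟩

lemma SuperharmonicOn.const_mul {s : ℂ → ℝ} {Ω : Set ℂ} (hs : SuperharmonicOn s Ω) {c : ℝ}
    (hc : 0 ≤ c) : SuperharmonicOn (fun z => c * s z) Ω := by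
  rcases hc.eq_or_lt with rfl | hc
  · refine ⟨by simpa using (continuous_const.lowerSemicontinuous.lowerSemicontinuousOn _), ?_⟩
    intro z _
    exact Eventually.of_forall fun r => by simp [CircleIntegrable, Real.circleAverage_def]
  refine ⟨fun z hz y hy => ?_, fun z hz => ?_⟩
  · have h1 : y / c < s z := by rw [div_lt_iff₀ hc]; linarith
    filter_upwards [hs.1 z hz _ h1] with x hx
    have := (div_lt_iff₀ hc).1 hx
    simp only [gt_iff_lt]
    linarith
  · filter_upwards [hs.2 z hz] with r h1
    refine ⟨IntervalIntegrable.const_mul h1.1 c, ?_⟩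
    have := Real.circleAverage_fun_smul (𝕜 := ℝ) (a := c) (f := s) (c := z) (R := r)
    simp only [smul_eq_mul] at this
    rw [this]
    exact mul_le_mul_of_nonneg_left h1.2 hc.le

lemma superharmonicOn_of_harmonicOnNhd {u : ℂ → ℝ} {Ω : Set ℂ} (hΩ : IsOpen Ω)
    (hu : InnerProductSpace.HarmonicOnNhd u Ω) : SuperharmonicOn u Ω := by
  refine ⟨hu.continuousOn.lowerSemicontinuousOn, fun z hz => ?_⟩
  obtain ⟨δ, hδ, hball⟩ := Metric.isOpen_iff.1 hΩ z hz
  filter_upwards [Ioo_mem_nhdsGT hδ] with r hr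
  have hsub : Metric.closedBall z |r| ⊆ Ω :=
    (Metric.closedBall_subset_ball (by rw [abs_of_pos hr.1]; exact hr.2)).trans hball
  exact ⟨(hu.continuousOn.mono (Metric.sphere_subset_closedBall.trans hsub)).circleIntegrable',
    (InnerProductSpace.HarmonicOnNhd.circleAverage_eq (hu.mono hsub)).le⟩

/-! ### Logarithmic potentials: circle averages, semicontinuity, behavior at infinity. -/

/-- The function `z ↦ ∫ log |z - w| dμ(w)`, the negative of the logarithmic potential. -/
def logMean (μ : Measure ℂ) (z : ℂ) : ℝ := ∫ w, Real.log ‖z - w‖ ∂μ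

/-- The logarithmic kernel at `z` is `μ`-integrable and `z` is not an atom. -/
def LogIntegrableAt (μ : Measure ℂ) (z : ℂ) : Prop :=
  Integrable (fun w => Real.log ‖z - w‖) μ ∧ μ {z} = 0

lemma LogIntegrableAt.ae_ne {μ : Measure ℂ} {z : ℂ} (h : LogIntegrableAt μ z) :
    ∀ᵐ w ∂μ, 0 < ‖z - w‖ := by
  filter_upwards [measure_eq_zero_iff_ae_notMem.1 h.2] with w hw
  rw [norm_pos_iff, sub_ne_zero]
  exact fun h => hw h.symm

lemma measurable_log_norm_sub (z : ℂ) : Measurable fun w : ℂ => Real.log ‖z - w‖ := by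
  fun_prop

/-- Fubini together with the circle average of log|· - w|. Sub-mean value inequality, harmonicity
off the support and superharmonicity of the potential are all read off from this formula. -/
lemma circleAverage_logMean_aux {μ : Measure ℂ} [IsFiniteMeasure μ] {R : ℝ}
    (hR : ∀ᵐ w ∂μ, ‖w‖ ≤ R) (c : ℂ) {r : ℝ} (hr : 0 < r) :
    CircleIntegrable (logMean μ) c r ∧ Real.circleAverage (logMean μ) c r =
      ∫ w, (Real.log r + Real.posLog (r⁻¹ * ‖c - w‖)) ∂μ := by
  have h2pi : (0 : ℝ) < 2 * Real.pi := by positivity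
  set f : ℝ → ℂ → ℝ := fun θ w => Real.log ‖circleMap c r θ - w‖ with hf
  have hmeas : Measurable (Function.uncurry f) := by
    have : Measurable fun p : ℝ × ℂ => Real.log ‖circleMap c r p.1 - p.2‖ :=
      Real.measurable_log.comp (by
        have : Continuous fun p : ℝ × ℂ => ‖circleMap c r p.1 - p.2‖ := by fun_prop
        exact this.measurable)
    exact this
  have hcirc : ∀ w, IntervalIntegrable (fun θ => f θ w) volume 0 (2 * Real.pi) := fun w =>
    circleIntegrable_log_norm_sub_const (a := w) (c := c) r
  have hval : ∀ w, ∫ θ in (0 : ℝ)..2 * Real.pi, f θ w =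
      2 * Real.pi * (Real.log r + Real.posLog (r⁻¹ * ‖c - w‖)) := fun w => by
    have h := circleAverage_log_norm_sub_const_eq_log_radius_add_posLog (a := w) (c := c) hr.ne'
    rw [Real.circleAverage_def, smul_eq_mul, inv_mul_eq_iff_eq_mul₀ h2pi.ne'] at h
    exact h
  set B : ℝ := Real.posLog (‖c‖ + r + R)
  have habs : ∀ w, ‖w‖ ≤ R → ∫ θ in (0 : ℝ)..2 * Real.pi, ‖f θ w‖ ≤
      2 * Real.pi * (2 * B + |Real.log r|) := fun w hw => by
    -- From |log x| = 2 log⁺ x - log x: the integral of |f| is controlled by that of f, which is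
    -- known exactly.
    have h1 : ∀ θ, ‖f θ w‖ ≤ 2 * B - f θ w := fun θ => by
      have h2 := Real.half_mul_log_add_log_abs (x := ‖circleMap c r θ - w‖)
      have h3 : Real.posLog ‖circleMap c r θ - w‖ ≤ B := by
        refine Real.posLog_le_posLog (norm_nonneg _) ?_
        calc ‖circleMap c r θ - w‖ ≤ ‖circleMap c r θ‖ + ‖w‖ := norm_sub_le _ _
          _ ≤ ‖c‖ + r + R := by
            refine add_le_add ?_ hw
            rw [circleMap]
            refine (norm_add_le _ _).trans ?_
            simp [abs_of_pos hr]
      rw [Real.norm_eq_abs]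
      simp only [hf]
      linarith
    calc ∫ θ in (0 : ℝ)..2 * Real.pi, ‖f θ w‖
        ≤ ∫ θ in (0 : ℝ)..2 * Real.pi, (2 * B - f θ w) :=
          intervalIntegral.integral_mono h2pi.le (hcirc w).norm
            ((by simp : IntervalIntegrable (fun _ => 2 * B) volume 0 (2 * Real.pi)).sub (hcirc w)) h1
      _ = 2 * Real.pi * (2 * B) -
            2 * Real.pi * (Real.log r + Real.posLog (r⁻¹ * ‖c - w‖)) := by
          rw [intervalIntegral.integral_sub (by simp) (hcirc w), hval]
          simp only [intervalIntegral.integral_const, smul_eq_mul, sub_zero]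
      _ ≤ _ := by
          rw [← mul_sub]
          refine mul_le_mul_of_nonneg_left ?_ h2pi.le
          have := Real.posLog_nonneg (x := r⁻¹ * ‖c - w‖)
          linarith [neg_abs_le (Real.log r)]
  have hint : Integrable (Function.uncurry f)
      ((volume.restrict (Set.uIoc 0 (2 * Real.pi))).prod μ) := by
    rw [integrable_prod_iff' hmeas.aestronglyMeasurable]
    refine ⟨Eventually.of_forall fun w => ?_, ?_⟩
    · exact intervalIntegrable_iff.1 (hcirc w)
    · refine Integrable.of_bound (C := 2 * Real.pi * (2 * B + |Real.log r|)) ?_ ?_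
      · exact (StronglyMeasurable.integral_prod_right'
          (f := fun p : ℂ × ℝ => ‖Function.uncurry f (p.2, p.1)‖)
          (hmeas.comp measurable_swap).norm.stronglyMeasurable).aestronglyMeasurable
      · filter_upwards [hR] with w hw
        have := habs w hw
        rw [intervalIntegral.integral_of_le h2pi.le] at this
        rw [Set.uIoc_of_le h2pi.le, Real.norm_of_nonneg (integral_nonneg fun _ => norm_nonneg _)]
        exact this
  refine ⟨?_, ?_⟩
  · rw [CircleIntegrable, intervalIntegrable_iff]
    exact hint.integral_prod_left
  · rw [Real.circleAverage_def, smul_eq_mul]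
    have := intervalIntegral_integral_swap hint
    rw [show (∫ θ in (0 : ℝ)..2 * Real.pi, logMean μ (circleMap c r θ)) =
      ∫ θ in (0 : ℝ)..2 * Real.pi, ∫ w, f θ w ∂μ from rfl, this]
    simp_rw [hval]
    rw [integral_const_mul, inv_mul_cancel_left₀ h2pi.ne']

lemma integrable_log_radius_add_posLog {μ : Measure ℂ} [IsFiniteMeasure μ] {R : ℝ}
    (hR : ∀ᵐ w ∂μ, ‖w‖ ≤ R) (c : ℂ) {r : ℝ} (hr : 0 < r) :
    Integrable (fun w => Real.log r + Real.posLog (r⁻¹ * ‖c - w‖)) μ := by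
  refine (integrable_const _).add ?_
  refine Integrable.of_bound (C := Real.posLog (r⁻¹ * (‖c‖ + R))) ?_ ?_
  · exact (Real.continuous_posLog.comp (by fun_prop)).aestronglyMeasurable
  · filter_upwards [hR] with w hw
    rw [Real.norm_of_nonneg Real.posLog_nonneg]
    refine Real.posLog_le_posLog (by positivity) ?_
    gcongr
    exact (norm_sub_le _ _).trans (by gcongr)

lemma logMean_le_circleAverage {μ : Measure ℂ} [IsFiniteMeasure μ] {R : ℝ}
    (hR : ∀ᵐ w ∂μ, ‖w‖ ≤ R) {c : ℂ} (hc : LogIntegrableAt μ c) {r : ℝ} (hr : 0 < r) :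
    logMean μ c ≤ Real.circleAverage (logMean μ) c r := by
  rw [(circleAverage_logMean_aux hR c hr).2]
  refine integral_mono_ae hc.1 (integrable_log_radius_add_posLog hR c hr) ?_
  filter_upwards [hc.ae_ne] with w hw
  have : Real.log ‖c - w‖ = Real.log r + Real.log (r⁻¹ * ‖c - w‖) := by
    rw [← Real.log_mul hr.ne' (by positivity), mul_inv_cancel_left₀ hr.ne']
  simp only [this]
  gcongr
  exact le_max_right _ _

lemma circleAverage_logMean {μ : Measure ℂ} [IsFiniteMeasure μ] {R : ℝ}
    (hR : ∀ᵐ w ∂μ, ‖w‖ ≤ R) {c : ℂ} {r : ℝ} (hr : 0 < r) (hrc : ∀ᵐ w ∂μ, r ≤ ‖c - w‖) :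
    Real.circleAverage (logMean μ) c r = logMean μ c := by
  rw [(circleAverage_logMean_aux hR c hr).2]
  refine integral_congr_ae ?_
  filter_upwards [hrc] with w hw
  have h0 : 0 < ‖c - w‖ := hr.trans_le hw
  have h1 : 1 ≤ r⁻¹ * ‖c - w‖ := by rw [inv_mul_eq_div, le_div_iff₀ hr]; linarith
  rw [Real.posLog_eq_log (by rwa [abs_of_nonneg (by positivity)]),
    ← Real.log_mul hr.ne' (by positivity), mul_inv_cancel_left₀ hr.ne']

lemma abs_log_le_of_mem_Icc {a b x : ℝ} (ha : 0 < a) (hx : x ∈ Icc a b) :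
    |Real.log x| ≤ |Real.log a| + |Real.log b| := by
  have h1 := Real.log_le_log ha hx.1
  have h2 := Real.log_le_log (ha.trans_le hx.1) hx.2
  rw [abs_le]
  constructor
  · linarith [neg_abs_le (Real.log a), abs_nonneg (Real.log b)]
  · linarith [le_abs_self (Real.log b), abs_nonneg (Real.log a)]

lemma logIntegrableAt_of_dist {μ : Measure ℂ} [IsFiniteMeasure μ] {R : ℝ}
    (hR : ∀ᵐ w ∂μ, ‖w‖ ≤ R) {z : ℂ} {δ : ℝ} (hδ : 0 < δ) (hz : ∀ᵐ w ∂μ, δ ≤ ‖z - w‖) :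
    LogIntegrableAt μ z := by
  constructor
  · refine Integrable.of_bound (C := |Real.log δ| + |Real.log (‖z‖ + R)|)
      (measurable_log_norm_sub z).aestronglyMeasurable ?_
    filter_upwards [hR, hz] with w hw1 hw2
    exact abs_log_le_of_mem_Icc hδ ⟨hw2, (norm_sub_le _ _).trans (by gcongr)⟩
  · rw [measure_eq_zero_iff_ae_notMem]
    filter_upwards [hz] with w hw hmem
    rw [mem_singleton_iff.1 hmem] at hw
    simp only [sub_self, norm_zero] at hw
    linarith

lemma continuousAt_logMean {μ : Measure ℂ} [IsFiniteMeasure μ] {R : ℝ}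
    (hR : ∀ᵐ w ∂μ, ‖w‖ ≤ R) {z : ℂ} {δ : ℝ} (hδ : 0 < δ) (hz : ∀ᵐ w ∂μ, δ ≤ ‖z - w‖) :
    ContinuousAt (logMean μ) z := by
  refine continuousAt_of_dominated
    (bound := fun _ => |Real.log (δ / 2)| + |Real.log (‖z‖ + δ + R)|)
    (Eventually.of_forall fun x => (measurable_log_norm_sub x).aestronglyMeasurable) ?_
    (integrable_const _) ?_
  · filter_upwards [Metric.ball_mem_nhds z (half_pos hδ)] with x hx
    filter_upwards [hR, hz] with w hw1 hw2
    rw [mem_ball_iff_norm] at hx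
    refine abs_log_le_of_mem_Icc (half_pos hδ) ⟨?_, ?_⟩
    · have : ‖z - w‖ ≤ ‖x - z‖ + ‖x - w‖ := by
        rw [norm_sub_rev x z]; exact norm_sub_le_norm_sub_add_norm_sub z x w
      linarith
    · have h1 : ‖x - w‖ ≤ ‖x‖ + ‖w‖ := norm_sub_le _ _
      have h2 : ‖x‖ ≤ ‖x - z‖ + ‖z‖ := by simpa using norm_add_le (x - z) z
      linarith
  · filter_upwards [hz] with w hw
    refine ContinuousAt.log (by fun_prop) ?_
    linarith

lemma superharmonicOn_logMean {μ : Measure ℂ} [IsFiniteMeasure μ] {R : ℝ}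
    (hR : ∀ᵐ w ∂μ, ‖w‖ ≤ R) {S : Set ℂ} (hS : IsClosed S) (hμ : μ Sᶜ = 0) :
    SuperharmonicOn (logMean μ) Sᶜ := by
  have key : ∀ z ∈ Sᶜ, ∃ δ > 0, ∀ᵐ w ∂μ, δ ≤ ‖z - w‖ := fun z hz => by
    obtain ⟨δ, hδ, hb⟩ := Metric.isOpen_iff.1 hS.isOpen_compl z hz
    refine ⟨δ, hδ, ?_⟩
    filter_upwards [measure_eq_zero_iff_ae_notMem.1 hμ] with w hw
    by_contra! h
    exact hw (hb (by rwa [mem_ball_iff_norm, norm_sub_rev]))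
  refine ⟨fun z hz => ?_, fun z hz => ?_⟩
  · obtain ⟨δ, hδ, h⟩ := key z hz
    exact (continuousAt_logMean hR hδ h).continuousWithinAt.lowerSemicontinuousWithinAt
  · obtain ⟨δ, hδ, h⟩ := key z hz
    filter_upwards [Ioo_mem_nhdsGT hδ] with r hr
    refine ⟨(circleAverage_logMean_aux hR z hr.1).1, (circleAverage_logMean hR hr.1 ?_).le⟩
    filter_upwards [h] with w hw using hr.2.le.trans hw

lemma log_half_norm_le_logMean {μ : Measure ℂ} [IsProbabilityMeasure μ] {R : ℝ}
    (hR0 : 0 < R) (hR : ∀ᵐ w ∂μ, ‖w‖ ≤ R) {z : ℂ} (hz : 2 * R ≤ ‖z‖) :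
    Real.log (‖z‖ / 2) ≤ logMean μ z := by
  have h1 : ∀ᵐ w ∂μ, ‖z‖ / 2 ≤ ‖z - w‖ := by
    filter_upwards [hR] with w hw
    have := norm_sub_norm_le z w
    linarith
  have hz0 : 0 < ‖z‖ / 2 := by linarith
  calc Real.log (‖z‖ / 2) = ∫ _, Real.log (‖z‖ / 2) ∂μ := by simp
    _ ≤ logMean μ z := by
      refine integral_mono_ae (integrable_const _) (logIntegrableAt_of_dist hR hz0 h1).1 ?_
      filter_upwards [h1] with w hw
      exact Real.log_le_log hz0 hw

lemma tendsto_logMean_cocompact {μ : Measure ℂ} [IsProbabilityMeasure μ] {R : ℝ}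
    (hR : ∀ᵐ w ∂μ, ‖w‖ ≤ R) : Tendsto (logMean μ) (cocompact ℂ) atTop := by
  have hR' : ∀ᵐ w ∂μ, ‖w‖ ≤ |R| + 1 := by
    filter_upwards [hR] with w hw
    linarith [le_abs_self R]
  have h1 : Tendsto (fun z : ℂ => Real.log (‖z‖ / 2)) (cocompact ℂ) atTop :=
    Real.tendsto_log_atTop.comp ((tendsto_norm_cocompact_atTop (E := ℂ)).atTop_div_const two_pos)
  refine tendsto_atTop_mono' _ ?_ h1
  filter_upwards [(tendsto_norm_cocompact_atTop (E := ℂ)).eventually_ge_atTop (2 * (|R| + 1))]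
    with z hz
  exact log_half_norm_le_logMean (by positivity) hR' hz

/-- The truncated kernels log max(ρ, |z - w|) have integrals continuous in z which dominate the
potential and converge to it at z₀ as ρ tends to 0. -/
lemma upperSemicontinuous_logMean {μ : Measure ℂ} [IsFiniteMeasure μ] {R : ℝ}
    (hR : ∀ᵐ w ∂μ, ‖w‖ ≤ R) (hμ : ∀ z, LogIntegrableAt μ z) :
    UpperSemicontinuous (logMean μ) := by
  intro z₀ c hc
  set F : ℝ → ℂ → ℝ := fun ρ z => ∫ w, Real.log (max ρ ‖z - w‖) ∂μ with hF
  have hFmeas : ∀ ρ z, AEStronglyMeasurable (fun w => Real.log (max ρ ‖z - w‖)) μ := fun ρ z =>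
    (Measurable.log (by fun_prop)).aestronglyMeasurable
  have hlim : Tendsto (fun n : ℕ => F (1 / ((n : ℝ) + 1)) z₀) atTop (𝓝 (logMean μ z₀)) := by
    refine tendsto_integral_of_dominated_convergence
      (fun w => |Real.log ‖z₀ - w‖| + |Real.log (max 1 (‖z₀‖ + R))|)
      (fun n => hFmeas _ _) ((hμ z₀).1.abs.add (integrable_const _)) ?_ ?_
    · intro n
      filter_upwards [hR, (hμ z₀).ae_ne] with w hw hw0
      refine abs_log_le_of_mem_Icc hw0 ⟨le_max_right _ _, max_le_max ?_ ?_⟩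
      · rw [div_le_one (by positivity)]
        linarith [(Nat.cast_nonneg n : (0 : ℝ) ≤ n)]
      · exact (norm_sub_le _ _).trans (by gcongr)
    · filter_upwards [(hμ z₀).ae_ne] with w hw0
      have h1 : Tendsto (fun n : ℕ => max (1 / ((n : ℝ) + 1)) ‖z₀ - w‖) atTop
          (𝓝 (max 0 ‖z₀ - w‖)) := tendsto_one_div_add_atTop_nhds_zero_nat.max tendsto_const_nhds
      rw [max_eq_right hw0.le] at h1
      exact h1.log hw0.ne'
  obtain ⟨n, hn⟩ := (hlim.eventually (gt_mem_nhds hc)).exists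
  set ρ : ℝ := 1 / ((n : ℝ) + 1)
  have hρ : 0 < ρ := by positivity
  have hbd : ∀ z, ‖z - z₀‖ < 1 → ∀ᵐ w ∂μ, ‖Real.log (max ρ ‖z - w‖)‖ ≤
      |Real.log ρ| + |Real.log (max ρ (‖z₀‖ + 1 + R))| := fun z hz => by
    filter_upwards [hR] with w hw
    refine abs_log_le_of_mem_Icc hρ ⟨le_max_left _ _, max_le_max le_rfl ?_⟩
    have h1 : ‖z - w‖ ≤ ‖z‖ + ‖w‖ := norm_sub_le _ _
    have h2 : ‖z‖ ≤ ‖z - z₀‖ + ‖z₀‖ := by simpa using norm_add_le (z - z₀) z₀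
    linarith
  have hcont : ContinuousAt (F ρ) z₀ := by
    refine continuousAt_of_dominated
      (bound := fun _ => |Real.log ρ| + |Real.log (max ρ (‖z₀‖ + 1 + R))|)
      (Eventually.of_forall fun x => hFmeas _ _) ?_ (integrable_const _) ?_
    · filter_upwards [Metric.ball_mem_nhds z₀ one_pos] with z hz
      exact hbd z (mem_ball_iff_norm.1 hz)
    · refine Eventually.of_forall fun w => ContinuousAt.log (by fun_prop) ?_
      exact (lt_max_of_lt_left hρ).ne'
  filter_upwards [hcont.eventually (gt_mem_nhds hn), Metric.ball_mem_nhds z₀ one_pos] with z hz hz1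
  refine lt_of_le_of_lt ?_ hz
  refine integral_mono_ae (hμ z).1
    (Integrable.of_bound (hFmeas _ _) _ (hbd z (mem_ball_iff_norm.1 hz1))) ?_
  filter_upwards [(hμ z).ae_ne] with w hw
  exact Real.log_le_log hw (le_max_right _ _)

lemma superharmonicOn_neg_logMean {μ : Measure ℂ} [IsFiniteMeasure μ] {R : ℝ}
    (hR : ∀ᵐ w ∂μ, ‖w‖ ≤ R) (hμ : ∀ z, LogIntegrableAt μ z) (Ω : Set ℂ) :
    SuperharmonicOn (fun z => -logMean μ z) Ω := by
  refine ⟨fun z _ y hy => ?_, fun z _ => ?_⟩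
  · have hy' : logMean μ z < -y := by simp only at hy; linarith
    filter_upwards [(upperSemicontinuous_logMean hR hμ z _ hy').filter_mono nhdsWithin_le_nhds]
      with x hx
    simp only [gt_iff_lt]
    linarith
  · filter_upwards [self_mem_nhdsWithin] with r hr
    refine ⟨IntervalIntegrable.neg (circleAverage_logMean_aux hR z hr).1, ?_⟩
    have h := Real.circleAverage_fun_smul (𝕜 := ℝ) (a := (-1 : ℝ)) (f := logMean μ) (c := z) (R := r)
    simp only [smul_eq_mul, neg_mul, one_mul] at h
    rw [h]
    exact neg_le_neg (logMean_le_circleAverage hR (hμ z) hr)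

/-! ### Energy minimization with a nonnegative kernel, where Tonelli and Fatou need no
integrability. -/

/-- The nonnegative kernel `log⁺ (A / |z - w|)`, with the value `∞` for `z = w`. -/
def logKer (A : ℝ) (z w : ℂ) : ℝ≥0∞ := (ENNReal.log (ENNReal.ofReal A / ‖z - w‖ₑ)).toENNReal

lemma continuous_logKer (A : ℝ) : Continuous fun p : ℂ × ℂ => logKer A p.1 p.2 := by
  have h1 : Continuous fun p : ℂ × ℂ => ENNReal.ofReal A / ‖p.1 - p.2‖ₑ := by
    simp_rw [div_eq_mul_inv]
    exact (ENNReal.continuous_const_mul ENNReal.ofReal_ne_top).comp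
      (continuous_inv.comp (by fun_prop))
  exact EReal.continuous_toENNReal.comp (ENNReal.continuous_log.comp h1)

lemma measurable_logKer (A : ℝ) : Measurable fun p : ℂ × ℂ => logKer A p.1 p.2 :=
  (continuous_logKer A).measurable

lemma measurable_logKer_right (A : ℝ) (z : ℂ) : Measurable (logKer A z) :=
  Measurable.of_uncurry_left (f := logKer A) (measurable_logKer A)

lemma logKer_comm (A : ℝ) (z w : ℂ) : logKer A z w = logKer A w z := by
  simp only [logKer, ← ofReal_norm, norm_sub_rev z w]

lemma logKer_self {A : ℝ} (hA : 0 < A) (z : ℂ) : logKer A z z = ⊤ := by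
  simp [logKer, ENNReal.div_zero (ENNReal.ofReal_pos.2 hA).ne']

lemma logKer_of_ne {A : ℝ} (hA : 0 < A) {z w : ℂ} (h : 0 < ‖z - w‖) :
    logKer A z w = ENNReal.ofReal (Real.log A - Real.log ‖z - w‖) := by
  rw [logKer, ← ofReal_norm, ← ENNReal.ofReal_div_of_pos h,
    ENNReal.log_ofReal_of_pos (div_pos hA h), EReal.toENNReal_of_ne_top (EReal.coe_ne_top _),
    EReal.toReal_coe, Real.log_div hA.ne' h.ne']

/-- The potential of the kernel `logKer A`. -/
def pot (A : ℝ) (ν : Measure ℂ) (z : ℂ) : ℝ≥0∞ := ∫⁻ w, logKer A z w ∂ν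

/-- The energy of the kernel `logKer A`. -/
def energy (A : ℝ) (ν : Measure ℂ) : ℝ≥0∞ := ∫⁻ z, pot A ν z ∂ν

lemma measurable_pot (A : ℝ) (ν : Measure ℂ) [SFinite ν] : Measurable (pot A ν) :=
  (measurable_logKer A).lintegral_prod_right'

lemma lintegral_pot_comm (A : ℝ) (μ ν : Measure ℂ) [SFinite μ] [SFinite ν] :
    ∫⁻ z, pot A μ z ∂ν = ∫⁻ z, pot A ν z ∂μ := by
  unfold pot
  rw [lintegral_lintegral_swap (measurable_logKer A).aemeasurable]
  simp_rw [logKer_comm A]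

/-- Fatou's lemma: potentials of a nonnegative continuous kernel are lower semicontinuous. -/
lemma isClosed_pot_le (A : ℝ) (ν : Measure ℂ) (v : ℝ≥0∞) :
    IsClosed {z | pot A ν z ≤ v} := by
  refine IsSeqClosed.isClosed fun x z hx hz => ?_
  have h1 : ∀ w, liminf (fun n => logKer A (x n) w) atTop = logKer A z w := fun w =>
    (((continuous_logKer A).comp (continuous_id.prodMk continuous_const)).tendsto z
      |>.comp hz).liminf_eq
  calc pot A ν z = ∫⁻ w, liminf (fun n => logKer A (x n) w) atTop ∂ν := by simp_rw [h1]; rfl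
    _ ≤ liminf (fun n => pot A ν (x n)) atTop :=
      lintegral_liminf_le fun n => measurable_logKer_right A _
    _ ≤ v := by
      refine liminf_le_of_frequently_le' (Frequently.of_forall hx)

lemma pot_eq_ofReal {A : ℝ} (hA : 0 < A) {ν : Measure ℂ} [IsFiniteMeasure ν] {z : ℂ}
    (hz : ∀ᵐ w ∂ν, ‖z - w‖ ≤ A) (h : LogIntegrableAt ν z) :
    pot A ν z = ENNReal.ofReal (ν.real univ * Real.log A - logMean ν z) := by
  have h1 : pot A ν z = ∫⁻ w, ENNReal.ofReal (Real.log A - Real.log ‖z - w‖) ∂ν := by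
    refine lintegral_congr_ae ?_
    filter_upwards [h.ae_ne] with w hw using logKer_of_ne hA hw
  have h2 : Integrable (fun w => Real.log A - Real.log ‖z - w‖) ν := (integrable_const _).sub h.1
  rw [h1, ← ofReal_integral_eq_lintegral_ofReal h2, integral_sub (integrable_const _) h.1]
  · simp [logMean]
  · filter_upwards [hz, h.ae_ne] with w hw hw0
    simpa using Real.log_le_log hw0 hw

lemma logMean_le_of_ae_le {A : ℝ} {ν : Measure ℂ} [IsFiniteMeasure ν] {z : ℂ}
    (hz : ∀ᵐ w ∂ν, ‖z - w‖ ≤ A) (h : LogIntegrableAt ν z) :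
    logMean ν z ≤ ν.real univ * Real.log A := by
  have : ∫ _, Real.log A ∂ν = ν.real univ * Real.log A := by simp
  rw [← this]
  refine integral_mono_ae h.1 (integrable_const _) ?_
  filter_upwards [hz, h.ae_ne] with w hw hw0 using Real.log_le_log hw0 hw

lemma logIntegrableAt_of_pot_lt_top {A : ℝ} (hA : 0 < A) {ν : Measure ℂ} [IsFiniteMeasure ν]
    {z : ℂ} (hz : ∀ᵐ w ∂ν, ‖z - w‖ ≤ A) (h : pot A ν z < ⊤) : LogIntegrableAt ν z := by
  have h0 : ν {z} = 0 := by
    by_contra hne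
    have : ∫⁻ w in {z}, logKer A z w ∂ν ≤ pot A ν z := setLIntegral_le_lintegral _ _
    rw [Measure.restrict_singleton, lintegral_smul_measure, lintegral_dirac, logKer_self hA,
      smul_eq_mul, ENNReal.mul_top hne] at this
    exact absurd (this.trans_lt h) (lt_irrefl _)
  refine ⟨?_, h0⟩
  have hae : ∀ᵐ w ∂ν, 0 < ‖z - w‖ := by
    filter_upwards [measure_eq_zero_iff_ae_notMem.1 h0] with w hw
    rw [norm_pos_iff, sub_ne_zero]
    exact fun h => hw h.symm
  have h1 : Integrable (fun w => Real.log A - Real.log ‖z - w‖) ν := by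
    refine ⟨((measurable_log_norm_sub z).const_sub _).aestronglyMeasurable, ?_⟩
    rw [hasFiniteIntegral_iff_ofReal]
    · refine lt_of_eq_of_lt (lintegral_congr_ae ?_) h
      filter_upwards [hae] with w hw using (logKer_of_ne hA hw).symm
    · filter_upwards [hz, hae] with w hw hw0
      simpa using Real.log_le_log hw0 hw
  refine ((integrable_const (Real.log A)).sub h1).congr (Eventually.of_forall fun w => ?_)
  simp

/-- The energy of (1 - t)μ + tν is a quadratic in t that is minimal at t = 0, so its derivative
there is nonnegative. -/
lemma le_lintegral_pot_of_minimal {A : ℝ} {K : Set ℂ} {μ : Measure ℂ}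
    (hμ : μ ∈ probOn K) (hfin : energy A μ ≠ ⊤) (hmin : ∀ ν ∈ probOn K, energy A μ ≤ energy A ν)
    {ν : Measure ℂ} (hν : ν ∈ probOn K) (hνfin : energy A ν ≠ ⊤) :
    energy A μ ≤ ∫⁻ z, pot A μ z ∂ν := by
  have := hμ.1
  have := hν.1
  by_contra! hlt
  set v := (energy A μ).toReal
  set e := (energy A ν).toReal
  have hmfin : ∫⁻ z, pot A μ z ∂ν ≠ ⊤ := (hlt.trans_le le_top).ne
  set m := (∫⁻ z, pot A μ z ∂ν).toReal with hm
  have hmv : m < v := (ENNReal.toReal_lt_toReal hmfin hfin).2 hlt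
  have key : ∀ t : ℝ, 0 < t → t < 1 → v ≤ (1 - t) ^ 2 * v + 2 * t * (1 - t) * m + t ^ 2 * e := by
    intro t ht ht1
    set a := ENNReal.ofReal (1 - t)
    set b := ENNReal.ofReal t
    have hab : a + b = 1 := by
      rw [← ENNReal.ofReal_add (by linarith) ht.le]; simp
    have hmem : a • μ + b • ν ∈ probOn K := by
      refine ⟨⟨?_⟩, ?_⟩
      · simp [hab]
      · simp [hμ.2, hν.2]
    have hen : energy A (a • μ + b • ν) =
        a * a * energy A μ + 2 * a * b * (∫⁻ z, pot A μ z ∂ν) + b * b * energy A ν := by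
      have hp : ∀ z, pot A (a • μ + b • ν) z = a * pot A μ z + b * pot A ν z := fun z => by
        simp [pot, lintegral_add_measure, lintegral_smul_measure]
      have hc := lintegral_pot_comm A μ ν
      simp only [energy, hp] at hc ⊢
      rw [lintegral_add_measure, lintegral_smul_measure, lintegral_smul_measure,
        lintegral_add_left ((measurable_pot A μ).const_mul a),
        lintegral_add_left ((measurable_pot A μ).const_mul a),
        lintegral_const_mul _ (measurable_pot A μ), lintegral_const_mul _ (measurable_pot A μ),
        lintegral_const_mul _ (measurable_pot A ν), lintegral_const_mul _ (measurable_pot A ν),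
        ← hc]
      simp only [smul_eq_mul]
      ring
    have h := hmin _ hmem
    rw [hen] at h
    have h2 := ENNReal.toReal_mono (by finiteness) h
    rw [ENNReal.toReal_add (by finiteness) (by finiteness),
      ENNReal.toReal_add (by finiteness) (by finiteness)] at h2
    simp only [ENNReal.toReal_mul, a, b, ENNReal.toReal_ofReal ht.le,
      ENNReal.toReal_ofReal (show 0 ≤ 1 - t by linarith), ENNReal.toReal_ofNat] at h2
    change v ≤ _ at h2
    simp only [← hm] at h2
    linear_combination h2
  set q := |v - 2 * m + e|
  have hq : 0 ≤ q := abs_nonneg _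
  -- Minimality gives 2(v - m) ≤ t(v - 2m + e); this t lies in (0, 1) and makes the right side at
  -- most v - m.
  set t := (v - m) / (q + (v - m) + 1)
  have hden : 0 < q + (v - m) + 1 := by linarith
  have ht : 0 < t := div_pos (by linarith) hden
  have ht1 : t < 1 := by rw [div_lt_one hden]; linarith
  have htq : t * q ≤ v - m := by
    rw [div_mul_eq_mul_div, div_le_iff₀ hden]
    nlinarith
  have h1 := key t ht ht1
  have h2 : t * (2 * (v - m)) ≤ t * (t * (v - 2 * m + e)) := by nlinarith
  have h3 := le_of_mul_le_mul_left h2 ht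
  have h4 : t * (v - 2 * m + e) ≤ t * q := mul_le_mul_of_nonneg_left (le_abs_self _) ht.le
  linarith

/-- If the potential were below the energy on a set of positive measure, the normalized restriction
of μ to it would contradict the variational inequality. So the potential is at least its own mean,
hence almost everywhere equal to it. -/
lemma ae_pot_le_of_minimal {A : ℝ} {K : Set ℂ} {μ : Measure ℂ}
    (hμ : μ ∈ probOn K) (hfin : energy A μ ≠ ⊤)
    (hmin : ∀ ν ∈ probOn K, energy A μ ≤ energy A ν) :
    ∀ᵐ z ∂μ, pot A μ z ≤ energy A μ := by
  have := hμ.1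
  set B : Set ℂ := {z | pot A μ z < energy A μ} with hB
  have hBm : MeasurableSet B := measurableSet_lt (measurable_pot A μ) measurable_const
  have hB0 : μ B = 0 := by
    by_contra hne
    set ν : Measure ℂ := (μ B)⁻¹ • μ.restrict B with hν
    have hνp : ν ∈ probOn K := by
      refine ⟨⟨?_⟩, ?_⟩
      · simp [hν, ENNReal.inv_mul_cancel hne (measure_ne_top _ _)]
      · have : μ.restrict B Kᶜ = 0 := nonpos_iff_eq_zero.1 ((Measure.restrict_le_self _).trans hμ.2.le)
        simp [hν, this]
    have hinv : (μ B)⁻¹ ≠ ⊤ := by simpa using hne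
    have hle : ∀ z, pot A ν z ≤ (μ B)⁻¹ * pot A μ z := fun z => by
      rw [pot, hν, lintegral_smul_measure, smul_eq_mul]
      gcongr
      exact setLIntegral_le_lintegral _ _
    have hνfin : energy A ν ≠ ⊤ := by
      refine ne_top_of_le_ne_top (b := (μ B)⁻¹ * ((μ B)⁻¹ * energy A μ)) (by finiteness) ?_
      calc energy A ν ≤ ∫⁻ z, (μ B)⁻¹ * pot A μ z ∂ν := lintegral_mono hle
        _ = (μ B)⁻¹ * ((μ B)⁻¹ * ∫⁻ z in B, pot A μ z ∂μ) := by
          rw [lintegral_const_mul _ (measurable_pot A μ), hν, lintegral_smul_measure, smul_eq_mul]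
        _ ≤ _ := by
          gcongr
          exact setLIntegral_le_lintegral _ _
    have h1 := le_lintegral_pot_of_minimal hμ hfin hmin hνp hνfin
    have h2 : ∫⁻ z, pot A μ z ∂ν < energy A μ := by
      rw [hν, lintegral_smul_measure, smul_eq_mul]
      have h3 : ∫⁻ z in B, pot A μ z ∂μ < ∫⁻ _ in B, energy A μ ∂μ := by
        refine setLIntegral_strict_mono hBm hne measurable_const ?_ ?_
        · exact ((setLIntegral_le_lintegral _ _).trans_lt hfin.lt_top).ne
        · exact Eventually.of_forall fun z hz => hz
      rw [setLIntegral_const] at h3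
      calc (μ B)⁻¹ * ∫⁻ z in B, pot A μ z ∂μ < (μ B)⁻¹ * (energy A μ * μ B) :=
            ENNReal.mul_lt_mul_right (ENNReal.inv_ne_zero.2 (measure_ne_top _ _)) hinv h3
        _ = energy A μ := by
          rw [mul_comm, mul_assoc, ENNReal.mul_inv_cancel hne (measure_ne_top _ _), mul_one]
    exact absurd (h1.trans_lt h2) (lt_irrefl _)
  have hge : (fun _ => energy A μ) ≤ᵐ[μ] pot A μ := by
    filter_upwards [measure_eq_zero_iff_ae_notMem.1 hB0] with z hz
    exact not_lt.1 hz
  have heq : (fun _ => energy A μ) =ᵐ[μ] pot A μ := by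
    refine ae_eq_of_ae_le_of_lintegral_le hge (by simpa using hfin)
      (measurable_pot A μ).aemeasurable ?_
    simp [energy]
  filter_upwards [heq] with z hz using hz.symm.le


/-! ### The maximum principle for potentials and Frostman's theorem. -/

lemma exists_isMinOn_dist_of_isCompact {S : Set ℂ} (hS : IsCompact S) (hne : S.Nonempty) (z : ℂ) :
    ∃ y ∈ S, ∀ w ∈ S, ‖z - y‖ ≤ ‖z - w‖ := by
  obtain ⟨y, hy, h⟩ := hS.exists_isMinOn hne (f := fun w => ‖z - w‖) (by fun_prop)
  exact ⟨y, hy, fun w hw => h hw⟩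

lemma exists_measureReal_closedBall_lt {μ : Measure ℂ} [IsFiniteMeasure μ] {w₀ : ℂ}
    (h : μ {w₀} = 0) {η : ℝ} (hη : 0 < η) : ∃ δ > 0, μ.real (Metric.closedBall w₀ δ) < η := by
  have h1 : Tendsto (fun δ => μ (Metric.closedBall w₀ δ)) (𝓝[>] 0) (𝓝 (μ {w₀})) := by
    have := tendsto_measure_cthickening_of_isClosed (μ := μ) (s := {w₀})
      ⟨1, one_pos, measure_ne_top _ _⟩ isClosed_singleton
    refine (this.mono_left nhdsWithin_le_nhds).congr' ?_
    filter_upwards [self_mem_nhdsWithin] with δ hδ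
    rw [Metric.cthickening_singleton _ (le_of_lt hδ)]
  rw [h] at h1
  have h2 := (ENNReal.tendsto_toReal ENNReal.zero_ne_top).comp h1
  obtain ⟨δ, h3, h4⟩ := ((h2.eventually (gt_mem_nhds hη)).and self_mem_nhdsWithin).exists
  exact ⟨δ, h4, h3⟩

/-- The maximum principle for potentials. -/
theorem neg_le_logMean_of_forall_mem {μ : Measure ℂ} [IsProbabilityMeasure μ] {S : Set ℂ}
    (hS : IsCompact S) (hμ : μ Sᶜ = 0) {V : ℝ}
    (hint : ∀ z ∈ S, LogIntegrableAt μ z) (hV : ∀ z ∈ S, -V ≤ logMean μ z) :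
    ∀ z, LogIntegrableAt μ z ∧ -V ≤ logMean μ z := by
  have haeS : ∀ᵐ w ∂μ, w ∈ S := by
    filter_upwards [measure_eq_zero_iff_ae_notMem.1 hμ] with w hw using not_not.1 hw
  obtain ⟨R, hR⟩ := hS.isBounded.exists_norm_le
  have haeR : ∀ᵐ w ∂μ, ‖w‖ ≤ R := haeS.mono fun w hw => hR w hw
  have hint' : ∀ z, LogIntegrableAt μ z := fun z => by
    by_cases hz : z ∈ S
    · exact hint z hz
    · obtain ⟨δ, hδ, hb⟩ := Metric.isOpen_iff.1 hS.isClosed.isOpen_compl z hz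
      refine logIntegrableAt_of_dist haeR hδ ?_
      filter_upwards [haeS] with w hw
      by_contra! h
      exact hb (by rwa [mem_ball_iff_norm, norm_sub_rev]) hw
  refine fun z => ⟨hint' z, ?_⟩
  by_cases hz : z ∈ S
  · exact hV z hz
  refine SuperharmonicOn.le_of_boundary hS.isClosed.isOpen_compl
    (superharmonicOn_logMean haeR hS.isClosed hμ) ?_ ?_ z hz
  · intro w₀ hw₀ c hc
    have hw₀S : w₀ ∈ S := by
      rw [frontier_compl] at hw₀
      exact hS.isClosed.frontier_subset hw₀
    set η := (-V - c) / 2 with hη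
    have hη0 : 0 < η := by simp only [hη]; linarith
    obtain ⟨δ, hδ, hδμ'⟩ := exists_measureReal_closedBall_lt (hint' w₀).2
      (div_pos hη0 (Real.log_pos one_lt_two))
    have hδμ := (lt_div_iff₀ (Real.log_pos one_lt_two)).1 hδμ'
    -- The first bound keeps z at distance at least δ/2 from points outside the δ-ball; the second
    -- makes |y - w| ≤ (1 + η)|z - w| for such w.
    set ε := min (δ / 4) (η * δ / 4) with hε
    have hε0 : 0 < ε := by positivity
    rw [eventually_nhdsWithin_iff]
    filter_upwards [Metric.ball_mem_nhds w₀ hε0] with z hzb hzS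
    rw [mem_ball_iff_norm] at hzb
    -- For the point y of S nearest to z, |y - w| ≤ 2|z - w| on S. The factor 2 is paid only on a
    -- ball of mass below η / log 2, so the potentials at y and z differ by less than 2η = -V - c in
    -- the needed direction.
    obtain ⟨y, hy, hyz⟩ := exists_isMinOn_dist_of_isCompact hS ⟨w₀, hw₀S⟩ z
    have hzy : ‖z - y‖ < ε := (hyz w₀ hw₀S).trans_lt hzb
    set g : ℂ → ℝ := fun w => (Metric.closedBall w₀ δ).indicator (fun _ => Real.log 2) w
    have hgm : MeasurableSet (Metric.closedBall w₀ δ) := measurableSet_closedBall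
    have hgint : Integrable g μ := (integrable_const _).indicator hgm
    have hpt : ∀ᵐ w ∂μ, Real.log ‖y - w‖ - g w - η ≤ Real.log ‖z - w‖ := by
      filter_upwards [(hint' z).ae_ne, (hint' y).ae_ne, haeS] with w hw1 hw2 hwS
      have htri : ‖y - w‖ ≤ ‖z - y‖ + ‖z - w‖ := by
        rw [norm_sub_rev z y]; exact norm_sub_le_norm_sub_add_norm_sub y z w
      by_cases hwB : w ∈ Metric.closedBall w₀ δ
      · have h1 : ‖y - w‖ ≤ 2 * ‖z - w‖ := by linarith [hyz w hwS]
        have h2 := Real.log_le_log hw2 h1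
        rw [Real.log_mul two_ne_zero hw1.ne'] at h2
        simp only [g, indicator_of_mem hwB]
        linarith
      · simp only [g, indicator_of_notMem hwB]
        rw [mem_closedBall_iff_norm, not_le] at hwB
        have h1 : ‖w - w₀‖ ≤ ‖w - z‖ + ‖z - w₀‖ := norm_sub_le_norm_sub_add_norm_sub w z w₀
        rw [norm_sub_rev w z] at h1
        have h2 : δ / 2 ≤ ‖z - w‖ := by
          have := min_le_left (δ / 4) (η * δ / 4)
          linarith
        have h3 : ‖y - w‖ ≤ (1 + η) * ‖z - w‖ := by
          have h4 : ε ≤ η * δ / 4 := min_le_right _ _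
          nlinarith
        have h5 := Real.log_le_log hw2 h3
        rw [Real.log_mul (by positivity) hw1.ne'] at h5
        have h6 := Real.log_le_sub_one_of_pos (show 0 < 1 + η by positivity)
        linarith
    have hle : ∫ w, (Real.log ‖y - w‖ - g w - η) ∂μ ≤ logMean μ z :=
      integral_mono_ae (((hint' y).1.sub hgint).sub (integrable_const _)) (hint' z).1 hpt
    have hsub : Integrable (fun w => Real.log ‖y - w‖ - g w) μ := (hint' y).1.sub hgint
    rw [integral_sub hsub (integrable_const _),
      integral_sub (hint' y).1 hgint, integral_indicator hgm] at hle
    simp only [integral_const, MeasurableSet.univ, smul_eq_mul, measureReal_restrict_apply,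
      univ_inter, probReal_univ, one_mul] at hle
    have h7 := hV y hy
    simp only [logMean] at h7 hle ⊢
    linarith
  · intro c _
    exact ((tendsto_logMean_cocompact haeR).eventually_gt_atTop c).filter_mono inf_le_left

lemma logKernel_of_ne {z w : ℂ} (h : 0 < ‖z - w‖) :
    logKernel z w = ((-Real.log ‖z - w‖ : ℝ) : EReal) := by
  rw [logKernel, ← ofReal_norm, ENNReal.log_ofReal_of_pos h, EReal.coe_neg]

lemma logPotential_eq {μ : Measure ℂ} {z : ℂ} (h : LogIntegrableAt μ z) :
    logPotential μ z = ((-logMean μ z : ℝ) : EReal) := by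
  have h1 : ∫⁻ w, (logKernel z w).toENNReal ∂μ = ∫⁻ w, ENNReal.ofReal (-Real.log ‖z - w‖) ∂μ := by
    refine lintegral_congr_ae ?_
    filter_upwards [h.ae_ne] with w hw
    rw [logKernel_of_ne hw, EReal.toENNReal_of_ne_top (EReal.coe_ne_top _), EReal.toReal_coe]
  have h2 : ∫⁻ w, (-logKernel z w).toENNReal ∂μ =
      ∫⁻ w, ENNReal.ofReal (-(-Real.log ‖z - w‖)) ∂μ := by
    refine lintegral_congr_ae ?_
    filter_upwards [h.ae_ne] with w hw
    rw [logKernel_of_ne hw, ← EReal.coe_neg, EReal.toENNReal_of_ne_top (EReal.coe_ne_top _),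
      EReal.toReal_coe]
  have hneg : -logMean μ z = ∫ w, -Real.log ‖z - w‖ ∂μ := (integral_neg _).symm
  have hi : Integrable (fun w => -Real.log ‖z - w‖) μ := h.1.neg
  have hfin : ∀ {g : ℂ → ℝ}, Integrable g μ → ∫⁻ w, ENNReal.ofReal (g w) ∂μ ≠ ⊤ := fun hg =>
    (lt_of_le_of_lt (lintegral_mono fun w => Real.ofReal_le_enorm _) hg.2).ne
  rw [logPotential, h1, h2, hneg, integral_eq_lintegral_pos_part_sub_lintegral_neg_part hi,
    EReal.coe_sub, EReal.coe_ennreal_toReal (hfin hi),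
    EReal.coe_ennreal_toReal (hfin (g := fun w => -(-Real.log ‖z - w‖)) hi.neg)]

lemma mem_levelSet_iff {μ : Measure ℂ} {z : ℂ} (h : LogIntegrableAt μ z) {θ : ℝ} (hθ : 0 < θ) :
    z ∈ levelSet μ θ ↔ logMean μ z < Real.log θ := by
  rw [levelSet, mem_ofPred_eq, logPotential_eq h, ← EReal.coe_neg, neg_neg, EReal.exp_coe,
    ENNReal.ofReal_lt_ofReal_iff hθ, Real.lt_log_iff_exp_lt hθ]

/-- Negative parts are moved across the equation so that it holds without subtraction, including on
the diagonal, where both sides are infinite. -/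
lemma logKernel_add_eq {A : ℝ} (hA : 1 ≤ A) {z w : ℂ} (h : ‖z - w‖ ≤ A) :
    (logKernel z w).toENNReal + ENNReal.ofReal (Real.log A) =
      logKer A z w + (-logKernel z w).toENNReal := by
  have hA0 : 0 < A := by linarith
  rcases (norm_nonneg (z - w)).eq_or_lt with h0 | h0
  · have : z = w := by rwa [eq_comm, norm_eq_zero, sub_eq_zero] at h0
    subst this
    simp [logKer_self hA0, logKernel]
  · rw [logKer_of_ne hA0 h0, logKernel_of_ne h0, ← EReal.coe_neg,
      EReal.toENNReal_of_ne_top (EReal.coe_ne_top _), EReal.toENNReal_of_ne_top (EReal.coe_ne_top _),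
      EReal.toReal_coe, EReal.toReal_coe, neg_neg]
    have hl := Real.log_le_log h0 h
    have ha := Real.log_nonneg hA
    rcases le_total 0 (Real.log ‖z - w‖) with h1 | h1
    · rw [ENNReal.ofReal_of_nonpos (by linarith), ← ENNReal.ofReal_add (by linarith) h1]
      simp
    · rw [ENNReal.ofReal_of_nonpos h1, ← ENNReal.ofReal_add (by linarith) ha]
      ring_nf

lemma neg_logKernel_le {A : ℝ} {z w : ℂ} (h : ‖z - w‖ ≤ A) :
    (-logKernel z w).toENNReal ≤ ENNReal.ofReal (Real.log A) := by
  rcases (norm_nonneg (z - w)).eq_or_lt with h0 | h0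
  · have : z = w := by rwa [eq_comm, norm_eq_zero, sub_eq_zero] at h0
    subst this
    simp [logKernel]
  · rw [logKernel_of_ne h0, ← EReal.coe_neg, EReal.toENNReal_of_ne_top (EReal.coe_ne_top _),
      EReal.toReal_coe, neg_neg]
    exact ENNReal.ofReal_le_ofReal (Real.log_le_log h0 h)

lemma ae_mem_of_mem_probOn {K : Set ℂ} {ν : Measure ℂ} (hν : ν ∈ probOn K) : ∀ᵐ w ∂ν, w ∈ K := by
  filter_upwards [measure_eq_zero_iff_ae_notMem.1 hν.2] with w hw using not_not.1 hw

lemma measurable_logKernel : Measurable fun p : ℂ × ℂ => logKernel p.1 p.2 := by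
  have h : Measurable fun p : ℂ × ℂ => ‖p.1 - p.2‖ₑ := by fun_prop
  exact (h.ennreal_log).neg

lemma logEnergy_eq {K : Set ℂ} {A : ℝ} (hA : 1 ≤ A) (hK : ∀ z ∈ K, ∀ w ∈ K, ‖z - w‖ ≤ A)
    {ν : Measure ℂ} (hν : ν ∈ probOn K) :
    logEnergy ν = (energy A ν : EReal) - (Real.log A : ℝ) := by
  have := hν.1
  have hae : ∀ᵐ p ∂(ν.prod ν), ‖p.1 - p.2‖ ≤ A := by
    filter_upwards [Measure.quasiMeasurePreserving_fst.ae (ae_mem_of_mem_probOn hν),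
      Measure.quasiMeasurePreserving_snd.ae (ae_mem_of_mem_probOn hν)] with p h1 h2
    exact hK _ h1 _ h2
  have hm := measurable_logKernel
  have hE : energy A ν = ∫⁻ p, logKer A p.1 p.2 ∂(ν.prod ν) :=
    (lintegral_prod _ (measurable_logKer A).aemeasurable).symm
  have h1 : ∫⁻ p, (logKernel p.1 p.2).toENNReal ∂(ν.prod ν) + ENNReal.ofReal (Real.log A) =
      energy A ν + ∫⁻ p, (-logKernel p.1 p.2).toENNReal ∂(ν.prod ν) := by
    rw [hE, ← lintegral_add_left (measurable_logKer A)]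
    have : ENNReal.ofReal (Real.log A) = ∫⁻ _, ENNReal.ofReal (Real.log A) ∂(ν.prod ν) := by simp
    rw [this, ← lintegral_add_right _ measurable_const]
    refine lintegral_congr_ae ?_
    filter_upwards [hae] with p hp using logKernel_add_eq hA hp
  have h2 : ∫⁻ p, (-logKernel p.1 p.2).toENNReal ∂(ν.prod ν) ≠ ⊤ := by
    refine ne_top_of_le_ne_top (b := ENNReal.ofReal (Real.log A)) ENNReal.ofReal_ne_top ?_
    calc _ ≤ ∫⁻ _, ENNReal.ofReal (Real.log A) ∂(ν.prod ν) := by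
          refine lintegral_mono_ae ?_
          filter_upwards [hae] with p hp using neg_logKernel_le hp
      _ = _ := by simp
  rw [logEnergy]
  generalize ∫⁻ p, (logKernel p.1 p.2).toENNReal ∂(ν.prod ν) = a at *
  generalize ∫⁻ p, (-logKernel p.1 p.2).toENNReal ∂(ν.prod ν) = b at *
  generalize energy A ν = e at *
  have hl := Real.log_nonneg hA
  generalize Real.log A = l at *
  lift b to ℝ≥0 using h2
  by_cases ha : a = ⊤
  · have he : e = ⊤ := by
      by_contra he
      rw [ha, top_add] at h1
      exact ENNReal.add_ne_top.2 ⟨he, ENNReal.coe_ne_top⟩ h1.symm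
    rw [ha, he]
    simp
  · have he : e ≠ ⊤ := by
      rintro rfl
      rw [top_add] at h1
      exact ENNReal.add_ne_top.2 ⟨ha, ENNReal.ofReal_ne_top⟩ h1
    lift a to ℝ≥0 using ha
    lift e to ℝ≥0 using he
    have h3 := congrArg ENNReal.toReal h1
    rw [ENNReal.toReal_add (by simp) (by simp), ENNReal.toReal_add (by simp) (by simp),
      ENNReal.toReal_ofReal hl] at h3
    simp only [ENNReal.coe_toReal] at h3
    have hc : ∀ x : ℝ≥0, ((x : ℝ≥0∞) : EReal) = ((x : ℝ) : EReal) := fun x => rfl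
    rw [hc, hc, hc, ← EReal.coe_sub, ← EReal.coe_sub]
    congr 1
    linarith

/-- Frostman's theorem, for a compact set of positive capacity. -/
theorem exists_robin {K : Set ℂ} (hK : IsCompact K) (hcap : 0 < logCap K) {μ : Measure ℂ}
    (hμ : IsEquilibriumMeasure K μ) :
    ∃ V : ℝ, logCap K = Real.exp (-V) ∧
      (∀ z, LogIntegrableAt μ z ∧ -V ≤ logMean μ z) ∧
      ∀ A : ℝ, 1 ≤ A → (∀ z ∈ K, ∀ w ∈ K, ‖z - w‖ ≤ A) → ∀ ν ∈ probOn K, energy A ν ≠ ⊤ →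
        ENNReal.ofReal (V + Real.log A) ≤ ∫⁻ z, pot A μ z ∂ν := by
  have := hμ.1.1
  have htop : robinConst K ≠ ⊤ := fun h => by simp [logCap, h] at hcap
  have hbot : robinConst K ≠ ⊥ := fun h => by simp [logCap, h] at hcap
  set V := (robinConst K).toReal
  have hV : robinConst K = (V : EReal) := (EReal.coe_toReal htop hbot).symm
  have hmin : ∀ A : ℝ, 1 ≤ A → (∀ z ∈ K, ∀ w ∈ K, ‖z - w‖ ≤ A) →
      energy A μ = ENNReal.ofReal (V + Real.log A) ∧ 0 ≤ V + Real.log A ∧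
      ∀ ν ∈ probOn K, energy A μ ≤ energy A ν := by
    intro A hA hKA
    have h1 : (V : EReal) = (energy A μ : EReal) - (Real.log A : ℝ) := by
      rw [← hV, ← hμ.2, logEnergy_eq hA hKA hμ.1]
    have h2 : ((V + Real.log A : ℝ) : EReal) = energy A μ := by
      rw [EReal.coe_add, h1, EReal.sub_add_cancel]
    have h0 : 0 ≤ V + Real.log A := by
      rw [← EReal.coe_nonneg, h2]; exact EReal.coe_ennreal_nonneg _
    refine ⟨?_, h0, fun ν hν => ?_⟩
    · rw [← EReal.coe_ennreal_eq_coe_ennreal_iff, ← h2, EReal.coe_ennreal_ofReal, max_eq_left h0]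
    · have h3 : robinConst K ≤ logEnergy ν := iInf₂_le ν hν
      rw [hV, logEnergy_eq hA hKA hν, h1] at h3
      have h4 := add_le_add_left h3 ((Real.log A : ℝ) : EReal)
      rw [EReal.sub_add_cancel, EReal.sub_add_cancel] at h4
      exact_mod_cast h4
  have hA : ∃ A : ℝ, 1 ≤ A ∧ ∀ z ∈ K, ∀ w ∈ K, ‖z - w‖ ≤ A := by
    obtain ⟨R, hR⟩ := hK.isBounded.exists_norm_le
    refine ⟨max 1 (2 * R), le_max_left _ _, fun z hz w hw => le_max_of_le_right ?_⟩
    linarith [norm_sub_le z w, hR z hz, hR w hw]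
  refine ⟨V, ?_, ?_, ?_⟩
  · rw [logCap, hV, ← EReal.coe_neg, EReal.exp_coe, ENNReal.toReal_ofReal (Real.exp_pos _).le]
  · obtain ⟨A, hA, hKA⟩ := hA
    have hA0 : 0 < A := by linarith
    obtain ⟨h1, h0, h2⟩ := hmin A hA hKA
    have hae := ae_pot_le_of_minimal hμ.1 (h1 ▸ ENNReal.ofReal_ne_top) h2
    -- The bound on the potential holds only almost everywhere on K, but the set where it holds is
    -- compact and carries μ, so the maximum principle applies to it instead of K.
    set S := K ∩ {z | pot A μ z ≤ energy A μ} with hS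
    have hSc : IsCompact S := hK.inter_right (isClosed_pot_le A μ _)
    have hμS : μ Sᶜ = 0 := by
      rw [measure_eq_zero_iff_ae_notMem]
      filter_upwards [hae, ae_mem_of_mem_probOn hμ.1] with z hz1 hz2
      exact not_not.2 ⟨hz2, hz1⟩
    have haeA : ∀ z ∈ K, ∀ᵐ w ∂μ, ‖z - w‖ ≤ A := fun z hz =>
      (ae_mem_of_mem_probOn hμ.1).mono fun w hw => hKA z hz w hw
    have hLI : ∀ z ∈ S, LogIntegrableAt μ z := fun z hz => by
      refine logIntegrableAt_of_pot_lt_top hA0 (haeA z hz.1) (hz.2.trans_lt ?_)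
      rw [h1]; exact ENNReal.ofReal_lt_top
    refine neg_le_logMean_of_forall_mem hSc hμS hLI fun z hz => ?_
    have h3 := hz.2
    rw [mem_ofPred_eq, pot_eq_ofReal hA0 (haeA z hz.1) (hLI z hz), h1,
      ENNReal.ofReal_le_ofReal_iff h0, probReal_univ] at h3
    linarith
  · intro A hA hKA ν hν hfin
    obtain ⟨h1, h0, h2⟩ := hmin A hA hKA
    rw [← h1]
    exact le_lintegral_pot_of_minimal hμ.1 (h1 ▸ ENNReal.ofReal_ne_top) h2 hν hfin

/-! ### The Bernstein–Walsh inequality. -/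

lemma superharmonicOn_const (V : ℝ) (Ω : Set ℂ) : SuperharmonicOn (fun _ => V) Ω :=
  (superharmonicOn_of_harmonicOnNhd isOpen_univ
    (InnerProductSpace.harmonicOnNhd_const V)).mono (subset_univ _)

lemma exists_norm_eval_le (N : ℂ[X]) {n : ℕ} (hn : N.natDegree ≤ n) :
    ∃ C > 0, ∀ z : ℂ, 1 ≤ ‖z‖ → ‖N.eval z‖ ≤ C * ‖z‖ ^ n := by
  refine ⟨∑ i ∈ Finset.range (N.natDegree + 1), ‖N.coeff i‖ + 1, by positivity, fun z hz => ?_⟩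
  rw [Polynomial.eval_eq_sum_range]
  calc _ ≤ ∑ i ∈ Finset.range (N.natDegree + 1), ‖N.coeff i * z ^ i‖ := norm_sum_le _ _
    _ ≤ ∑ i ∈ Finset.range (N.natDegree + 1), ‖N.coeff i‖ * ‖z‖ ^ n := by
      refine Finset.sum_le_sum fun i hi => ?_
      rw [norm_mul, norm_pow]
      gcongr
      exact (Finset.mem_range_succ_iff.1 hi).trans hn
    _ ≤ _ := by
      rw [← Finset.sum_mul]
      gcongr
      linarith

/-- The Bernstein–Walsh inequality. -/
theorem norm_eval_le_exp_logMean {K : Set ℂ} (hK : IsCompact K) {μ : Measure ℂ}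
    (hμ : μ ∈ probOn K) {V : ℝ} (hV : ∀ z, -V ≤ logMean μ z) (N : ℂ[X]) {n : ℕ}
    (hn : N.natDegree ≤ n) {M : ℝ} (hM : 0 ≤ M) (hN : ∀ z ∈ K, ‖N.eval z‖ ≤ M) (z : ℂ) :
    ‖N.eval z‖ ≤ M * Real.exp (n * (V + logMean μ z)) := by
  have := hμ.1
  obtain ⟨R₀, hR₀⟩ := hK.isBounded.exists_norm_le
  set R := max R₀ 1
  have hR : ∀ᵐ w ∂μ, ‖w‖ ≤ R :=
    (ae_mem_of_mem_probOn hμ).mono fun w hw => (hR₀ w hw).trans (le_max_left _ _)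
  have hR1 : 1 ≤ R := le_max_right _ _
  by_cases hz0 : N.eval z = 0
  · rw [hz0, norm_zero]; positivity
  by_cases hzK : z ∈ K
  · refine (hN z hzK).trans (le_mul_of_one_le_right hM (Real.one_le_exp ?_))
    have := hV z
    have : 0 ≤ V + logMean μ z := by linarith
    positivity
  -- M' > M keeps the logarithm meaningful when M = 0, and ε > 0 makes the comparison function tend
  -- to infinity at infinity. Both are removed by a limit.
  suffices h : ∀ M' > M, ∀ ε > 0, Real.log ‖N.eval z‖ ≤
      Real.log M' + (n + ε) * (V + logMean μ z) by
    have h1 : ∀ M' > M, Real.log ‖N.eval z‖ ≤ Real.log M' + n * (V + logMean μ z) := by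
      intro M' hM'
      have hc : Tendsto (fun ε : ℝ => Real.log M' + (n + ε) * (V + logMean μ z)) (𝓝[>] 0)
          (𝓝 (Real.log M' + (n + 0) * (V + logMean μ z))) := by
        refine Tendsto.mono_left ?_ nhdsWithin_le_nhds
        exact Continuous.tendsto (by fun_prop) 0
      rw [add_zero] at hc
      refine ge_of_tendsto hc ?_
      filter_upwards [self_mem_nhdsWithin] with ε hε using h M' hM' ε hε
    have h2 : ∀ M' > M, ‖N.eval z‖ ≤ M' * Real.exp (n * (V + logMean μ z)) := by
      intro M' hM'
      have hM'0 : 0 < M' := hM.trans_lt hM'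
      rw [← Real.log_le_log_iff (norm_pos_iff.2 hz0) (by positivity),
        Real.log_mul hM'0.ne' (Real.exp_pos _).ne', Real.log_exp]
      exact h1 M' hM'
    have hc : Tendsto (fun M' : ℝ => M' * Real.exp (n * (V + logMean μ z))) (𝓝[>] M)
        (𝓝 (M * Real.exp (n * (V + logMean μ z)))) :=
      Tendsto.mono_left (Continuous.tendsto (by fun_prop) M) nhdsWithin_le_nhds
    refine ge_of_tendsto hc ?_
    filter_upwards [self_mem_nhdsWithin] with M' hM' using h2 M' hM'
  intro M' hM' ε hε
  have hM'0 : 0 < M' := hM.trans_lt hM'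
  -- Off its zeros log|N| is harmonic, and at a zero -log|N| tends to +∞, which is harmless for a
  -- minimum principle.
  set Ω : Set ℂ := Kᶜ ∩ {z | N.eval z ≠ 0} with hΩ
  have hΩo : IsOpen Ω := hK.isClosed.isOpen_compl.inter
    (isOpen_ne_fun N.continuous continuous_const)
  have hs : SuperharmonicOn
      (fun z => (n + ε) * (V + logMean μ z) + -Real.log ‖N.eval z‖) Ω := by
    refine SuperharmonicOn.add (SuperharmonicOn.const_mul (SuperharmonicOn.add
      (superharmonicOn_const V Ω) ((superharmonicOn_logMean hR hK.isClosed hμ.2).mono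
        inter_subset_left)) (by positivity)) (superharmonicOn_of_harmonicOnNhd hΩo ?_)
    intro y hy
    exact (AnalyticAt.harmonicAt_log_norm (N.differentiable.analyticAt y) hy.2).neg
  have hmain := hs.le_of_boundary hΩo (M := -Real.log M') ?_ ?_ z ⟨hzK, hz0⟩
  · linarith
  · intro w hw c hc
    have hNw : ‖N.eval w‖ < Real.exp (-c) := by
      have h1 : M' < Real.exp (-c) := by
        rw [← Real.log_lt_iff_lt_exp hM'0]; linarith
      have hwΩ : w ∉ Ω := by
        have := hw.2; rwa [hΩo.interior_eq] at this
      by_cases hwK : w ∈ K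
      · exact ((hN w hwK).trans_lt hM').trans h1
      · have : N.eval w = 0 := by
          by_contra h
          exact hwΩ ⟨hwK, h⟩
        rw [this, norm_zero]
        exact Real.exp_pos _
    have hcont : ContinuousAt (fun z => ‖N.eval z‖) w := by fun_prop
    rw [eventually_nhdsWithin_iff]
    filter_upwards [hcont.eventually (gt_mem_nhds hNw)] with y hy hyΩ
    have h2 := (Real.log_lt_iff_lt_exp (norm_pos_iff.2 hyΩ.2)).2 hy
    have h3 : 0 ≤ (n + ε) * (V + logMean μ y) :=
      mul_nonneg (by positivity) (by linarith [hV y])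
    linarith
  · intro c _
    obtain ⟨C, hC, hNC⟩ := exists_norm_eval_le N hn
    have htend : Tendsto (fun y : ℂ => ε * Real.log ‖y‖ +
        ((n + ε) * (V - Real.log 2) - Real.log C)) (cocompact ℂ) atTop :=
      tendsto_atTop_add_const_right _ _ (Tendsto.const_mul_atTop hε
        (Real.tendsto_log_atTop.comp tendsto_norm_cocompact_atTop))
    rw [eventually_inf_principal]
    filter_upwards [htend.eventually_gt_atTop c,
      (tendsto_norm_cocompact_atTop (E := ℂ)).eventually_ge_atTop (2 * R)] with y hy hyR hyΩ
    have hy1 : 1 ≤ ‖y‖ := by linarith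
    have hy0 : 0 < ‖y‖ := by linarith
    have h1 := log_half_norm_le_logMean (by linarith) hR hyR
    rw [Real.log_div hy0.ne' two_ne_zero] at h1
    have h2 := Real.log_le_log (norm_pos_iff.2 hyΩ.2) (hNC y hy1)
    rw [Real.log_mul hC.ne' (by positivity), Real.log_pow] at h2
    have h3 : (n + ε) * (V + (Real.log ‖y‖ - Real.log 2)) ≤ (n + ε) * (V + logMean μ y) :=
      mul_le_mul_of_nonneg_left (by linarith) (by positivity)
    linarith

/-! ### The outer domain, the Dirichlet problem and harmonic measure. -/

lemma isOpen_outerDomain {K : Set ℂ} (hK : IsCompact K) : IsOpen (outerDomain K) := by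
  rw [isOpen_iff_mem_nhds]
  intro z hz
  refine mem_of_superset (hK.isClosed.isOpen_compl.connectedComponentIn.mem_nhds
    (mem_connectedComponentIn hz.1)) fun y hy => ?_
  exact ⟨connectedComponentIn_subset _ _ hy, by rw [← connectedComponentIn_eq hy]; exact hz.2⟩

lemma outerDomain_subset (K : Set ℂ) : outerDomain K ⊆ Kᶜ := fun _ hz => hz.1

lemma frontier_outerDomain_subset {K : Set ℂ} (hK : IsCompact K) :
    frontier (outerDomain K) ⊆ K := by
  intro z hz
  by_contra hzK
  have hn := hK.isClosed.isOpen_compl.connectedComponentIn.mem_nhds (mem_connectedComponentIn hzK)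
  obtain ⟨y, hy1, hy2⟩ := mem_closure_iff_nhds.1 hz.1 _ hn
  refine hz.2 ?_
  rw [(isOpen_outerDomain hK).interior_eq]
  exact ⟨hzK, by rw [connectedComponentIn_eq hy1]; exact hy2.2⟩

lemma mem_outerDomain_of_norm_lt {K : Set ℂ} {R : ℝ} (hR0 : 0 ≤ R) (hR : ∀ z ∈ K, ‖z‖ ≤ R) {z : ℂ}
    (hz : R < ‖z‖) : z ∈ outerDomain K := by
  have hz0 : 0 < ‖z‖ := hR0.trans_lt hz
  set ray : Set ℂ := (fun t : ℝ => (t : ℂ) * z) '' Ici 1 with hray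
  have hrayK : ray ⊆ Kᶜ := by
    rintro _ ⟨t, ht, rfl⟩ hmem
    have h1 := hR _ hmem
    simp only [norm_mul, Complex.norm_real, Real.norm_eq_abs] at h1
    rw [abs_of_nonneg (zero_le_one.trans ht)] at h1
    nlinarith [mem_Ici.1 ht]
  have hzr : z ∈ ray := ⟨1, by simp, by simp⟩
  refine ⟨hrayK hzr, fun hb => ?_⟩
  have hpre : IsPreconnected ray := isPreconnected_Ici.image _ (by fun_prop)
  obtain ⟨B, hB⟩ := (hb.subset (hpre.subset_connectedComponentIn hzr hrayK)).exists_norm_le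
  have h2 := hB ((max 1 (B / ‖z‖ + 1) : ℝ) * z) ⟨_, by simp, rfl⟩
  rw [norm_mul, Complex.norm_real, Real.norm_of_nonneg (by positivity)] at h2
  have h3 : (B / ‖z‖ + 1) * ‖z‖ ≤ max 1 (B / ‖z‖ + 1) * ‖z‖ := by gcongr; exact le_max_right _ _
  rw [add_mul, div_mul_cancel₀ _ hz0.ne'] at h3
  linarith

/-- A component that is unbounded and comes close to z₀ meets every circle about z₀, by
connectedness. Thus the radius can be chosen freely later. -/
lemma exists_mem_outerDomain_norm_eq {K : Set ℂ} {z₀ : ℂ}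
    (hz₀ : z₀ ∈ closure (outerDomain K)) {ρ : ℝ} (hρ : 0 < ρ) :
    ∃ z ∈ outerDomain K, ‖z - z₀‖ = ρ := by
  obtain ⟨y, hy, hyd⟩ := Metric.mem_closure_iff.1 hz₀ ρ hρ
  rw [dist_comm, dist_eq_norm] at hyd
  set C := connectedComponentIn Kᶜ y
  have hCG : C ⊆ outerDomain K := fun x hx =>
    ⟨connectedComponentIn_subset _ _ hx, by rw [← connectedComponentIn_eq hx]; exact hy.2⟩
  obtain ⟨x, hx, hxd⟩ : ∃ x ∈ C, ρ ≤ ‖x - z₀‖ := by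
    by_contra! h
    exact hy.2 (Metric.isBounded_ball.subset fun x hx => mem_ball_iff_norm.2 (h x hx))
  obtain ⟨z, hz, hzd⟩ := isPreconnected_connectedComponentIn.intermediate_value
    (mem_connectedComponentIn hy.1) hx (f := fun x => ‖x - z₀‖) (by fun_prop) ⟨hyd.le, hxd⟩
  exact ⟨z, hCG hz, hzd⟩

/-- The minimum principle in (possibly unbounded) open subsets of the complement of a compact set
that carries a measure with a bounded potential. -/
theorem SuperharmonicOn.le_of_boundary_of_bddBelow {K : Set ℂ} (hK : IsCompact K) {μ : Measure ℂ}
    (hμ : μ ∈ probOn K) {V : ℝ} (hV : ∀ z, -V ≤ logMean μ z) {Ω : Set ℂ} (hΩ : IsOpen Ω)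
    (hΩK : Ω ⊆ Kᶜ) {s : ℂ → ℝ} (hs : SuperharmonicOn s Ω) {M B : ℝ}
    (hb : ∀ w ∈ frontier Ω, ∀ c < M, ∀ᶠ z in 𝓝[Ω] w, c < s z)
    (hinf : ∀ᶠ z in cocompact ℂ ⊓ 𝓟 Ω, B ≤ s z) : ∀ z ∈ Ω, M ≤ s z := by
  have := hμ.1
  obtain ⟨R, hR⟩ := hK.isBounded.exists_norm_le
  have haeR : ∀ᵐ w ∂μ, ‖w‖ ≤ R := (ae_mem_of_mem_probOn hμ).mono fun w hw => hR w hw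
  intro z hz
  -- Phragmén–Lindelöf: the added term is nonnegative, superharmonic off K and infinite at infinity,
  -- so a lower bound for s there suffices.
  have key : ∀ ε > 0, M ≤ s z + ε * (V + logMean μ z) := by
    intro ε hε
    have hsε : SuperharmonicOn (fun z => s z + ε * (V + logMean μ z)) Ω :=
      hs.add (((superharmonicOn_const V Ω).add
        ((superharmonicOn_logMean haeR hK.isClosed hμ.2).mono hΩK)).const_mul hε.le)
    refine hsε.le_of_boundary hΩ (fun w hw c hc => ?_) (fun c _ => ?_) z hz
    · filter_upwards [hb w hw c hc] with y hy
      have : 0 ≤ ε * (V + logMean μ y) := mul_nonneg hε.le (by linarith [hV y])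
      linarith
    · have h1 : Tendsto (fun y => B + ε * (V + logMean μ y)) (cocompact ℂ) atTop :=
        tendsto_atTop_add_const_left _ _ (Tendsto.const_mul_atTop hε
          (tendsto_atTop_add_const_left _ _ (tendsto_logMean_cocompact haeR)))
      filter_upwards [hinf, (h1.eventually_gt_atTop c).filter_mono inf_le_left] with y h2 h3
      linarith
  have hc : Tendsto (fun ε : ℝ => s z + ε * (V + logMean μ z)) (𝓝[>] 0)
      (𝓝 (s z + 0 * (V + logMean μ z))) :=
    Tendsto.mono_left (Continuous.tendsto (by fun_prop) 0) nhdsWithin_le_nhds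
  rw [zero_mul, add_zero] at hc
  refine ge_of_tendsto hc ?_
  filter_upwards [self_mem_nhdsWithin] with ε hε using key ε hε

/-- `u` solves the Dirichlet problem in the outer domain of `K` with boundary data `φ`. -/
structure IsDirichletSolution (K : Set ℂ) (φ u : ℂ → ℝ) : Prop where
  harmonic : InnerProductSpace.HarmonicOnNhd u (outerDomain K)
  continuousOn : ContinuousOn u (closure (outerDomain K))
  eq_on : ∀ z ∈ frontier (outerDomain K), u z = φ z
  tendsto : ∃ c : ℝ, Tendsto u (cocompact ℂ) (𝓝 c)

lemma IsDirichletRegular.exists_solution {K : Set ℂ} (h : IsDirichletRegular K) {φ : ℂ → ℝ}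
    (hφ : ContinuousOn φ (frontier (outerDomain K))) : ∃ u, IsDirichletSolution K φ u := by
  obtain ⟨u, h1, h2, h3, h4⟩ := h φ hφ
  exact ⟨u, h1, h2, h3, h4⟩

lemma IsDirichletSolution.add {K : Set ℂ} {φ ψ u v : ℂ → ℝ} (hu : IsDirichletSolution K φ u)
    (hv : IsDirichletSolution K ψ v) :
    IsDirichletSolution K (fun z => φ z + ψ z) (fun z => u z + v z) where
  harmonic := hu.harmonic.add hv.harmonic
  continuousOn := hu.continuousOn.add hv.continuousOn
  eq_on z hz := by simp only [hu.eq_on z hz, hv.eq_on z hz]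
  tendsto := by
    obtain ⟨a, ha⟩ := hu.tendsto
    obtain ⟨b, hb⟩ := hv.tendsto
    exact ⟨a + b, ha.add hb⟩

lemma IsDirichletSolution.const_mul {K : Set ℂ} {φ u : ℂ → ℝ} (hu : IsDirichletSolution K φ u)
    (c : ℝ) : IsDirichletSolution K (fun z => c * φ z) (fun z => c * u z) where
  harmonic := hu.harmonic.const_smul (c := c)
  continuousOn := continuousOn_const.mul hu.continuousOn
  eq_on z hz := by simp only [hu.eq_on z hz]
  tendsto := by
    obtain ⟨a, ha⟩ := hu.tendsto
    exact ⟨c * a, ha.const_mul c⟩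

lemma isDirichletSolution_const (K : Set ℂ) (c : ℝ) :
    IsDirichletSolution K (fun _ => c) (fun _ => c) where
  harmonic := InnerProductSpace.harmonicOnNhd_const c
  continuousOn := continuousOn_const
  eq_on _ _ := rfl
  tendsto := ⟨c, tendsto_const_nhds⟩

/-- The standing assumptions: `K` is compact and carries the probability measure `μ`, the
potential of which is bounded by `V`. -/
structure IsBoundedPotential (K : Set ℂ) (μ : Measure ℂ) (V : ℝ) : Prop where
  isCompact : IsCompact K
  mem_probOn : μ ∈ probOn K
  neg_le (z : ℂ) : -V ≤ logMean μ z
  logIntegrableAt (z : ℂ) : LogIntegrableAt μ z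

lemma IsDirichletSolution.nonneg {K : Set ℂ} {μ : Measure ℂ} {V : ℝ}
    (hK : IsBoundedPotential K μ V) {φ u : ℂ → ℝ} (hu : IsDirichletSolution K φ u)
    (hφ : ∀ z ∈ frontier (outerDomain K), 0 ≤ φ z) : ∀ z ∈ outerDomain K, 0 ≤ u z := by
  have hG := isOpen_outerDomain hK.isCompact
  obtain ⟨c, hc⟩ := hu.tendsto
  refine SuperharmonicOn.le_of_boundary_of_bddBelow hK.isCompact hK.mem_probOn hK.neg_le hG
    (outerDomain_subset K) (superharmonicOn_of_harmonicOnNhd hG hu.harmonic) (B := c - 1)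
    (fun w hw a ha => ?_) ?_
  · have h1 := (hu.continuousOn w hw.1).mono subset_closure
    refine h1.eventually (lt_mem_nhds ?_)
    rw [hu.eq_on w hw]
    exact ha.trans_le (hφ w hw)
  · exact ((hc.eventually (lt_mem_nhds (sub_one_lt c))).mono fun _ h => h.le).filter_mono inf_le_left

lemma IsDirichletSolution.unique {K : Set ℂ} {μ : Measure ℂ} {V : ℝ}
    (hK : IsBoundedPotential K μ V) {φ u v : ℂ → ℝ} (hu : IsDirichletSolution K φ u)
    (hv : IsDirichletSolution K φ v) : ∀ z ∈ outerDomain K, u z = v z := by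
  intro z hz
  have h1 := (hu.add (hv.const_mul (-1))).nonneg hK (fun _ _ => by simp) z hz
  have h2 := (hv.add (hu.const_mul (-1))).nonneg hK (fun _ _ => by simp) z hz
  linarith

/-- Harmonic measure of a point of the outer domain. -/
theorem exists_harmonicMeasure {K : Set ℂ} {μ : Measure ℂ} {V : ℝ}
    (hK : IsBoundedPotential K μ V) (hreg : IsDirichletRegular K) {z : ℂ}
    (hz : z ∈ outerDomain K) :
    ∃ ν ∈ probOn (frontier (outerDomain K)), ∀ φ : ℂ → ℝ, Continuous φ →
      ∀ u, IsDirichletSolution K φ u → ∫ w, φ w ∂ν = u z := by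
  classical
  set Y := frontier (outerDomain K)
  have hXc : IsCompact Y :=
    hK.isCompact.of_isClosed_subset isClosed_frontier (frontier_outerDomain_subset hK.isCompact)
  have : CompactSpace Y := isCompact_iff_compactSpace.1 hXc
  let ext : (Y → ℝ) → ℂ → ℝ := fun f w => if h : w ∈ Y then f ⟨w, h⟩ else 0
  have hext : ∀ f : Y → ℝ, ∀ w (h : w ∈ Y), ext f w = f ⟨w, h⟩ := fun f w h => dif_pos h
  have hextc : ∀ f : Y → ℝ, Continuous f → ContinuousOn (ext f) Y := fun f hf => by
    rw [continuousOn_iff_continuous_domRestrict]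
    convert! hf using 1
    ext w
    exact hext f w w.2
  have hsol : ∀ f : CompactlySupportedContinuousMap Y ℝ, ∃ u, IsDirichletSolution K (ext f) u := fun f =>
    hreg.exists_solution (hextc f f.continuous)
  choose sol hsol using hsol
  have hcongr : ∀ {φ ψ u : ℂ → ℝ}, IsDirichletSolution K φ u → (∀ w ∈ Y, φ w = ψ w) →
      IsDirichletSolution K ψ u := fun h hφ =>
    ⟨h.harmonic, h.continuousOn, fun w hw => (h.eq_on w hw).trans (hφ w hw), h.tendsto⟩
  -- Uniqueness makes the chosen solution linear in the boundary data; the minimum principle makes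
  -- its value at z a positive functional, so Riesz–Markov applies.
  let L : CompactlySupportedContinuousMap Y ℝ →ₗ[ℝ] ℝ :=
    { toFun := fun f => sol f z
      map_add' := fun f g => by
        refine IsDirichletSolution.unique hK (hsol (f + g)) (hcongr ((hsol f).add (hsol g)) ?_) z hz
        intro w hw
        simp [hext _ w hw]
      map_smul' := fun c f => by
        refine IsDirichletSolution.unique hK (hsol (c • f)) (hcongr ((hsol f).const_mul c) ?_) z hz
        intro w hw
        simp [hext _ w hw] }
  let Λ : CompactlySupportedContinuousMap Y ℝ →ₚ[ℝ] ℝ := PositiveLinearMap.mk₀ L fun f hf => by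
    refine (hsol f).nonneg hK (fun w hw => ?_) z hz
    rw [hext _ w hw]
    exact hf ⟨w, hw⟩
  set ν₀ := RealRMK.rieszMeasure Λ
  let toCc : ∀ f : Y → ℝ, Continuous f →
      CompactlySupportedContinuousMap Y ℝ := fun f hf =>
    ⟨⟨f, hf⟩, HasCompactSupport.of_compactSpace f⟩
  have hint : ∀ φ : ℂ → ℝ, Continuous φ → ∀ u, IsDirichletSolution K φ u →
      ∫ w : Y, φ w ∂ν₀ = u z := by
    intro φ hφ u hu
    have h1 := RealRMK.integral_rieszMeasure Λ (toCc (fun w => φ w) (hφ.comp continuous_subtype_val))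
    refine Eq.trans h1 ?_
    refine IsDirichletSolution.unique hK (hsol _) (hcongr hu fun w hw => ?_) z hz
    rw [hext _ w hw]
    rfl
  have hprob : IsProbabilityMeasure ν₀ := by
    have h1 := hint (fun _ => 1) continuous_const _ (isDirichletSolution_const K 1)
    rw [integral_const, smul_eq_mul, mul_one] at h1
    refine ⟨?_⟩
    rw [← ENNReal.toReal_eq_one_iff]
    exact h1
  refine ⟨ν₀.map Subtype.val, ⟨Measure.isProbabilityMeasure_map measurable_subtype_coe.aemeasurable,
    ?_⟩, fun φ hφ u hu => ?_⟩
  · rw [Measure.map_apply measurable_subtype_coe isClosed_frontier.measurableSet.compl]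
    simp [Y]
  · rw [integral_map measurable_subtype_coe.aemeasurable hφ.aestronglyMeasurable]
    exact hint φ hφ u hu

lemma tendsto_ofReal_truncated_logKer {A : ℝ} (hA : 0 < A) (ζ w : ℂ) :
    Tendsto (fun n : ℕ => ENNReal.ofReal (Real.log A - Real.log (max ‖w - ζ‖ (1 / ((n : ℝ) + 1)))))
      atTop (𝓝 (logKer A ζ w)) := by
  have h0 : Tendsto (fun n : ℕ => 1 / ((n : ℝ) + 1)) atTop (𝓝 0) :=
    tendsto_one_div_add_atTop_nhds_zero_nat
  rcases (norm_nonneg (w - ζ)).eq_or_lt with h | h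
  · have hw : w = ζ := by rwa [eq_comm, norm_eq_zero, sub_eq_zero] at h
    subst hw
    rw [logKer_self hA]
    refine ENNReal.tendsto_ofReal_atTop.comp ?_
    have h1 : Tendsto (fun n : ℕ => 1 / ((n : ℝ) + 1)) atTop (𝓝[>] 0) :=
      tendsto_nhdsWithin_iff.2 ⟨h0, Eventually.of_forall fun n => by
        rw [mem_Ioi]; positivity⟩
    have h2 := Real.tendsto_log_nhdsGT_zero.comp h1
    refine tendsto_atTop_add_const_left _ _ (tendsto_neg_atBot_atTop.comp ?_)
    refine h2.congr fun n => ?_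
    simp only [Function.comp, sub_self, norm_zero]
    rw [max_eq_right (by positivity)]
  · rw [logKer_of_ne hA (by rwa [norm_sub_rev]), norm_sub_rev ζ w]
    have h1 : Tendsto (fun n : ℕ => max ‖w - ζ‖ (1 / ((n : ℝ) + 1))) atTop (𝓝 (max ‖w - ζ‖ 0)) :=
      tendsto_const_nhds.max h0
    rw [max_eq_left h.le] at h1
    exact (ENNReal.continuous_ofReal.tendsto _).comp ((h1.log h.ne').const_sub _)

/-- The potential of harmonic measure is dominated by the Green function. -/
lemma pot_harmonicMeasure_le {K : Set ℂ} {μ : Measure ℂ} {V : ℝ}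
    (hK : IsBoundedPotential K μ V) (hreg : IsDirichletRegular K) {z : ℂ}
    (hz : z ∈ outerDomain K) {ν : Measure ℂ} (hν : ν ∈ probOn (frontier (outerDomain K)))
    (hνu : ∀ φ : ℂ → ℝ, Continuous φ → ∀ u, IsDirichletSolution K φ u → ∫ w, φ w ∂ν = u z)
    {A : ℝ} (hA : 1 ≤ A) (hKA : ∀ z ∈ K, ∀ w ∈ K, ‖z - w‖ ≤ A) {ζ : ℂ} (hζ : ζ ∈ K) :
    pot A ν ζ ≤ ENNReal.ofReal (Real.log A - Real.log ‖z - ζ‖ + (V + logMean μ z)) := by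
  have := hν.1
  have hprob := hK.mem_probOn.1
  have hA0 : 0 < A := by linarith
  have hG := isOpen_outerDomain hK.isCompact
  have hae : ∀ᵐ w ∂ν, ‖w - ζ‖ ≤ A := (ae_mem_of_mem_probOn hν).mono fun w hw =>
    hKA _ (frontier_outerDomain_subset hK.isCompact hw) _ hζ
  obtain ⟨R₀, hR₀⟩ := hK.isCompact.isBounded.exists_norm_le
  set R := max R₀ 1
  have hR1 : 1 ≤ R := le_max_right _ _
  have haeR : ∀ᵐ w ∂μ, ‖w‖ ≤ R :=
    (ae_mem_of_mem_probOn hK.mem_probOn).mono fun w hw => (hR₀ w hw).trans (le_max_left _ _)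
  have hζR : ‖ζ‖ ≤ R := (hR₀ ζ hζ).trans (le_max_left _ _)
  -- Truncation makes the data continuous, so the integral is u(z) for a Dirichlet solution u. Then
  -- u is compared with -log|y - ζ| + g(y), which has no smaller boundary values and is bounded
  -- below near infinity because g grows like log|y|.
  have key : ∀ ρ : ℝ, 0 < ρ → ∫ w, -Real.log (max ‖w - ζ‖ ρ) ∂ν ≤
      -Real.log ‖z - ζ‖ + (V + logMean μ z) := by
    intro ρ hρ
    have hpos : ∀ w : ℂ, 0 < max ‖w - ζ‖ ρ := fun w => lt_max_of_lt_right hρ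
    have hφ : Continuous fun w : ℂ => -Real.log (max ‖w - ζ‖ ρ) :=
      (Continuous.log (by fun_prop) fun w => (hpos w).ne').neg
    obtain ⟨u, hu⟩ := hreg.exists_solution hφ.continuousOn
    rw [hνu _ hφ u hu]
    obtain ⟨c, hc⟩ := hu.tendsto
    have hs : SuperharmonicOn (fun y => (-Real.log ‖y - ζ‖ + -u y) + (V + logMean μ y))
        (outerDomain K) := by
      refine SuperharmonicOn.add (superharmonicOn_of_harmonicOnNhd hG ?_)
        ((superharmonicOn_const V _).add ((superharmonicOn_logMean haeR hK.isCompact.isClosed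
          hK.mem_probOn.2).mono (outerDomain_subset K)))
      refine InnerProductSpace.HarmonicOnNhd.add (fun y hy => ?_) hu.harmonic.neg
      refine (AnalyticAt.harmonicAt_log_norm (f := fun y => y - ζ) (by fun_prop) ?_).neg
      exact sub_ne_zero.2 fun h => hy.1 (h ▸ hζ)
    have hmain := hs.le_of_boundary_of_bddBelow hK.isCompact hK.mem_probOn hK.neg_le hG
      (outerDomain_subset K) (M := 0) (B := V - Real.log 4 - (c + 1)) ?_ ?_ z hz
    · linarith
    · intro w hw a ha
      have h1 : ContinuousWithinAt (fun y => -Real.log (max ‖y - ζ‖ ρ) - u y) (outerDomain K) w :=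
        hφ.continuousWithinAt.sub ((hu.continuousOn w hw.1).mono subset_closure)
      have h1w : a < -Real.log (max ‖w - ζ‖ ρ) - u w := by
        rw [hu.eq_on w hw]; simpa using ha
      have h2 := h1.eventually (lt_mem_nhds h1w)
      filter_upwards [h2, self_mem_nhdsWithin] with y hy hyG
      have h3 : Real.log ‖y - ζ‖ ≤ Real.log (max ‖y - ζ‖ ρ) := by
        refine Real.log_le_log (norm_pos_iff.2 (sub_ne_zero.2 fun h => hyG.1 (h ▸ hζ)))
          (le_max_left _ _)
      linarith [hK.neg_le y]
    · refine Filter.Eventually.filter_mono inf_le_left ?_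
      filter_upwards [hc.eventually (gt_mem_nhds (lt_add_one c)),
        (tendsto_norm_cocompact_atTop (E := ℂ)).eventually_ge_atTop (2 * R)] with y hy1 hy2
      have h1 := log_half_norm_le_logMean (by linarith) haeR hy2
      have hy0 : 0 < ‖y‖ := by linarith
      have h2 : Real.log ‖y - ζ‖ ≤ Real.log (2 * ‖y‖) := by
        refine Real.log_le_log ?_ ?_
        · linarith [norm_sub_norm_le y ζ]
        · linarith [norm_sub_le y ζ]
      rw [Real.log_div hy0.ne' two_ne_zero] at h1
      rw [Real.log_mul two_ne_zero hy0.ne'] at h2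
      have h4 : Real.log 4 = Real.log 2 + Real.log 2 := by
        rw [← Real.log_mul two_ne_zero two_ne_zero]; norm_num
      linarith
  -- Fatou's lemma removes the truncation.
  calc pot A ν ζ = ∫⁻ w, liminf (fun n : ℕ => ENNReal.ofReal
        (Real.log A - Real.log (max ‖w - ζ‖ (1 / ((n : ℝ) + 1))))) atTop ∂ν := by
        simp_rw [(tendsto_ofReal_truncated_logKer hA0 ζ _).liminf_eq]; rfl
    _ ≤ liminf (fun n : ℕ => ∫⁻ w, ENNReal.ofReal
        (Real.log A - Real.log (max ‖w - ζ‖ (1 / ((n : ℝ) + 1)))) ∂ν) atTop :=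
      lintegral_liminf_le fun n => by fun_prop
    _ ≤ _ := by
      refine liminf_le_of_frequently_le' (Frequently.of_forall fun n => ?_)
      set ρ : ℝ := 1 / ((n : ℝ) + 1)
      have hρ : 0 < ρ := by positivity
      have hρ1 : ρ ≤ 1 := by
        rw [div_le_one (by positivity)]; linarith [(Nat.cast_nonneg n : (0 : ℝ) ≤ n)]
      have hbd : ∀ᵐ w ∂ν, max ‖w - ζ‖ ρ ≤ A := hae.mono fun w hw => max_le hw (hρ1.trans hA)
      have hi : Integrable (fun w => Real.log (max ‖w - ζ‖ ρ)) ν := by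
        refine Integrable.of_bound (C := |Real.log ρ| + |Real.log A|)
          (Measurable.log (by fun_prop)).aestronglyMeasurable ?_
        filter_upwards [hbd] with w hw
        exact abs_log_le_of_mem_Icc hρ ⟨le_max_right _ _, hw⟩
      have hi2 : Integrable (fun w => Real.log A - Real.log (max ‖w - ζ‖ ρ)) ν :=
        (integrable_const _).sub hi
      rw [← ofReal_integral_eq_lintegral_ofReal hi2]
      · refine ENNReal.ofReal_le_ofReal ?_
        rw [integral_sub (integrable_const _) hi]
        have := key ρ hρ
        rw [integral_neg] at this
        simp only [integral_const, probReal_univ, smul_eq_mul, one_mul]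
        linarith
      · filter_upwards [hbd] with w hw
        simpa using Real.log_le_log (lt_max_of_lt_right hρ) hw

/-! ### The Green function g = V + `logMean μ` vanishes at the boundary, approached from the outer
domain. -/

lemma LogIntegrableAt.restrict {μ : Measure ℂ} {z : ℂ} (h : LogIntegrableAt μ z) (T : Set ℂ) :
    LogIntegrableAt (μ.restrict T) z :=
  ⟨h.1.restrict, nonpos_iff_eq_zero.1 ((Measure.restrict_le_self _).trans h.2.le)⟩

/-- The energy of a probability measure on `K` with respect to `μ` is at least the minimal one. -/
def IsMinimalOn (K : Set ℂ) (μ : Measure ℂ) (V : ℝ) : Prop :=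
  ∀ A : ℝ, 1 ≤ A → (∀ z ∈ K, ∀ w ∈ K, ‖z - w‖ ≤ A) → ∀ ν ∈ probOn K, energy A ν ≠ ⊤ →
    ENNReal.ofReal (V + Real.log A) ≤ ∫⁻ z, pot A μ z ∂ν

lemma probOn_mono {K K' : Set ℂ} (h : K ⊆ K') : probOn K ⊆ probOn K' := fun _ hν =>
  ⟨hν.1, measure_mono_null (compl_subset_compl.2 h) hν.2⟩

/-- Split μ = σ + τ along T and let ν be the harmonic measure of z. Minimality bounds V + log A,
which is g(z) plus the potentials of σ and τ at z, by ∫ pot σ dν + ∫ pot ν dτ. The first integral is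
at most u(z). By the Green bound on pot ν, the second is at most the potential of τ at z plus (1 -
μ(T)) g(z). Cancelling leaves the claim. -/
lemma restrict_mul_green_le {K : Set ℂ} {μ : Measure ℂ} {V : ℝ}
    (hK : IsBoundedPotential K μ V) (hmin : IsMinimalOn K μ V) (hreg : IsDirichletRegular K)
    {A : ℝ} (hA : 1 ≤ A) (hKA : ∀ z ∈ K, ∀ w ∈ K, ‖z - w‖ ≤ A) {T : Set ℂ}
    (hT : MeasurableSet T) {φ u : ℂ → ℝ} (hφ : Continuous φ) (hφ0 : ∀ w, 0 ≤ φ w)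
    (hpot : ∀ w ∈ K, pot A (μ.restrict T) w ≤ ENNReal.ofReal (φ w))
    (hu : IsDirichletSolution K φ u) {z : ℂ} (hz : z ∈ outerDomain K)
    (hzA : ∀ w ∈ K, ‖z - w‖ ≤ A) :
    μ.real T * (V + logMean μ z) ≤
      u z - (μ.real T * Real.log A - logMean (μ.restrict T) z) := by
  have hprob := hK.mem_probOn.1
  have hA0 : 0 < A := by linarith
  obtain ⟨ν, hν, hνu⟩ := exists_harmonicMeasure hK hreg hz
  have := hν.1
  have hνK : ν ∈ probOn K := probOn_mono (frontier_outerDomain_subset hK.isCompact) hν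
  have haeK : ∀ᵐ w ∂μ, w ∈ K := ae_mem_of_mem_probOn hK.mem_probOn
  have hH : 0 ≤ V + logMean μ z := by linarith [hK.neg_le z]
  have hle := fun ζ (hζ : ζ ∈ K) => pot_harmonicMeasure_le hK hreg hz hν hνu hA hKA hζ
  -- Since z has positive distance d to K, the Green bound makes the potential of ν bounded on K.
  have hfin : energy A ν ≠ ⊤ := by
    obtain ⟨d, hd, hball⟩ := Metric.isOpen_iff.1 hK.isCompact.isClosed.isOpen_compl z
      (outerDomain_subset K hz)
    refine ne_top_of_le_ne_top (b := ENNReal.ofReal (Real.log A - Real.log d + (V + logMean μ z)))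
      ENNReal.ofReal_ne_top ?_
    calc energy A ν ≤ ∫⁻ _, ENNReal.ofReal (Real.log A - Real.log d + (V + logMean μ z)) ∂ν := by
          refine lintegral_mono_ae ?_
          filter_upwards [ae_mem_of_mem_probOn hνK] with ζ hζ
          refine (hle ζ hζ).trans (ENNReal.ofReal_le_ofReal ?_)
          have : d ≤ ‖z - ζ‖ := by
            by_contra! h
            exact hball (by rwa [mem_ball_iff_norm, norm_sub_rev]) hζ
          linarith [Real.log_le_log hd this]
      _ = _ := by simp
  have h1 := hmin A hA hKA ν hνK hfin
  set σ := μ.restrict T with hσ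
  set τ := μ.restrict Tᶜ with hτ
  have hστ : σ + τ = μ := Measure.restrict_add_restrict_compl hT
  have hpa : ∀ w, pot A μ w = pot A σ w + pot A τ w := fun w => by
    rw [pot, ← hστ, lintegral_add_measure]; rfl
  have hlm : logMean μ z = logMean σ z + logMean τ z := by
    rw [logMean, logMean, logMean, ← integral_add_measure ((hK.logIntegrableAt z).restrict T).1
      ((hK.logIntegrableAt z).restrict Tᶜ).1, hστ]
  have hmass : μ.real T + μ.real Tᶜ = 1 := by
    rw [measureReal_add_measureReal_compl hT, probReal_univ]
  have h2 : ∫⁻ w, pot A σ w ∂ν ≤ ENNReal.ofReal (u z) := by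
    calc ∫⁻ w, pot A σ w ∂ν ≤ ∫⁻ w, ENNReal.ofReal (φ w) ∂ν := by
          refine lintegral_mono_ae ?_
          filter_upwards [ae_mem_of_mem_probOn hνK] with w hw using hpot w hw
      _ = ENNReal.ofReal (∫ w, φ w ∂ν) := by
          rw [ofReal_integral_eq_lintegral_ofReal _ (Eventually.of_forall hφ0)]
          obtain ⟨B, hB⟩ := hK.isCompact.exists_bound_of_continuousOn hφ.continuousOn
          refine Integrable.of_bound (C := B) hφ.aestronglyMeasurable ?_
          filter_upwards [ae_mem_of_mem_probOn hνK] with w hw using hB w hw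
      _ = _ := by rw [hνu φ hφ u hu]
  have h3 : ∫⁻ w, pot A τ w ∂ν ≤ ENNReal.ofReal
      (μ.real Tᶜ * (Real.log A + (V + logMean μ z)) - logMean τ z) := by
    rw [lintegral_pot_comm]
    have hi : Integrable (fun ζ => Real.log ‖z - ζ‖) τ := ((hK.logIntegrableAt z).restrict Tᶜ).1
    have hi2 : Integrable (fun ζ => (Real.log A + (V + logMean μ z)) - Real.log ‖z - ζ‖) τ :=
      (integrable_const _).sub hi
    have haeτ : ∀ᵐ w ∂τ, w ∈ K := ae_restrict_of_ae haeK
    calc ∫⁻ ζ, pot A ν ζ ∂τ ≤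
          ∫⁻ ζ, ENNReal.ofReal ((Real.log A + (V + logMean μ z)) - Real.log ‖z - ζ‖) ∂τ := by
          refine lintegral_mono_ae ?_
          filter_upwards [haeτ] with ζ hζ
          refine (hle ζ hζ).trans (le_of_eq ?_)
          congr 1
          ring
      _ = ENNReal.ofReal
          (∫ ζ, ((Real.log A + (V + logMean μ z)) - Real.log ‖z - ζ‖) ∂τ) := by
          rw [ofReal_integral_eq_lintegral_ofReal hi2]
          filter_upwards [haeτ, ((hK.logIntegrableAt z).restrict Tᶜ).ae_ne] with ζ hζ h0
          have := Real.log_le_log h0 (hzA ζ hζ)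
          simp only [Pi.zero_apply]
          linarith
      _ = _ := by
          rw [integral_sub (integrable_const _) hi]
          simp [logMean, hτ, measureReal_restrict_apply]
  have hu0 : 0 ≤ u z := hu.nonneg hK (fun w _ => hφ0 w) z hz
  have h4 : 0 ≤ μ.real Tᶜ * (Real.log A + (V + logMean μ z)) - logMean τ z := by
    have := logMean_le_of_ae_le (ν := τ) (A := A) (z := z)
      ((ae_restrict_of_ae haeK).mono fun w hw => hzA w hw) ((hK.logIntegrableAt z).restrict Tᶜ)
    have h5 : τ.real univ = μ.real Tᶜ := by simp [hτ, measureReal_restrict_apply]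
    rw [h5] at this
    have : 0 ≤ μ.real Tᶜ * (V + logMean μ z) := mul_nonneg measureReal_nonneg hH
    linarith
  have h5 : ENNReal.ofReal (V + Real.log A) ≤ ENNReal.ofReal (u z +
      (μ.real Tᶜ * (Real.log A + (V + logMean μ z)) - logMean τ z)) := by
    rw [ENNReal.ofReal_add hu0 h4]
    refine h1.trans ?_
    simp_rw [hpa]
    rw [lintegral_add_left (measurable_pot A σ)]
    exact add_le_add h2 h3
  have h6 := (ENNReal.ofReal_le_ofReal_iff (add_nonneg hu0 h4)).1 h5
  have h7 : μ.real Tᶜ = 1 - μ.real T := by linarith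
  rw [h7] at h6
  linarith

/-- The Green function tends to zero at the boundary of a regular domain. -/
theorem eventually_green_lt {K : Set ℂ} {μ : Measure ℂ} {V : ℝ}
    (hK : IsBoundedPotential K μ V) (hmin : IsMinimalOn K μ V) (hreg : IsDirichletRegular K)
    {z₀ : ℂ} (hz₀ : z₀ ∈ frontier (outerDomain K)) {η : ℝ} (hη : 0 < η) :
    ∀ᶠ z in 𝓝[outerDomain K] z₀, V + logMean μ z < η := by
  have hprob := hK.mem_probOn.1
  have hz₀K := frontier_outerDomain_subset hK.isCompact hz₀
  obtain ⟨R, hR⟩ := hK.isCompact.isBounded.exists_norm_le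
  have haeK : ∀ᵐ w ∂μ, w ∈ K := ae_mem_of_mem_probOn hK.mem_probOn
  have haeR : ∀ᵐ w ∂μ, ‖w‖ ≤ R := haeK.mono fun w hw => hR w hw
  -- The extra 1 keeps points within distance 1 of z₀ at distance at most A from K.
  set A := max 1 (2 * R + 1)
  have hA : 1 ≤ A := le_max_left _ _
  have hA0 : 0 < A := by linarith
  have hA2 : 2 * R + 1 ≤ A := le_max_right _ _
  have hKA : ∀ z ∈ K, ∀ w ∈ K, ‖z - w‖ ≤ A := fun z hz w hw => by
    linarith [norm_sub_le z w, hR z hz, hR w hw]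
  obtain ⟨δ, hδ, hδμ⟩ := exists_measureReal_closedBall_lt (hK.logIntegrableAt z₀).2 one_half_pos
  -- Removing a small ball makes the potential of the remaining part continuous at z₀, yet more than
  -- half of the mass is kept.
  set T : Set ℂ := (Metric.closedBall z₀ δ)ᶜ with hT
  have hTm : MeasurableSet T := measurableSet_closedBall.compl
  have hmass : 1 / 2 < μ.real T := by
    have : μ.real (Metric.closedBall z₀ δ) + μ.real T = 1 := by
      rw [measureReal_add_measureReal_compl measurableSet_closedBall, probReal_univ]
    linarith
  set σ := μ.restrict T with hσ
  have hσu : σ.real univ = μ.real T := by simp [hσ, measureReal_restrict_apply]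
  have haeKσ : ∀ᵐ w ∂σ, w ∈ K := ae_restrict_of_ae haeK
  have hσδ : ∀ᵐ w ∂σ, δ ≤ ‖z₀ - w‖ := by
    filter_upwards [ae_restrict_mem hTm] with w hw
    rw [hT, mem_compl_iff, mem_closedBall_iff_norm, not_le, norm_sub_rev] at hw
    exact hw.le
  have hcont : ContinuousAt (logMean σ) z₀ :=
    continuousAt_logMean (haeKσ.mono fun w hw => hR w hw) hδ hσδ
  have hLI : ∀ z, LogIntegrableAt σ z := fun z => (hK.logIntegrableAt z).restrict T
  have hpotσ : ∀ w ∈ K, pot A σ w = ENNReal.ofReal (μ.real T * Real.log A - logMean σ w) :=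
    fun w hw => by
      rw [pot_eq_ofReal hA0 (haeKσ.mono fun y hy => hKA w hw y hy) (hLI w), hσu]
  set p₀ := μ.real T * Real.log A - logMean σ z₀ with hp₀
  have hp₀0 : 0 ≤ p₀ := by
    have := logMean_le_of_ae_le (haeKσ.mono fun y hy => hKA z₀ hz₀K y hy) (hLI z₀)
    rw [hσu] at this
    linarith
  set ε := η / 8
  have hε : 0 < ε := by positivity
  obtain ⟨d, hd, hdσ⟩ := Metric.eventually_nhds_iff_ball.1
    (hcont.eventually (lt_mem_nhds (sub_lt_self (logMean σ z₀) hε)))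
  -- With this slope φ exceeds log A + V, a bound for the potential of all of μ, outside the ball of
  -- radius d, while φ(z₀) is only ε above the potential of σ at z₀.
  set C := |Real.log A + V| / d
  set φ : ℂ → ℝ := fun w => p₀ + ε + C * ‖w - z₀‖ with hφ
  have hφc : Continuous φ := by fun_prop
  have hC : 0 ≤ C := by positivity
  have hφ0 : ∀ w, 0 ≤ φ w := fun w => by simp only [hφ]; positivity
  have hpot : ∀ w ∈ K, pot A σ w ≤ ENNReal.ofReal (φ w) := fun w hw => by
    by_cases hwd : w ∈ Metric.ball z₀ d
    · rw [hpotσ w hw]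
      refine ENNReal.ofReal_le_ofReal ?_
      have h1 := hdσ w hwd
      have : 0 ≤ C * ‖w - z₀‖ := by positivity
      simp only [hφ]
      linarith
    · rw [mem_ball_iff_norm, not_lt] at hwd
      calc pot A σ w ≤ pot A μ w := lintegral_mono' Measure.restrict_le_self le_rfl
        _ = ENNReal.ofReal (Real.log A - logMean μ w) := by
          rw [pot_eq_ofReal hA0 (haeK.mono fun y hy => hKA w hw y hy) (hK.logIntegrableAt w)]
          simp
        _ ≤ _ := by
          refine ENNReal.ofReal_le_ofReal ?_
          have h1 : |Real.log A + V| ≤ C * ‖w - z₀‖ := by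
            calc |Real.log A + V| = C * d := by simp only [C]; field_simp
              _ ≤ _ := by gcongr
          have h2 := hK.neg_le w
          simp only [hφ]
          linarith [le_abs_self (Real.log A + V)]
  obtain ⟨u, hu⟩ := hreg.exists_solution hφc.continuousOn
  have hlim : ContinuousWithinAt (fun z => u z + logMean σ z) (outerDomain K) z₀ :=
    ((hu.continuousOn z₀ hz₀.1).mono subset_closure).add hcont.continuousWithinAt
  have hlt : u z₀ + logMean σ z₀ < μ.real T * Real.log A + 2 * ε := by
    rw [hu.eq_on z₀ hz₀]
    simp only [hφ, sub_self, norm_zero, mul_zero]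
    linarith
  have h1 := hlim.eventually (gt_mem_nhds hlt)
  filter_upwards [h1, self_mem_nhdsWithin,
    nhdsWithin_le_nhds (Metric.ball_mem_nhds z₀ one_pos)] with z hz1 hz2 hz3
  have hzA : ∀ w ∈ K, ‖z - w‖ ≤ A := fun w hw => by
    rw [mem_ball_iff_norm] at hz3
    have h4 : ‖z‖ ≤ ‖z - z₀‖ + ‖z₀‖ := by simpa using norm_add_le (z - z₀) z₀
    linarith [norm_sub_le z w, hR z₀ hz₀K, hR w hw]
  have h2 := restrict_mul_green_le hK hmin hreg hA hKA hTm hφc hφ0 hpot hu hz2 hzA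
  have h3 : μ.real T * (V + logMean μ z) < 2 * ε := by linarith
  have hH : 0 ≤ V + logMean μ z := by linarith [hK.neg_le z]
  have : ε = η / 8 := rfl
  nlinarith

/-! ### From boundary limits to values on K, by averaging over radii. -/

/-- The positive part of `log (t / |t - ρ|)`, with the value `∞` for `t = ρ`. -/
def radialKer (t ρ : ℝ) : ℝ≥0∞ :=
  if t = ρ then ⊤ else ENNReal.ofReal (Real.log t - Real.log |t - ρ|)

lemma measurable_radialKer : Measurable fun p : ℝ × ℝ => radialKer p.1 p.2 :=
  Measurable.ite (measurableSet_eq_fun measurable_fst measurable_snd) measurable_const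
    (by fun_prop)

lemma integral_log_sub_log_abs {t : ℝ} :
    ∫ ρ in (0 : ℝ)..2 * t, (Real.log t - Real.log |t - ρ|) = 2 * t := by
  simp_rw [Real.log_abs]
  have hi : IntervalIntegrable (fun ρ => Real.log (t - ρ)) volume 0 (2 * t) := by
    have := (intervalIntegral.intervalIntegrable_log' (a := t) (b := -t)).comp_sub_left t
    convert! this using 1 <;> ring
  rw [intervalIntegral.integral_sub (by simp) hi, intervalIntegral.integral_comp_sub_left
    (fun x => Real.log x) t, integral_log, intervalIntegral.integral_const]
  have : t - 2 * t = -t := by ring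
  rw [this, Real.log_neg_eq_log]
  simp only [smul_eq_mul]
  ring_nf

lemma lintegral_radialKer_le {t : ℝ} (ht : 0 < t) (r : ℝ) :
    ∫⁻ ρ in Ioo 0 r, radialKer t ρ ≤ ENNReal.ofReal (2 * t) := by
  have hi : IntervalIntegrable (fun ρ => Real.log t - Real.log |t - ρ|) volume 0 (2 * t) := by
    simp_rw [Real.log_abs]
    refine IntervalIntegrable.sub (by simp) ?_
    have := (intervalIntegral.intervalIntegrable_log' (a := t) (b := -t)).comp_sub_left t
    convert! this using 1 <;> ring
  have hne : ∀ᵐ ρ ∂(volume : Measure ℝ), ρ ≠ t := by simp [ae_iff]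
  have hpt : ∀ ρ, ρ ≠ t → (Ioo 0 r).indicator (radialKer t) ρ ≤
      (Ioc 0 (2 * t)).indicator (fun ρ => ENNReal.ofReal (Real.log t - Real.log |t - ρ|)) ρ := by
    intro ρ hρ
    by_cases h1 : ρ ∈ Ioo 0 r
    · rw [indicator_of_mem h1, radialKer, if_neg hρ.symm]
      by_cases h2 : ρ ≤ 2 * t
      · rw [indicator_of_mem (show ρ ∈ Ioc 0 (2 * t) from ⟨h1.1, h2⟩)]
      · rw [ENNReal.ofReal_of_nonpos]
        · exact zero_le
        · push Not at h2
          have h3 : t ≤ |t - ρ| := by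
            rw [abs_sub_comm]; exact (by linarith : t ≤ ρ - t).trans (le_abs_self _)
          linarith [Real.log_le_log ht h3]
    · rw [indicator_of_notMem h1]
      exact zero_le
  calc ∫⁻ ρ in Ioo 0 r, radialKer t ρ = ∫⁻ ρ, (Ioo 0 r).indicator (radialKer t) ρ :=
        (lintegral_indicator measurableSet_Ioo _).symm
    _ ≤ ∫⁻ ρ, (Ioc 0 (2 * t)).indicator
          (fun ρ => ENNReal.ofReal (Real.log t - Real.log |t - ρ|)) ρ := by
        refine lintegral_mono_ae ?_
        filter_upwards [hne] with ρ hρ using hpt ρ hρ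
    _ = ENNReal.ofReal (∫ ρ in Ioc 0 (2 * t), (Real.log t - Real.log |t - ρ|)) := by
        rw [lintegral_indicator measurableSet_Ioc, ofReal_integral_eq_lintegral_ofReal]
        · exact (intervalIntegrable_iff_integrableOn_Ioc_of_le (by linarith)).1 hi
        · filter_upwards [ae_restrict_mem measurableSet_Ioc, ae_restrict_of_ae hne] with ρ hρ h
          simp only [Pi.zero_apply, sub_nonneg]
          refine Real.log_le_log (abs_pos.2 (sub_ne_zero.2 h.symm)) ?_
          rw [abs_le]
          constructor <;> linarith [hρ.1, hρ.2]
    _ = _ := by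
        rw [← intervalIntegral.integral_of_le (by linarith), integral_log_sub_log_abs]

lemma lintegral_radialKer_le_of_two_mul_le {t r : ℝ} (hr : 0 < r) (htr : 2 * r ≤ t) :
    ∫⁻ ρ in Ioo 0 r, radialKer t ρ ≤ ENNReal.ofReal (r * (2 * r / t)) := by
  have ht : 0 < t := by linarith
  calc ∫⁻ ρ in Ioo 0 r, radialKer t ρ ≤ ∫⁻ _ in Ioo 0 r, ENNReal.ofReal (2 * r / t) := by
        refine setLIntegral_mono measurable_const fun ρ hρ => ?_
        have h1 : 0 < t - ρ := by linarith [hρ.2]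
        rw [radialKer, if_neg (by linarith), abs_of_pos h1, ← Real.log_div ht.ne' h1.ne']
        refine ENNReal.ofReal_le_ofReal ?_
        refine (Real.log_le_sub_one_of_pos (by positivity)).trans ?_
        rw [div_sub_one h1.ne', div_le_div_iff₀ h1 ht]
        nlinarith [hρ.1, hρ.2]
    _ = _ := by
        rw [setLIntegral_const, Real.volume_Ioo, sub_zero, mul_comm, ← ENNReal.ofReal_mul hr.le]

/-- Averaged over radii in (0, r), the kernel is at most 4 on the ball B, whose mass is below ε/8,
and at most ε/2 elsewhere. The mean over ρ of the μ-integral is thus at most ε, so some radius is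
good. -/
lemma exists_radius_lintegral_radialKer_le {μ : Measure ℂ} [IsProbabilityMeasure μ] {z₀ : ℂ}
    (h0 : μ {z₀} = 0) {ε r₀ : ℝ} (hε : 0 < ε) (hr₀ : 0 < r₀) :
    ∃ ρ ∈ Ioo 0 r₀, ∫⁻ w, radialKer ‖w - z₀‖ ρ ∂μ ≤ ENNReal.ofReal ε := by
  obtain ⟨δ, hδ, hδμ⟩ := exists_measureReal_closedBall_lt h0 (η := ε / 8) (by positivity)
  set r := min r₀ (min (δ / 2) (δ * ε / 4)) with hr
  have hr0 : 0 < r := by positivity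
  have hr1 : r ≤ δ / 2 := (min_le_right _ _).trans (min_le_left _ _)
  have hr2 : r ≤ δ * ε / 4 := (min_le_right _ _).trans (min_le_right _ _)
  set B := Metric.closedBall z₀ δ with hB
  have hBm : MeasurableSet B := measurableSet_closedBall
  have hpt : ∀ᵐ w ∂μ, ∫⁻ ρ in Ioo 0 r, radialKer ‖w - z₀‖ ρ ≤
      ENNReal.ofReal (4 * r) * B.indicator 1 w + ENNReal.ofReal (r * (ε / 2)) := by
    filter_upwards [measure_eq_zero_iff_ae_notMem.1 h0] with w hw
    have ht : 0 < ‖w - z₀‖ := norm_pos_iff.2 (sub_ne_zero.2 hw)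
    rcases le_total ‖w - z₀‖ (2 * r) with h1 | h1
    · have hwB : w ∈ B := by
        rw [hB, mem_closedBall_iff_norm]; linarith
      rw [indicator_of_mem hwB]
      refine (lintegral_radialKer_le ht r).trans (le_add_right ?_)
      simp only [Pi.one_apply, mul_one]
      exact ENNReal.ofReal_le_ofReal (by linarith)
    · by_cases hwB : w ∈ B
      · rw [indicator_of_mem hwB]
        refine (lintegral_radialKer_le_of_two_mul_le hr0 h1).trans (le_add_right ?_)
        simp only [Pi.one_apply, mul_one]
        refine ENNReal.ofReal_le_ofReal ?_
        have : 2 * r / ‖w - z₀‖ ≤ 1 := (div_le_one ht).2 h1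
        nlinarith
      · refine (lintegral_radialKer_le_of_two_mul_le hr0 h1).trans (le_add_left ?_)
        refine ENNReal.ofReal_le_ofReal ?_
        rw [hB, mem_closedBall_iff_norm, not_le] at hwB
        have : 2 * r / ‖w - z₀‖ ≤ ε / 2 := by
          rw [div_le_iff₀ ht]
          nlinarith
        gcongr
  have htot : ∫⁻ ρ in Ioo 0 r, ∫⁻ w, radialKer ‖w - z₀‖ ρ ∂μ ≤ ENNReal.ofReal (r * ε) := by
    have hm : Measurable fun p : ℝ × ℂ => radialKer ‖p.2 - z₀‖ p.1 :=
      measurable_radialKer.comp (by fun_prop : Measurable fun p : ℝ × ℂ => (‖p.2 - z₀‖, p.1))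
    rw [lintegral_lintegral_swap hm.aemeasurable]
    calc ∫⁻ w, (∫⁻ ρ in Ioo 0 r, radialKer ‖w - z₀‖ ρ) ∂μ ≤
        ∫⁻ w, (ENNReal.ofReal (4 * r) * B.indicator 1 w + ENNReal.ofReal (r * (ε / 2))) ∂μ :=
          lintegral_mono_ae hpt
      _ = ENNReal.ofReal (4 * r) * μ B + ENNReal.ofReal (r * (ε / 2)) := by
          rw [lintegral_add_right _ measurable_const,
            lintegral_const_mul _ (measurable_one.indicator hBm), lintegral_indicator_one hBm]
          simp
      _ ≤ ENNReal.ofReal (4 * r) * ENNReal.ofReal (ε / 8) + ENNReal.ofReal (r * (ε / 2)) := by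
          gcongr
          rw [← ofReal_measureReal]
          exact ENNReal.ofReal_le_ofReal hδμ.le
      _ = _ := by
          rw [← ENNReal.ofReal_mul (by positivity), ← ENNReal.ofReal_add (by positivity)
            (by positivity)]
          ring_nf
  by_contra! hcon
  have hrr : Ioo 0 r ⊆ Ioo 0 r₀ := Ioo_subset_Ioo_right (min_le_left _ _)
  have hlt : ∫⁻ _ in Ioo 0 r, ENNReal.ofReal ε < ∫⁻ ρ in Ioo 0 r, ∫⁻ w, radialKer ‖w - z₀‖ ρ ∂μ := by
    refine setLIntegral_strict_mono measurableSet_Ioo (by simp [hr0]) ?_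
      (by rw [setLIntegral_const, Real.volume_Ioo]; finiteness)
      (Eventually.of_forall fun ρ hρ => hcon ρ (hrr hρ))
    have hm : Measurable fun p : ℝ × ℂ => radialKer ‖p.2 - z₀‖ p.1 :=
      measurable_radialKer.comp (by fun_prop : Measurable fun p : ℝ × ℂ => (‖p.2 - z₀‖, p.1))
    exact hm.lintegral_prod_right'
  rw [setLIntegral_const, Real.volume_Ioo, sub_zero, ← ENNReal.ofReal_mul hε.le, mul_comm] at hlt
  exact absurd (hlt.trans_le htot) (lt_irrefl _)

lemma integral_le_of_lintegral_ofReal_le {μ : Measure ℂ} {g : ℂ → ℝ} (hg : Integrable g μ) {ε : ℝ}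
    (hε : 0 ≤ ε) (h : ∫⁻ w, ENNReal.ofReal (g w) ∂μ ≤ ENNReal.ofReal ε) : ∫ w, g w ∂μ ≤ ε := by
  rw [integral_eq_lintegral_pos_part_sub_lintegral_neg_part hg]
  have := ENNReal.toReal_mono ENNReal.ofReal_ne_top h
  rw [ENNReal.toReal_ofReal hε] at this
  linarith [ENNReal.toReal_nonneg (a := ∫⁻ w, ENNReal.ofReal (-g w) ∂μ)]

/-- Upper semicontinuity bounds nearby values by the value at z₀, which is the wrong direction. For
z on the circle of radius ρ, |z - w| ≥ ||w - z₀| - ρ|, so the potentials at z₀ and z compare through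
`radialKer`, and a good circle still meets the outer domain. -/
lemma logMean_le_of_mem_frontier {K : Set ℂ} {μ : Measure ℂ} {V : ℝ}
    (hK : IsBoundedPotential K μ V) (hmin : IsMinimalOn K μ V) (hreg : IsDirichletRegular K)
    {z₀ : ℂ} (hz₀ : z₀ ∈ frontier (outerDomain K)) : logMean μ z₀ ≤ -V := by
  have hprob := hK.mem_probOn.1
  refine le_of_forall_pos_le_add fun ε hε => ?_
  obtain ⟨r₀, hr₀, hball⟩ := Metric.mem_nhdsWithin_iff.1
    (eventually_green_lt hK hmin hreg hz₀ (half_pos hε))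
  obtain ⟨ρ, hρ, hρμ⟩ := exists_radius_lintegral_radialKer_le (hK.logIntegrableAt z₀).2
    (half_pos hε) hr₀
  obtain ⟨z, hz, hzρ⟩ := exists_mem_outerDomain_norm_eq hz₀.1 hρ.1
  have h1 : V + logMean μ z < ε / 2 :=
    hball ⟨by rw [mem_ball_iff_norm, hzρ]; exact hρ.2, hz⟩
  have h2 : ∫ w, (Real.log ‖z₀ - w‖ - Real.log ‖z - w‖) ∂μ ≤ ε / 2 := by
    refine integral_le_of_lintegral_ofReal_le
      ((hK.logIntegrableAt z₀).1.sub (hK.logIntegrableAt z).1) (half_pos hε).le ?_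
    refine (lintegral_mono_ae ?_).trans hρμ
    filter_upwards [(hK.logIntegrableAt z).ae_ne] with w hw
    rw [radialKer]
    split_ifs with h
    · exact le_top
    · refine ENNReal.ofReal_le_ofReal ?_
      simp only [Pi.sub_apply]
      rw [norm_sub_rev z₀ w]
      have h3 : |‖w - z₀‖ - ρ| ≤ ‖z - w‖ := by
        rw [← hzρ, norm_sub_rev z w]
        simpa using abs_norm_sub_norm_le (w - z₀) (z - z₀)
      have := Real.log_le_log (abs_pos.2 (sub_ne_zero.2 h)) h3
      linarith
  rw [integral_sub (hK.logIntegrableAt z₀).1 (hK.logIntegrableAt z).1] at h2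
  simp only [logMean] at h1 ⊢
  linarith

/-- The equilibrium potential of a regular compact set is constant on the set. -/
theorem logMean_le_of_mem {K : Set ℂ} {μ : Measure ℂ} {V : ℝ}
    (hK : IsBoundedPotential K μ V) (hmin : IsMinimalOn K μ V) (hreg : IsDirichletRegular K)
    {z : ℂ} (hz : z ∈ K) : logMean μ z ≤ -V := by
  have hprob := hK.mem_probOn.1
  obtain ⟨R, hR⟩ := hK.isCompact.isBounded.exists_norm_le
  have haeR : ∀ᵐ w ∂μ, ‖w‖ ≤ R := (ae_mem_of_mem_probOn hK.mem_probOn).mono fun w hw => hR w hw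
  have hzG : z ∉ outerDomain K := fun h => h.1 hz
  by_cases hzf : z ∈ frontier (outerDomain K)
  · exact logMean_le_of_mem_frontier hK hmin hreg hzf
  -- The remaining points of K lie in this bounded open set, whose frontier is covered by the
  -- boundary case and lower semicontinuity of -`logMean μ`.
  set Ω := interior (outerDomain K)ᶜ with hΩ
  have hzΩ : z ∈ Ω := by
    rw [hΩ, interior_compl]
    intro hcl
    exact hzf ⟨hcl, fun h => hzG (interior_subset h)⟩
  have hs := superharmonicOn_neg_logMean haeR hK.logIntegrableAt univ
  have := (hs.mono (subset_univ Ω)).le_of_boundary isOpen_interior (M := V) ?_ ?_ z hzΩ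
  · linarith
  · intro w hw c hc
    have hwf : w ∈ frontier (outerDomain K) := by
      rw [← frontier_compl]
      exact frontier_interior_subset hw
    have h1 := logMean_le_of_mem_frontier hK hmin hreg hwf
    have h2 := hs.1 w (mem_univ w) c (by simp only; linarith)
    rw [nhdsWithin_univ] at h2
    exact h2.filter_mono nhdsWithin_le_nhds
  · intro c _
    rw [eventually_inf_principal]
    filter_upwards [(tendsto_norm_cocompact_atTop (E := ℂ)).eventually_gt_atTop (max R 0)]
      with y hy hyΩ
    exact absurd (mem_outerDomain_of_norm_lt (le_max_right _ _)
      (fun x hx => (hR x hx).trans (le_max_left _ _)) hy) (interior_subset hyΩ)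

/-! ### Normalized denominators, coverings by disks, and fractions. -/

lemma norm_eval_ofFn_le {m : ℕ} (v : Fin (m + 1) → ℂ) {R : ℝ} {z : ℂ} (hz : ‖z‖ ≤ R) :
    ‖(ofFn (m + 1) v).eval z‖ ≤ ‖v‖ * ((m + 1) * max 1 R ^ m) := by
  rw [ofFn_eq_sum_monomial, eval_finsetSum]
  calc _ ≤ ∑ i : Fin (m + 1), ‖((monomial (i : ℕ)) (v i)).eval z‖ := norm_sum_le _ _
    _ ≤ ∑ _i : Fin (m + 1), ‖v‖ * max 1 R ^ m := by
      refine Finset.sum_le_sum fun i _ => ?_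
      rw [eval_monomial, norm_mul, norm_pow]
      refine mul_le_mul (norm_le_pi_norm v i) ?_ (by positivity) (norm_nonneg _)
      calc ‖z‖ ^ (i : ℕ) ≤ max 1 R ^ (i : ℕ) := by gcongr; exact hz.trans (le_max_right _ _)
        _ ≤ max 1 R ^ m := pow_le_pow_right₀ (le_max_left _ _) (Nat.lt_succ_iff.1 i.2)
    _ = _ := by simp; ring

/-- Some coefficient has modulus 1, so the Mahler measure |a| ∏ max(1, |a_i|) is at least 2⁻ᵐ. Away
from the roots each |z - a_i| is at least δ/(1 + R + δ) times max(1, |a_i|). -/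
lemma exists_roots_lower_bound {m : ℕ} {v : Fin (m + 1) → ℂ} (hv : ‖v‖ = 1) :
    ∃ c : Fin m → ℂ, ∀ R δ : ℝ, 0 ≤ R → 0 < δ → ∀ z : ℂ, ‖z‖ ≤ R → (∀ i, δ ≤ ‖z - c i‖) →
      (δ / (2 * (1 + R + δ))) ^ m ≤ ‖(ofFn (m + 1) v).eval z‖ := by
  set q := ofFn (m + 1) v with hq
  have hdeg : q.natDegree ≤ m := Nat.lt_succ_iff.1 (ofFn_natDegree_lt (by omega) v)
  have hcard : Multiset.card q.roots ≤ m := (card_roots' q).trans hdeg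
  -- The default 0 fills up the list when there are fewer than m roots; superfluous centers only
  -- strengthen the hypothesis on z.
  refine ⟨fun i => q.roots.toList.getD i 0, fun R δ hR hδ z hz hzc => ?_⟩
  have hroot : ∀ a ∈ q.roots, δ ≤ ‖z - a‖ := fun a ha => by
    obtain ⟨i, hi, rfl⟩ := List.getElem_of_mem (Multiset.mem_toList.2 ha)
    have hi' : i < m := by
      rw [Multiset.length_toList] at hi; omega
    have : δ ≤ ‖z - q.roots.toList.getD i 0‖ := hzc ⟨i, hi'⟩
    rwa [List.getD_eq_getElem _ _ hi] at this
  set x := δ / (1 + R + δ) with hx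
  have hden : 0 < 1 + R + δ := by positivity
  have hx0 : 0 ≤ x := by positivity
  have hx1 : x ≤ 1 := (div_le_one hden).2 (by linarith)
  have hMM := mahlerMeasure_eq_leadingCoeff_mul_prod_roots q
  have hone : 1 ≤ 2 ^ m * q.mahlerMeasure := by
    obtain ⟨i, hi⟩ : ∃ i, ‖v i‖ = 1 := by
      by_contra! h
      have hlt : ∀ i, ‖v i‖ < 1 := fun i => lt_of_le_of_ne (hv ▸ norm_le_pi_norm v i) (h i)
      have := (pi_norm_lt_iff one_pos).2 hlt
      exact absurd hv this.ne
    have h1 := norm_coeff_le_choose_mul_mahlerMeasure (i : ℕ) q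
    rw [hq, ofFn_coeff_eq_val_of_lt v i.2, ← hq] at h1
    simp only [Fin.eta, hi] at h1
    refine h1.trans ?_
    gcongr
    · exact mahlerMeasure_nonneg q
    · calc ((q.natDegree.choose i : ℕ) : ℝ) ≤ ((2 ^ q.natDegree : ℕ) : ℝ) := by
            exact_mod_cast Nat.choose_le_two_pow _ _
        _ ≤ 2 ^ m := by
            push_cast
            exact pow_le_pow_right₀ one_le_two hdeg
  have hprod : x ^ Multiset.card q.roots * (q.roots.map fun a => max 1 ‖a‖).prod ≤
      (q.roots.map fun a => ‖z - a‖).prod := by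
    have h1 : x ^ Multiset.card q.roots * (q.roots.map fun a => max 1 ‖a‖).prod =
        (q.roots.map fun a => x * max 1 ‖a‖).prod := by
      rw [Multiset.prod_map_mul, Multiset.map_const', Multiset.prod_replicate]
    rw [h1]
    refine Multiset.prod_map_le_prod_map₀ _ _ (fun a _ => by positivity) fun a ha => ?_
    have h2 := hroot a ha
    rw [hx, div_mul_eq_mul_div, div_le_iff₀ hden]
    have h3 : ‖a‖ ≤ ‖z - a‖ + ‖z‖ := by
      rw [norm_sub_rev]; simpa using norm_add_le (a - z) z
    have h4 : max 1 ‖a‖ ≤ 1 + R + ‖z - a‖ := max_le (by linarith [norm_nonneg (z - a)]) (by linarith)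
    calc δ * max 1 ‖a‖ ≤ δ * (1 + R + ‖z - a‖) := by gcongr
      _ ≤ ‖z - a‖ * (1 + R + δ) := by nlinarith
  have heval : ‖q.eval z‖ = ‖q.leadingCoeff‖ * (q.roots.map fun a => ‖z - a‖).prod := by
    rw [(IsAlgClosed.splits q).eval_eq_prod_roots z, norm_mul]
    congr 1
    have := map_multiset_prod (normHom (α := ℂ)) (q.roots.map fun a => z - a)
    rw [Multiset.map_map] at this
    exact this
  calc (δ / (2 * (1 + R + δ))) ^ m = x ^ m * (1 / 2 ^ m) := by
        rw [hx, ← one_div_pow, ← mul_pow]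
        congr 1
        field_simp
    _ ≤ x ^ m * q.mahlerMeasure := by
        gcongr
        rw [div_le_iff₀ (by positivity)]
        linarith
    _ ≤ x ^ Multiset.card q.roots * q.mahlerMeasure := by
        gcongr ?_ * _
        · exact mahlerMeasure_nonneg q
        · exact pow_le_pow_of_le_one hx0 hx1 hcard
    _ ≤ ‖q.eval z‖ := by
        rw [heval, hMM, mul_left_comm]
        gcongr

lemma sigmaContent_le_tsum {ι : Type*} [Encodable ι] {A : Set ℂ} (c : ι → ℂ) (ρ : ι → ℝ≥0)
    (hA : A ⊆ ⋃ i, Metric.ball (c i) (ρ i)) : sigmaContent A ≤ ∑' i, (ρ i : ℝ≥0∞) := by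
  set c' : ℕ → ℂ := Function.extend Encodable.encode c 0
  set ρ' : ℕ → ℝ≥0 := Function.extend Encodable.encode ρ 0 with hρ'
  have hinj : Function.Injective (Encodable.encode : ι → ℕ) := Encodable.encode_injective
  have hsum : ∑' k, (ρ' k : ℝ≥0∞) = ∑' i, (ρ i : ℝ≥0∞) := by
    rw [← tsum_extend_zero hinj]
    congr 1
    ext k
    by_cases h : ∃ i : ι, Encodable.encode i = k
    · obtain ⟨i, rfl⟩ := h
      rw [hρ', hinj.extend_apply, hinj.extend_apply]
    · rw [hρ', Function.extend_apply' _ _ _ h, Function.extend_apply' _ _ _ h]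
      simp
  rw [← hsum]
  refine iInf_le_of_le c' (iInf_le_of_le ρ' (iInf_le_of_le ?_ le_rfl))
  refine hA.trans (iUnion_subset fun i => ?_)
  refine subset_iUnion_of_subset (Encodable.encode i) ?_
  simp only [c', ρ', hinj.extend_apply]
  exact subset_rfl

/-- A disk of radius ρ_i meets only circles about z₀ with radii in an interval of length 2ρ_i, and
these intervals are too short in total to cover (0, s₀). -/
lemma exists_sphere_avoiding {ι : Type*} [Countable ι] (c : ι → ℂ) (ρ : ι → ℝ≥0) (z₀ : ℂ)
    {s₀ : ℝ} (hs : 2 * ∑' i, (ρ i : ℝ≥0∞) < ENNReal.ofReal s₀) :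
    ∃ s ∈ Ioo 0 s₀, ∀ z : ℂ, ‖z - z₀‖ = s → ∀ i, (ρ i : ℝ) ≤ ‖z - c i‖ := by
  by_contra! hcon
  have hsub : Ioo 0 s₀ ⊆ ⋃ i, Ioo (‖c i - z₀‖ - ρ i) (‖c i - z₀‖ + ρ i) := by
    intro s hs
    obtain ⟨z, hz, i, hi⟩ := hcon s hs
    refine mem_iUnion.2 ⟨i, ?_⟩
    have h1 := abs_norm_sub_norm_le (z - z₀) (c i - z₀)
    rw [sub_sub_sub_cancel_right, hz, abs_le] at h1
    constructor <;> linarith [h1.1, h1.2]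
  have hvol := measure_mono (μ := volume) hsub
  rw [Real.volume_Ioo, sub_zero] at hvol
  refine absurd (hvol.trans ((measure_iUnion_le _).trans ?_)) (not_le.2 hs)
  rw [← ENNReal.tsum_mul_left]
  refine ENNReal.tsum_le_tsum fun i => ?_
  rw [Real.volume_Ioo, show ‖c i - z₀‖ + ρ i - (‖c i - z₀‖ - ρ i) = 2 * (ρ i : ℝ) by ring,
    ENNReal.ofReal_mul two_pos.le]
  simp

/-- The values of a rational function in terms of a not necessarily reduced fraction. -/
lemma eval_mul_ratEval {r : RatFunc ℂ} {p q : ℂ[X]} (hq : q ≠ 0)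
    (hr : r = algebraMap ℂ[X] (RatFunc ℂ) p / algebraMap ℂ[X] (RatFunc ℂ) q) {z : ℂ}
    (hz : r.denom.eval z ≠ 0) : q.eval z * ratEval r z = p.eval z := by
  have h1 := congrArg (Polynomial.eval z) ((RatFunc.num_mul_eq_mul_denom_iff hq).2 hr)
  rw [eval_mul, eval_mul] at h1
  rw [ratEval, RatFunc.eval, eval₂_id, eval₂_id]
  field_simp
  linear_combination h1

lemma denom_eval_ne_zero {r : RatFunc ℂ} {p q : ℂ[X]}
    (hr : r = algebraMap ℂ[X] (RatFunc ℂ) p / algebraMap ℂ[X] (RatFunc ℂ) q) {z : ℂ}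
    (hz : q.eval z ≠ 0) : r.denom.eval z ≠ 0 := by
  intro h
  obtain ⟨t, ht⟩ := hr ▸ RatFunc.denom_div_dvd p q
  exact hz (by rw [ht, eval_mul, h, zero_mul])

lemma exists_normalized_of_mem_ratClass {n m : ℕ} {r : RatFunc ℂ} (hr : r ∈ ratClass n m) :
    ∃ (p : ℂ[X]) (v : Fin (m + 1) → ℂ), p.natDegree ≤ n ∧ ‖v‖ = 1 ∧
      r = algebraMap ℂ[X] (RatFunc ℂ) p / algebraMap ℂ[X] (RatFunc ℂ) (ofFn (m + 1) v) := by
  obtain ⟨p, q, hp, hq, hq0, rfl⟩ := hr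
  have hqv : ofFn (m + 1) (toFn (m + 1) q) = q :=
    ofFn_comp_toFn_eq_id_of_natDegree_lt (Nat.lt_succ_iff.2 hq)
  set w := toFn (m + 1) q
  have hw : w ≠ 0 := fun h => hq0 (by rw [← hqv, h, ofFn_zero])
  have hw' : ‖w‖ ≠ 0 := norm_ne_zero_iff.2 hw
  set a : ℂ := ((‖w‖⁻¹ : ℝ) : ℂ) with ha
  have ha0 : a ≠ 0 := by
    rw [ha, Complex.ofReal_ne_zero]; exact inv_ne_zero hw'
  refine ⟨C a * p, a • w, (natDegree_C_mul_le _ _).trans hp, ?_, ?_⟩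
  · rw [norm_smul, ha, Complex.norm_real, norm_inv, norm_norm, inv_mul_cancel₀ hw']
  · rw [map_smul, hqv, smul_eq_C_mul, map_mul, map_mul, mul_div_mul_left]
    simpa using ha0

/-! ### Geometric convergence off small disks, and the limit of the numerators. -/

/-- Quotients `p n / q n`, where `q n` has degree at most `m` and the normalized coefficient
vector `v n`, with geometrically small differences where `W < τ`. -/
structure IsGeometric (W : ℂ → ℝ) (τ : ℝ) {m : ℕ} (p : ℕ → ℂ[X])
    (v : ℕ → Fin (m + 1) → ℂ) : Prop where
  upperSemicontinuous : UpperSemicontinuous W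
  nonneg (z : ℂ) : 0 ≤ W z
  pos : 0 < τ
  norm_eq (n : ℕ) : ‖v n‖ = 1
  bound (l : ℝ) (hl : τ⁻¹ < l) : ∃ A, 0 ≤ A ∧ ∀ᶠ n in atTop, ∀ z,
    ‖(p (n + 1)).eval z * (ofFn (m + 1) (v n)).eval z -
      (p n).eval z * (ofFn (m + 1) (v (n + 1))).eval z‖ ≤ A * l ^ n * W z ^ (n + 1)

lemma exists_limit_of_geometric {a : ℕ → ℂ} {n₀ : ℕ} {D κ : ℝ} (hκ : κ < 1)
    (h : ∀ n, n₀ ≤ n → ‖a (n + 1) - a n‖ ≤ D * κ ^ n) :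
    ∃ l, ∀ n, n₀ ≤ n → ‖a n - l‖ ≤ D / (1 - κ) * κ ^ n := by
  have h1 : ∀ n, dist (a (n + n₀)) (a (n + 1 + n₀)) ≤ D * κ ^ n₀ * κ ^ n := fun n => by
    rw [dist_comm, dist_eq_norm, mul_assoc, ← pow_add, add_comm n₀ n, add_right_comm]
    exact h _ (by omega)
  obtain ⟨l, hl⟩ := cauchySeq_tendsto_of_complete (cauchySeq_of_le_geometric κ _ hκ h1)
  refine ⟨l, fun n hn => ?_⟩
  obtain ⟨k, rfl⟩ := Nat.exists_eq_add_of_le' hn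
  have := dist_le_of_le_geometric_of_tendsto κ _ hκ h1 hl k
  rw [dist_eq_norm] at this
  refine this.trans (le_of_eq ?_)
  rw [pow_add]
  ring

lemma exists_lt_of_isCompact {W : ℂ → ℝ} (hW : UpperSemicontinuous W) {τ : ℝ}
    (hτ : 0 < τ) {C : Set ℂ} (hC : IsCompact C) (hCE : ∀ z ∈ C, W z < τ) :
    ∃ w, 0 < w ∧ w < τ ∧ ∀ z ∈ C, W z ≤ w := by
  rcases C.eq_empty_or_nonempty with rfl | hne
  · exact ⟨τ / 2, by linarith, by linarith, by simp⟩
  · obtain ⟨y, hy, hmax⟩ := UpperSemicontinuousOn.exists_isMaxOn hne hC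
      (hW.upperSemicontinuousOn C)
    exact ⟨max (τ / 2) (W y), lt_max_of_lt_left (by linarith),
      max_lt (by linarith) (hCE y hy), fun z hz => (hmax hz).trans (le_max_right _ _)⟩

/-- The property of exceptional centers `c` of the denominators. -/
def AreCenters {m : ℕ} (v : ℕ → Fin (m + 1) → ℂ) (c : ℕ → Fin m → ℂ) : Prop :=
  ∀ n, ∀ R δ : ℝ, 0 ≤ R → 0 < δ → ∀ z : ℂ, ‖z‖ ≤ R → (∀ i, δ ≤ ‖z - c n i‖) →
    (δ / (2 * (1 + R + δ))) ^ m ≤ ‖(ofFn (m + 1) (v n)).eval z‖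

lemma IsGeometric.exists_centers {W : ℂ → ℝ} {τ : ℝ} {m : ℕ} {p : ℕ → ℂ[X]}
    {v : ℕ → Fin (m + 1) → ℂ} (h : IsGeometric W τ p v) : ∃ c, AreCenters v c := by
  choose c hc using fun n => exists_roots_lower_bound (h.norm_eq n)
  exact ⟨c, hc⟩

lemma geometric_identity {A l w b κ : ℝ} (hb : b ≠ 0) (hκ : κ ≠ 0) (m n : ℕ) :
    A * l ^ n * w ^ (n + 1) = A * w / (b ^ (2 * m) * κ ^ m) * (l * w / κ ^ (2 * m)) ^ n *
      ((b * κ ^ (n + 1)) ^ m * (b * κ ^ n) ^ m) := by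
  have h : (b * κ ^ (n + 1)) ^ m * (b * κ ^ n) ^ m =
      b ^ (2 * m) * κ ^ m * (κ ^ (2 * m)) ^ n := by ring
  rw [h, div_pow, mul_pow l w]
  have : (κ ^ (2 * m)) ^ n ≠ 0 := by positivity
  have : b ^ (2 * m) * κ ^ m ≠ 0 := by positivity
  rw [div_mul_div_comm, div_mul_cancel₀ _ (by positivity)]
  ring

/-- Consecutive quotients differ by the cross difference, at most of order (l w)ⁿ on C, divided by
two denominators. Removing disks of radii η₁ κ₁ᵏ about all centers costs only a factor κ₁^(-2mn),
which is affordable for κ₁ close to 1. The removed set does not depend on n. -/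
theorem IsGeometric.exists_good_set {W : ℂ → ℝ} {τ : ℝ} {m : ℕ} {p : ℕ → ℂ[X]}
    {v : ℕ → Fin (m + 1) → ℂ} (h : IsGeometric W τ p v) {c : ℕ → Fin m → ℂ}
    (hc : AreCenters v c) {C : Set ℂ} (hC : IsCompact C) (hCE : ∀ z ∈ C, W z < τ) {η : ℝ}
    (hη : 0 < η) :
    ∃ (n₀ : ℕ) (ρ : ℕ → ℝ≥0) (D κ : ℝ) (b : ℕ → ℝ), 0 ≤ D ∧ 0 < κ ∧ κ < 1 ∧ (∀ n, 0 < b n) ∧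
      ∑' x : ℕ × Fin m, (ρ x.1 : ℝ≥0∞) ≤ ENNReal.ofReal η ∧
      ∀ z ∈ C, (∀ k i, (ρ k : ℝ) ≤ ‖z - c k i‖) →
        (∀ n, b n ≤ ‖(ofFn (m + 1) (v n)).eval z‖) ∧
        ∃ l, ∀ n, n₀ ≤ n →
          ‖(p n).eval z / (ofFn (m + 1) (v n)).eval z - l‖ ≤ D * κ ^ n := by
  obtain ⟨w, hw, hwτ, hWw⟩ := exists_lt_of_isCompact h.upperSemicontinuous h.pos hC hCE
  obtain ⟨R₀, hR₀⟩ := hC.isBounded.exists_norm_le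
  set R := max R₀ 0
  have hR : ∀ z ∈ C, ‖z‖ ≤ R := fun z hz => (hR₀ z hz).trans (le_max_left _ _)
  have hR0 : 0 ≤ R := le_max_right _ _
  obtain ⟨l, hl1, hl2⟩ := exists_between ((inv_lt_inv₀ h.pos hw).2 hwτ)
  have hl0 : 0 < l := (inv_pos.2 h.pos).trans hl1
  set lam := l * w with hlam
  have hlam0 : 0 < lam := mul_pos hl0 hw
  have hlam1 : lam < 1 := by
    calc l * w < w⁻¹ * w := by gcongr
      _ = 1 := inv_mul_cancel₀ hw.ne'
  obtain ⟨A, hA0, hA⟩ := h.bound l hl1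
  obtain ⟨n₀, hn₀⟩ := eventually_atTop.1 hA
  obtain ⟨κ₁, ⟨hκ₁0, hκ₁1⟩, hκ₁⟩ : ∃ κ₁ ∈ Ioo (0 : ℝ) 1, lam < κ₁ ^ (2 * m) := by
    have h1 : Tendsto (fun x : ℝ => x ^ (2 * m)) (𝓝[<] 1) (𝓝 (1 ^ (2 * m))) :=
      ((continuous_pow (2 * m)).tendsto 1).mono_left nhdsWithin_le_nhds
    rw [one_pow] at h1
    obtain ⟨x, hx1, hx2⟩ :=
      ((h1.eventually (lt_mem_nhds hlam1)).and (Ioo_mem_nhdsLT one_pos)).exists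
    exact ⟨x, hx2, hx1⟩
  -- The m geometric series of radii sum to m η₁/(1 - κ₁) ≤ η; η₁ ≤ 1 keeps all radii at most 1,
  -- whence the constant 2(2 + R) in b₀.
  set η₁ := min 1 (η * (1 - κ₁) / (m + 1)) with hη₁
  have h1κ : 0 < 1 - κ₁ := by linarith
  have hη₁0 : 0 < η₁ := by positivity
  have hη₁1 : η₁ ≤ 1 := min_le_left _ _
  set ρ : ℕ → ℝ≥0 := fun k => ⟨η₁ * κ₁ ^ k, by positivity⟩ with hρ
  have hρv : ∀ k, (ρ k : ℝ) = η₁ * κ₁ ^ k := fun k => rfl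
  set b₀ := η₁ / (2 * (2 + R)) with hb₀
  have hb₀0 : 0 < b₀ := by positivity
  set b : ℕ → ℝ := fun n => (b₀ * κ₁ ^ n) ^ m with hb
  have hb0 : ∀ n, 0 < b n := fun n => by positivity
  set κ := lam / κ₁ ^ (2 * m)
  have hκ0 : 0 < κ := by positivity
  have hκ1 : κ < 1 := (div_lt_one (by positivity)).2 hκ₁
  set D := A * w / (b₀ ^ (2 * m) * κ₁ ^ m) with hD
  have hD0 : 0 ≤ D := by positivity
  refine ⟨n₀, ρ, D / (1 - κ), κ, b, div_nonneg hD0 (by linarith), hκ0, hκ1, hb0, ?_,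
    fun z hz hgood => ?_⟩
  · have hρE : ∀ k, (ρ k : ℝ≥0∞) = ENNReal.ofReal (η₁ * κ₁ ^ k) := fun k => by
      rw [← hρv, ENNReal.ofReal_coe_nnreal]
    rw [ENNReal.tsum_prod']
    simp only [ENNReal.tsum_const, ENat.card_eq_coe_fintype_card, Fintype.card_fin]
    rw [ENNReal.tsum_mul_left]
    simp_rw [hρE]
    rw [← ENNReal.ofReal_tsum_of_nonneg (fun k => by positivity)
      ((summable_geometric_of_lt_one hκ₁0.le hκ₁1).mul_left _), tsum_mul_left,
      tsum_geometric_of_lt_one hκ₁0.le hκ₁1]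
    have hm : (((m : ℕ) : ℕ∞) : ℝ≥0∞) = ENNReal.ofReal (m : ℝ) := by simp
    rw [hm, ← ENNReal.ofReal_mul (by positivity)]
    refine ENNReal.ofReal_le_ofReal ?_
    have h2 : η₁ ≤ η * (1 - κ₁) / (m + 1) := min_le_right _ _
    rw [le_div_iff₀ (by positivity)] at h2
    rw [← div_eq_mul_inv, ← mul_div_assoc, div_le_iff₀ h1κ]
    nlinarith
  · have hlow : ∀ n, b n ≤ ‖(ofFn (m + 1) (v n)).eval z‖ := fun n => by
      have hρ0 : 0 < (ρ n : ℝ) := by rw [hρv]; positivity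
      have hρ1 : (ρ n : ℝ) ≤ 1 := by
        rw [hρv]
        exact mul_le_one₀ hη₁1 (by positivity) (pow_le_one₀ hκ₁0.le hκ₁1.le)
      refine le_trans ?_ (hc n R (ρ n) hR0 hρ0 z (hR z hz) (hgood n))
      refine pow_le_pow_left₀ (by positivity) ?_ m
      calc b₀ * κ₁ ^ n = (ρ n : ℝ) / (2 * (2 + R)) := by rw [hρv, hb₀]; ring
        _ ≤ _ := div_le_div_of_nonneg_left hρ0.le (by positivity) (by linarith)
    refine ⟨hlow, exists_limit_of_geometric hκ1 fun n hn => ?_⟩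
    have hq1 : 0 < ‖(ofFn (m + 1) (v n)).eval z‖ := (hb0 n).trans_le (hlow n)
    have hq2 : 0 < ‖(ofFn (m + 1) (v (n + 1))).eval z‖ := (hb0 _).trans_le (hlow _)
    rw [div_sub_div _ _ (norm_pos_iff.1 hq2) (norm_pos_iff.1 hq1), norm_div, norm_mul,
      mul_comm ((ofFn (m + 1) (v (n + 1))).eval z)]
    rw [div_le_iff₀ (by positivity)]
    calc _ ≤ A * l ^ n * W z ^ (n + 1) := hn₀ n hn z
      _ ≤ A * l ^ n * w ^ (n + 1) := by
        gcongr
        · exact h.nonneg z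
        · exact hWw z hz
      _ = D * κ ^ n * (b (n + 1) * b n) :=
        geometric_identity hb₀0.ne' hκ₁0.ne' m n
      _ ≤ _ := by
        gcongr
        · exact hlow _
        · exact hlow _

/-- Locally uniform convergence of the numerators along a subsequence on which the denominators
converge. -/
theorem IsGeometric.uniformCauchySeqOn {W : ℂ → ℝ} {τ : ℝ} {m : ℕ} {p : ℕ → ℂ[X]}
    {v : ℕ → Fin (m + 1) → ℂ} (h : IsGeometric W τ p v) {φ : ℕ → ℕ} (hφ : StrictMono φ)
    {u : Fin (m + 1) → ℂ} (hu : Tendsto (fun k => v (φ k)) atTop (𝓝 u)) {z₀ : ℂ}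
    (hz₀ : W z₀ < τ) :
    ∃ s > 0, UniformCauchySeqOn (fun k z => (p (φ k)).eval z) atTop (Metric.closedBall z₀ s) := by
  obtain ⟨c, hc⟩ := h.exists_centers
  obtain ⟨s₀, hs₀, hball⟩ := Metric.nhds_basis_closedBall.eventually_iff.1
    (h.upperSemicontinuous z₀ τ hz₀)
  obtain ⟨n₀, ρ, D, κ, b, hD, hκ0, hκ1, hb, hsum, hgood⟩ := h.exists_good_set hc
    (isCompact_closedBall z₀ s₀) (fun z hz => hball hz) (η := s₀ / 4) (by positivity)
  obtain ⟨s, ⟨hs0, hs1⟩, hs⟩ := exists_sphere_avoiding (fun x : ℕ × Fin m => c x.1 x.2)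
    (fun x => ρ x.1) z₀ (s₀ := s₀) (by
      calc 2 * ∑' x : ℕ × Fin m, (ρ x.1 : ℝ≥0∞) ≤ 2 * ENNReal.ofReal (s₀ / 4) := by gcongr
        _ = ENNReal.ofReal (s₀ / 2) := by
          rw [← ENNReal.ofReal_ofNat 2, ← ENNReal.ofReal_mul (by positivity)]
          congr 1
          ring
        _ < _ := (ENNReal.ofReal_lt_ofReal_iff hs₀).2 (by linarith))
  have hsph : ∀ z ∈ Metric.sphere z₀ s, (∀ n, b n ≤ ‖(ofFn (m + 1) (v n)).eval z‖) ∧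
      ∃ l, ∀ n, n₀ ≤ n → ‖(p n).eval z / (ofFn (m + 1) (v n)).eval z - l‖ ≤ D * κ ^ n := by
    intro z hz
    have hz' : ‖z - z₀‖ = s := mem_sphere_iff_norm.1 hz
    exact hgood z (by rw [mem_closedBall_iff_norm, hz']; exact hs1.le) fun k i => hs z hz' (k, i)
  choose! l hl using fun z hz => (hsph z hz).2
  have hlow := fun z hz => (hsph z hz).1
  obtain ⟨R, hR⟩ := (isCompact_sphere z₀ s).isBounded.exists_norm_le
  obtain ⟨P, hP⟩ := (isCompact_sphere z₀ s).exists_bound_of_continuousOn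
    (p n₀).continuous.continuousOn
  set B := ((m : ℝ) + 1) * max 1 R ^ m with hB
  have hB0 : 0 < B := by positivity
  set M := |P| / b n₀ + D with hM
  have hM0 : 0 ≤ M := by have := hb n₀; positivity
  have hlM : ∀ z ∈ Metric.sphere z₀ s, ‖l z‖ ≤ M := fun z hz => by
    have h1 := hl z hz n₀ le_rfl
    have h2 : ‖(p n₀).eval z / (ofFn (m + 1) (v n₀)).eval z‖ ≤ |P| / b n₀ := by
      rw [norm_div]
      gcongr
      · exact hb _
      · exact (hP z hz).trans (le_abs_self _)
      · exact hlow z hz _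
    have h3 : D * κ ^ n₀ ≤ D := mul_le_of_le_one_right hD (pow_le_one₀ hκ0.le hκ1.le)
    have h4 := norm_sub_norm_le (l z) ((p n₀).eval z / (ofFn (m + 1) (v n₀)).eval z)
    rw [norm_sub_rev] at h4
    linarith
  -- On the circle p = q · (p/q): one error comes from the quotient, the other from the convergence
  -- of the denominators.
  have herr : ∀ k, n₀ ≤ φ k → ∀ z ∈ Metric.sphere z₀ s,
      ‖(ofFn (m + 1) u).eval z * l z - (p (φ k)).eval z‖ ≤
        B * (D * κ ^ φ k) + ‖v (φ k) - u‖ * B * M := by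
    intro k hk z hz
    have hq : (ofFn (m + 1) (v (φ k))).eval z ≠ 0 :=
      norm_pos_iff.1 ((hb _).trans_le (hlow z hz _))
    have heq : (ofFn (m + 1) u).eval z * l z - (p (φ k)).eval z =
        -((ofFn (m + 1) (v (φ k))).eval z *
          ((p (φ k)).eval z / (ofFn (m + 1) (v (φ k))).eval z - l z)) -
          (ofFn (m + 1) (v (φ k) - u)).eval z * l z := by
      rw [map_sub, eval_sub]
      field_simp
      ring
    rw [heq]
    refine (norm_sub_le _ _).trans ?_
    rw [norm_neg, norm_mul, norm_mul]
    have h1 := norm_eval_ofFn_le (v (φ k)) (hR z hz)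
    rw [h.norm_eq, one_mul] at h1
    have h2 := norm_eval_ofFn_le (v (φ k) - u) (hR z hz)
    refine add_le_add (mul_le_mul h1 (hl z hz _ hk) (norm_nonneg _) hB0.le)
      (mul_le_mul h2 (hlM z hz) (norm_nonneg _) (by positivity))
  have hlim : Tendsto (fun k => B * (D * κ ^ φ k) + ‖v (φ k) - u‖ * B * M) atTop (𝓝 0) := by
    have h1 := ((tendsto_pow_atTop_nhds_zero_of_lt_one hκ0.le hκ1).comp hφ.tendsto_atTop)
    have h2 : Tendsto (fun k => ‖v (φ k) - u‖) atTop (𝓝 0) := by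
      have := (hu.sub_const u).norm
      simpa using this
    have h3 := ((h1.const_mul D).const_mul B).add ((h2.mul_const B).mul_const M)
    simpa using h3
  have hunif : TendstoUniformlyOn (fun k z => (p (φ k)).eval z)
      (fun z => (ofFn (m + 1) u).eval z * l z) atTop (Metric.sphere z₀ s) := by
    rw [Metric.tendstoUniformlyOn_iff]
    intro ε hε
    filter_upwards [hlim.eventually (gt_mem_nhds hε),
      hφ.tendsto_atTop.eventually_ge_atTop n₀] with k hk1 hk2 z hz
    rw [dist_eq_norm]
    exact (herr k hk2 z hz).trans_lt hk1
  refine ⟨s, hs0, ?_⟩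
  rw [Metric.uniformCauchySeqOn_iff]
  intro ε hε
  obtain ⟨N, hN⟩ := Metric.uniformCauchySeqOn_iff.1 hunif.uniformCauchySeqOn (ε / 2) (by positivity)
  refine ⟨N, fun j hj k hk z hz => lt_of_le_of_lt ?_ (half_lt_self hε)⟩
  rw [dist_eq_norm, ← eval_sub]
  -- The numerators are polynomials, so the maximum principle carries the estimate into the disk,
  -- past any poles of the quotients.
  refine Complex.norm_le_of_forall_mem_frontier_norm_le (U := Metric.ball z₀ s)
    Metric.isBounded_ball (f := fun z => ((p (φ j)) - p (φ k)).eval z)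
    (Polynomial.differentiable _).diffContOnCl (fun y hy => ?_)
    (by rwa [closure_ball z₀ hs0.ne'])
  rw [frontier_ball z₀ hs0.ne'] at hy
  have := hN j hj k hk y hy
  rw [dist_eq_norm, ← eval_sub] at this
  exact this.le

lemma ofFn_ne_zero_of_norm_eq_one {m : ℕ} {u : Fin (m + 1) → ℂ} (hu : ‖u‖ = 1) :
    ofFn (m + 1) u ≠ 0 := fun h => by
  rw [← map_zero (ofFn (R := ℂ) (m + 1))] at h
  rw [injective_ofFn (m + 1) h, norm_zero] at hu
  exact zero_ne_one hu

lemma natDegree_ofFn_le {m : ℕ} (u : Fin (m + 1) → ℂ) : (ofFn (m + 1) u).natDegree ≤ m :=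
  Nat.lt_succ_iff.1 (ofFn_natDegree_lt (by omega) u)

lemma tendsto_eval_ofFn {m : ℕ} {v : ℕ → Fin (m + 1) → ℂ} {u : Fin (m + 1) → ℂ}
    (h : Tendsto v atTop (𝓝 u)) (z : ℂ) :
    Tendsto (fun k => (ofFn (m + 1) (v k)).eval z) atTop (𝓝 ((ofFn (m + 1) u).eval z)) := by
  have h0 : Tendsto (fun k => ‖v k - u‖) atTop (𝓝 0) := by
    simpa using (h.sub_const u).norm
  rw [tendsto_iff_norm_sub_tendsto_zero]
  refine squeeze_zero (fun _ => norm_nonneg _) (fun k => ?_)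
    (by simpa using h0.mul_const (((m : ℝ) + 1) * max 1 ‖z‖ ^ m))
  rw [← eval_sub, ← map_sub]
  exact norm_eval_ofFn_le _ le_rfl

/-- The limit of the normalized quotients along a subsequence. -/
structure IsSubseqLimit (W : ℂ → ℝ) (τ : ℝ) {m : ℕ} (p : ℕ → ℂ[X]) (v : ℕ → Fin (m + 1) → ℂ)
    (φ : ℕ → ℕ) (u : Fin (m + 1) → ℂ) (h : ℂ → ℂ) : Prop where
  strictMono : StrictMono φ
  norm_eq : ‖u‖ = 1
  tendsto : Tendsto (fun k => v (φ k)) atTop (𝓝 u)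
  analytic : AnalyticOnNhd ℂ h {z | W z < τ}
  tendsto_eval (z : ℂ) (hz : W z < τ) : Tendsto (fun k => (p (φ k)).eval z) atTop (𝓝 (h z))

theorem IsGeometric.exists_isSubseqLimit {W : ℂ → ℝ} {τ : ℝ} {m : ℕ} {p : ℕ → ℂ[X]}
    {v : ℕ → Fin (m + 1) → ℂ} (hg : IsGeometric W τ p v) : ∃ φ u h, IsSubseqLimit W τ p v φ u h := by
  obtain ⟨u, hu, φ, hφ, hlim⟩ := (isCompact_sphere (0 : Fin (m + 1) → ℂ) 1).tendsto_subseq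
    (x := v) (fun n => mem_sphere_zero_iff_norm.2 (hg.norm_eq n))
  have hcs := fun z hz => hg.uniformCauchySeqOn hφ hlim (z₀ := z) hz
  have hex : ∀ z, W z < τ → ∃ a, Tendsto (fun k => (p (φ k)).eval z) atTop (𝓝 a) := by
    intro z hz
    obtain ⟨s, hs, hc⟩ := hcs z hz
    exact cauchySeq_tendsto_of_complete (hc.cauchy_map (Metric.mem_closedBall_self hs.le))
  choose! h hh using hex
  refine ⟨φ, u, h, hφ, mem_sphere_zero_iff_norm.1 hu, hlim, fun z hz => ?_, hh⟩
  obtain ⟨s, hs, hc⟩ := hcs z hz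
  obtain ⟨s', hs', hball⟩ := Metric.nhds_basis_ball.eventually_iff.1
    (hg.upperSemicontinuous z τ hz)
  have hsub : Metric.ball z (min s s') ⊆ Metric.closedBall z s :=
    (Metric.ball_subset_ball (min_le_left _ _)).trans Metric.ball_subset_closedBall
  have hunif := (hc.mono hsub).tendstoUniformlyOn_of_tendsto
    fun w hw => hh w (hball (Metric.ball_subset_ball (min_le_right _ _) hw))
  have hd := hunif.tendstoLocallyUniformlyOn.differentiableOn
    (Eventually.of_forall fun k => (p (φ k)).differentiable.differentiableOn) Metric.isOpen_ball
  exact hd.analyticAt (Metric.ball_mem_nhds z (lt_min hs hs'))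

/-! ### The meromorphic limit F = h/Q and its agreement with f. -/

section Quotient

variable {E : Set ℂ} {h : ℂ → ℂ} {Q : ℂ[X]}

lemma analyticAt_eval (Q : ℂ[X]) (z : ℂ) : AnalyticAt ℂ (fun w => Q.eval w) z :=
  Q.differentiable.analyticAt z

lemma meromorphicOn_div_eval (hh : AnalyticOnNhd ℂ h E) (Q : ℂ[X]) :
    MeromorphicOn (fun z => h z / Q.eval z) E := fun z hz =>
  (hh z hz).meromorphicAt.fun_div (analyticAt_eval Q z).meromorphicAt

/-- The meromorphic function `h / Q`, with removable singularities removed. -/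
def quotientOn (h : ℂ → ℂ) (Q : ℂ[X]) (E : Set ℂ) : ℂ → ℂ :=
  toMeromorphicNFOn (fun z => h z / Q.eval z) E

lemma meromorphicOrderAt_eval (hQ : Q ≠ 0) (z : ℂ) :
    meromorphicOrderAt (fun w => Q.eval w) z = ((Q.rootMultiplicity z : ℤ) : WithTop ℤ) := by
  obtain ⟨g, hg, hgz⟩ := exists_eq_pow_rootMultiplicity_mul_and_not_dvd Q hQ z
  rw [meromorphicOrderAt_eq_int_iff (analyticAt_eval Q z).meromorphicAt]
  refine ⟨fun w => g.eval w, analyticAt_eval g z, fun h0 => hgz (dvd_iff_isRoot.2 h0),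
    Eventually.of_forall fun w => ?_⟩
  conv_lhs => rw [hg]
  simp

lemma poleOrder_quotientOn_le (hh : AnalyticOnNhd ℂ h E) (hQ : Q ≠ 0) {z : ℂ} (hz : z ∈ E) :
    poleOrder (quotientOn h Q E) z ≤ Q.rootMultiplicity z := by
  have h1 : meromorphicOrderAt (quotientOn h Q E) z =
      meromorphicOrderAt h z - ((Q.rootMultiplicity z : ℤ) : WithTop ℤ) := by
    rw [quotientOn, meromorphicOrderAt_toMeromorphicNFOn (meromorphicOn_div_eval hh Q) hz,
      fun_meromorphicOrderAt_div (hh z hz).meromorphicAt (analyticAt_eval Q z).meromorphicAt,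
      meromorphicOrderAt_eval hQ]
  rw [poleOrder, h1]
  have h2 := (hh z hz).meromorphicOrderAt_nonneg
  cases hd : meromorphicOrderAt h z with
  | top => simp
  | coe k =>
    rw [hd] at h2
    have h3 : 0 ≤ k := by exact_mod_cast h2
    rw [← WithTop.LinearOrderedAddCommGroup.coe_sub, WithTop.untop₀_coe]
    omega

theorem isMeromorphicWithPoles_quotientOn (hh : AnalyticOnNhd ℂ h E) (hQ : Q ≠ 0) {m : ℕ}
    (hm : Q.natDegree ≤ m) : IsMeromorphicWithPoles (quotientOn h Q E) E m := by
  classical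
  refine ⟨meromorphicNFOn_toMeromorphicNFOn _ _, fun S hS => ?_⟩
  calc ∑ z ∈ S, poleOrder (quotientOn h Q E) z ≤ ∑ z ∈ S, Q.roots.count z :=
        Finset.sum_le_sum fun z hz => by
          rw [count_roots]
          exact poleOrder_quotientOn_le hh hQ (hS hz)
    _ ≤ ∑ z ∈ S ∪ Q.roots.toFinset, Q.roots.count z :=
        Finset.sum_le_sum_of_subset Finset.subset_union_left
    _ = Multiset.card Q.roots :=
        Multiset.sum_count_eq_card fun a ha => Finset.mem_union_right _ (Multiset.mem_toFinset.2 ha)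
    _ ≤ m := (card_roots' Q).trans hm

lemma quotientOn_eq (hh : AnalyticOnNhd ℂ h E) {z : ℂ} (hz : z ∈ E) (hQz : Q.eval z ≠ 0) :
    AnalyticAt ℂ (quotientOn h Q E) z ∧ quotientOn h Q E z = h z / Q.eval z := by
  have h1 : AnalyticAt ℂ (fun w => h w / Q.eval w) z := (hh z hz).fun_div (analyticAt_eval Q z) hQz
  have h2 := toMeromorphicNFOn_eq_toMeromorphicNFAt_on_nhds (meromorphicOn_div_eval hh Q) hz
  rw [toMeromorphicNFAt_eq_self.2 h1.meromorphicNFAt] at h2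
  exact ⟨h1.congr h2.symm, h2.eq_of_nhds⟩

end Quotient

/-- A meromorphic function in normal form that agrees with a continuous function on a set
accumulating at `z` is analytic at `z`. -/
theorem analyticAt_of_accPt {F f : ℂ → ℂ} {K : Set ℂ} {z : ℂ} (hF : MeromorphicNFAt F z)
    (hf : ContinuousWithinAt f K z) (hz : AccPt z (𝓟 K))
    (heq : ∀ᶠ w in 𝓝[≠] z, w ∈ K → F w = f w) : AnalyticAt ℂ F z ∧ F z = f z := by
  have hne : (𝓝[≠] z ⊓ 𝓟 K).NeBot := hz
  have hle : 𝓝[≠] z ⊓ 𝓟 K ≤ 𝓝[K] z := inf_le_inf_right _ nhdsWithin_le_nhds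
  have hlim : Tendsto F (𝓝[≠] z ⊓ 𝓟 K) (𝓝 (f z)) :=
    (hf.tendsto.mono_left hle).congr' (by
      rw [EventuallyEq, eventually_inf_principal]
      exact heq.mono fun w hw hwK => (hw hwK).symm)
  have han : AnalyticAt ℂ F z := by
    rw [← hF.meromorphicOrderAt_nonneg_iff_analyticAt]
    by_contra! hneg
    exact hlim.not_tendsto (Metric.disjoint_nhds_cobounded _)
      -- At a pole F would tend to infinity, but along K it tends to f(z).
      ((tendsto_cobounded_of_meromorphicOrderAt_neg hneg).mono_left inf_le_left)
  refine ⟨han, tendsto_nhds_unique ?_ hlim⟩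
  exact han.continuousAt.tendsto.mono_left (inf_le_left.trans nhdsWithin_le_nhds)

lemma continuousOn_ratEval {r : RatFunc ℂ} {K : Set ℂ} (h : ∀ z ∈ K, r.denom.eval z ≠ 0) :
    ContinuousOn (ratEval r) K := by
  have : ratEval r = fun z => r.num.eval z / r.denom.eval z := by
    ext z
    rw [ratEval, RatFunc.eval, eval₂_id, eval₂_id]
  rw [this]
  exact r.num.continuous.continuousOn.div r.denom.continuous.continuousOn h

lemma norm_sub_ratEval_le_of_supDist_le {K : Set ℂ} {f : ℂ → ℂ} {r : RatFunc ℂ} {δ : ℝ}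
    (hδ : 0 ≤ δ) (h : supDist K f r ≤ ENNReal.ofReal δ) {z : ℂ} (hz : z ∈ K) :
    r.denom.eval z ≠ 0 ∧ ‖f z - ratEval r z‖ ≤ δ := by
  have h1 := (le_iSup₂ (f := fun z (_ : z ∈ K) => if r.denom.eval z = 0 then (⊤ : ℝ≥0∞) else
    ‖f z - ratEval r z‖ₑ) z hz).trans h
  by_cases h0 : r.denom.eval z = 0
  · simp [h0] at h1
  · refine ⟨h0, ?_⟩
    simp only [h0, if_false] at h1
    rwa [← ofReal_norm, ENNReal.ofReal_le_ofReal_iff hδ] at h1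

theorem eventually_norm_sub_ratEval_le {K : Set ℂ} {f : ℂ → ℂ} {r : ℕ → RatFunc ℂ} {t l : ℝ}
    (hlim : limsup (fun n : ℕ => supDist K f (r n) ^ (1 / (n : ℝ))) atTop ≤ ENNReal.ofReal t)
    (ht : 0 ≤ t) (hl : t < l) :
    ∀ᶠ n in atTop, ∀ z ∈ K, (r n).denom.eval z ≠ 0 ∧ ‖f z - ratEval (r n) z‖ ≤ l ^ n := by
  have hl0 : 0 < l := ht.trans_lt hl
  have h1 := eventually_lt_of_limsup_lt
    (hlim.trans_lt ((ENNReal.ofReal_lt_ofReal_iff hl0).2 hl))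
  filter_upwards [h1, eventually_ge_atTop 1] with n hn hn1 z hz
  refine norm_sub_ratEval_le_of_supDist_le (by positivity) ?_ hz
  have hn0 : (n : ℝ) ≠ 0 := by positivity
  rw [ENNReal.ofReal_pow hl0.le, ← ENNReal.rpow_natCast]
  calc supDist K f (r n) = (supDist K f (r n) ^ (1 / (n : ℝ))) ^ (n : ℝ) := by
        rw [← ENNReal.rpow_mul, one_div_mul_cancel hn0, ENNReal.rpow_one]
    _ ≤ _ := ENNReal.rpow_le_rpow hn.le (by positivity)

theorem continuousOn_of_limsup_lt {K : Set ℂ} {f : ℂ → ℂ} {r : ℕ → RatFunc ℂ} {t : ℝ}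
    (hlim : limsup (fun n : ℕ => supDist K f (r n) ^ (1 / (n : ℝ))) atTop ≤ ENNReal.ofReal t)
    (ht : 0 ≤ t) (ht1 : t < 1) :
    ContinuousOn f K ∧ ∀ z ∈ K, Tendsto (fun n => ratEval (r n) z) atTop (𝓝 (f z)) := by
  obtain ⟨l, hl, hl1⟩ := exists_between ht1
  have hev := eventually_norm_sub_ratEval_le hlim ht hl
  have hunif : TendstoUniformlyOn (fun n => ratEval (r n)) f atTop K := by
    rw [Metric.tendstoUniformlyOn_iff]
    intro ε hε
    filter_upwards [hev, (tendsto_pow_atTop_nhds_zero_of_lt_one (ht.trans hl.le) hl1).eventually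
      (gt_mem_nhds hε)] with n h1 h2 z hz
    rw [dist_eq_norm]
    exact (h1 z hz).2.trans_lt h2
  exact ⟨hunif.continuousOn (hev.mono fun n hn => continuousOn_ratEval fun z hz => (hn z hz).1).frequently,
    fun z hz => hunif.tendsto_at hz⟩

theorem IsGeometric.tendstoInSigmaContent {W : ℂ → ℝ} {τ : ℝ} {m : ℕ} {p : ℕ → ℂ[X]}
    {v : ℕ → Fin (m + 1) → ℂ} (hg : IsGeometric W τ p v) {φ : ℕ → ℕ} {u : Fin (m + 1) → ℂ}
    {h : ℂ → ℂ} (hs : IsSubseqLimit W τ p v φ u h) {r : ℕ → RatFunc ℂ}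
    (hr : ∀ n, m ≤ n → r n = algebraMap ℂ[X] (RatFunc ℂ) (p n) /
      algebraMap ℂ[X] (RatFunc ℂ) (ofFn (m + 1) (v n))) :
    TendstoInSigmaContent (fun n => ratEval (r n)) (quotientOn h (ofFn (m + 1) u) {z | W z < τ})
      {z | W z < τ} := by
  intro C hC hCE ε hε
  obtain ⟨c, hc⟩ := hg.exists_centers
  obtain ⟨c', hc'⟩ := exists_roots_lower_bound hs.norm_eq
  rw [ENNReal.tendsto_nhds_zero]
  intro δ hδ
  obtain ⟨η, hη0, hηδ⟩ := ENNReal.lt_iff_exists_nnreal_btwn.1 hδ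
  have hη : 0 < (η : ℝ) := by exact_mod_cast hη0
  obtain ⟨n₀, ρ, D, κ, b, hD, hκ0, hκ1, hb, hsum, hgood⟩ := hg.exists_good_set hc hC
    (fun z hz => hCE hz) (half_pos hη)
  set s : ℝ≥0 := η / 2 / (m + 1) with hs_def
  have hs0 : 0 < (s : ℝ) := by
    rw [hs_def]; push_cast; positivity
  have hκlim : Tendsto (fun n => D * κ ^ n) atTop (𝓝 0) := by
    simpa using (tendsto_pow_atTop_nhds_zero_of_lt_one hκ0.le hκ1).const_mul D
  filter_upwards [eventually_ge_atTop n₀, eventually_ge_atTop m,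
    hκlim.eventually (gt_mem_nhds hε)] with n hn hnm hnε
  -- The covering consists of the disks about the centers of all denominators and m disks about the
  -- centers of Q; each family uses half of η.
  refine (sigmaContent_le_tsum (ι := (ℕ × Fin m) ⊕ Fin m)
    (Sum.elim (fun x => c x.1 x.2) c') (Sum.elim (fun x => ρ x.1) fun _ => s) ?_).trans ?_
  · rintro z ⟨hzC, hzε⟩
    by_contra hcon
    simp only [mem_iUnion, Sum.exists, not_or, not_exists, Sum.elim_inl, Sum.elim_inr, Prod.forall,
      Metric.mem_ball, not_lt, dist_eq_norm] at hcon
    obtain ⟨hlow, l, hl⟩ := hgood z hzC hcon.1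
    have hq : ∀ n, (ofFn (m + 1) (v n)).eval z ≠ 0 := fun n =>
      norm_pos_iff.1 ((hb n).trans_le (hlow n))
    have hQ : (ofFn (m + 1) u).eval z ≠ 0 := norm_pos_iff.1
      (lt_of_lt_of_le (by positivity) (hc' ‖z‖ s (norm_nonneg _) hs0 z le_rfl hcon.2))
    have hl1 : Tendsto (fun k => (p (φ k)).eval z / (ofFn (m + 1) (v (φ k))).eval z) atTop
        (𝓝 l) := by
      rw [tendsto_iff_norm_sub_tendsto_zero]
      refine squeeze_zero' (Eventually.of_forall fun _ => norm_nonneg _) ?_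
        (hκlim.comp hs.strictMono.tendsto_atTop)
      filter_upwards [hs.strictMono.tendsto_atTop.eventually_ge_atTop n₀] with k hk
      exact hl _ hk
    have hl2 := tendsto_nhds_unique hl1
      ((hs.tendsto_eval z (hCE hzC)).div (tendsto_eval_ofFn hs.tendsto z) hQ)
    have hF := (quotientOn_eq hs.analytic (hCE hzC) hQ).2
    have hre : ratEval (r n) z = (p n).eval z / (ofFn (m + 1) (v n)).eval z := by
      rw [eq_div_iff (hq n), mul_comm]
      exact eval_mul_ratEval (ofFn_ne_zero_of_norm_eq_one (hg.norm_eq n)) (hr n hnm)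
        (denom_eval_ne_zero (hr n hnm) (hq n))
    have := hl n hn
    rw [hF, hre, ← hl2] at hzε
    linarith
  · rw [Summable.tsum_sum ENNReal.summable ENNReal.summable]
    simp only [Sum.elim_inl, Sum.elim_inr]
    calc _ ≤ ENNReal.ofReal (η / 2) + ENNReal.ofReal (η / 2) := by
          refine add_le_add hsum ?_
          rw [tsum_fintype, Finset.sum_const, Finset.card_univ, Fintype.card_fin, nsmul_eq_mul,
            ← ENNReal.ofReal_coe_nnreal, ← ENNReal.ofReal_natCast,
            ← ENNReal.ofReal_mul (by positivity)]
          refine ENNReal.ofReal_le_ofReal ?_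
          rw [hs_def]
          push_cast
          rw [← mul_div_assoc, div_le_iff₀ (by positivity)]
          nlinarith
      _ = η := by
          rw [← ENNReal.ofReal_add (by positivity) (by positivity), add_halves,
            ENNReal.ofReal_coe_nnreal]
      _ ≤ δ := hηδ.le

theorem IsBoundedPotential.isGeometric {K : Set ℂ} {μ : Measure ℂ} {V : ℝ}
    (hK : IsBoundedPotential K μ V) {f : ℂ → ℂ} {r : ℕ → RatFunc ℂ} {m : ℕ} {t : ℝ} (ht : 0 < t)
    (hlim : limsup (fun n : ℕ => supDist K f (r n) ^ (1 / (n : ℝ))) atTop ≤ ENNReal.ofReal t)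
    {p : ℕ → ℂ[X]} {v : ℕ → Fin (m + 1) → ℂ} (hv : ∀ n, ‖v n‖ = 1)
    (hp : ∀ n, m ≤ n → (p n).natDegree ≤ n - m)
    (hr : ∀ n, m ≤ n → r n = algebraMap ℂ[X] (RatFunc ℂ) (p n) /
      algebraMap ℂ[X] (RatFunc ℂ) (ofFn (m + 1) (v n))) :
    IsGeometric (fun z => Real.exp (V + logMean μ z)) t⁻¹ p v where
  upperSemicontinuous := by
    have := hK.mem_probOn.1
    obtain ⟨R, hR⟩ := hK.isCompact.isBounded.exists_norm_le
    have h1 := upperSemicontinuous_logMean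
      ((ae_mem_of_mem_probOn hK.mem_probOn).mono fun w hw => hR w hw) hK.logIntegrableAt
    exact (Real.continuous_exp.comp (continuous_const.add continuous_id)).comp_upperSemicontinuous
      h1 fun a b hab => Real.exp_le_exp.2 (by simpa using hab)
  nonneg z := (Real.exp_pos _).le
  pos := inv_pos.2 ht
  norm_eq := hv
  bound l hl := by
    rw [inv_inv] at hl
    have hl0 : 0 < l := ht.trans hl
    obtain ⟨R, hR⟩ := hK.isCompact.isBounded.exists_norm_le
    set B := ((m : ℝ) + 1) * max 1 R ^ m
    have hB : 0 < B := by positivity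
    have hqB : ∀ n, ∀ z ∈ K, ‖(ofFn (m + 1) (v n)).eval z‖ ≤ B := fun n z hz => by
      simpa [hv n] using norm_eval_ofFn_le (v n) (hR z hz)
    have hev := eventually_norm_sub_ratEval_le hlim ht.le hl
    refine ⟨B * B * (1 + l), by positivity, ?_⟩
    filter_upwards [hev, (tendsto_add_atTop_nat 1).eventually hev, eventually_ge_atTop m]
      with n h1 h2 hn z
    -- The numerator degree n - m leaves room for a denominator of degree m, so the cross difference
    -- has degree at most n + 1.
    have hdeg : ∀ i j, m ≤ i → i ≤ n + 1 →
        (p i * ofFn (m + 1) (v j)).natDegree ≤ n + 1 := fun i j hi hin => by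
      have h3 := hp i hi
      have h4 := natDegree_ofFn_le (v j)
      exact natDegree_mul_le.trans (by omega)
    have hN := norm_eval_le_exp_logMean hK.isCompact hK.mem_probOn hK.neg_le
      (p (n + 1) * ofFn (m + 1) (v n) - p n * ofFn (m + 1) (v (n + 1)))
      (n := n + 1) (M := B * B * (1 + l) * l ^ n)
      ((natDegree_sub_le _ _).trans
        (max_le (hdeg _ _ (by omega) le_rfl) (hdeg _ _ hn (by omega)))) (by positivity)
      (fun w hw => ?_) z
    · rw [eval_sub, eval_mul, eval_mul] at hN
      rwa [← Real.exp_nat_mul]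
    · have e1 := eval_mul_ratEval (ofFn_ne_zero_of_norm_eq_one (hv n)) (hr n hn) (h1 w hw).1
      have e2 := eval_mul_ratEval (ofFn_ne_zero_of_norm_eq_one (hv (n + 1)))
        (hr (n + 1) (by omega)) (h2 w hw).1
      -- On K the cross difference is q_n q_{n+1} (r_{n+1} - r_n), so its size there follows from
      -- the approximation of f.
      have heq : (p (n + 1) * ofFn (m + 1) (v n) - p n * ofFn (m + 1) (v (n + 1))).eval w =
          (ofFn (m + 1) (v (n + 1))).eval w * (ofFn (m + 1) (v n)).eval w *
            ((f w - ratEval (r n) w) - (f w - ratEval (r (n + 1)) w)) := by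
        rw [eval_sub, eval_mul, eval_mul, ← e1, ← e2]
        ring
      rw [heq, norm_mul, norm_mul]
      calc _ ≤ B * B * (l ^ n + l ^ (n + 1)) := by
            gcongr
            · exact hqB _ w hw
            · exact hqB _ w hw
            · exact (norm_sub_le _ _).trans (add_le_add (h1 w hw).2 (h2 w hw).2)
        _ = _ := by ring

/-- The limit agrees with `f` at the points of `K` where the limit denominator does not vanish. -/
lemma IsSubseqLimit.quotientOn_eq {W : ℂ → ℝ} {τ : ℝ} {m : ℕ} {p : ℕ → ℂ[X]}
    {v : ℕ → Fin (m + 1) → ℂ} {φ : ℕ → ℕ} {u : Fin (m + 1) → ℂ} {h : ℂ → ℂ}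
    (hs : IsSubseqLimit W τ p v φ u h) {r : ℕ → RatFunc ℂ} (hv : ∀ n, ‖v n‖ = 1)
    (hr : ∀ n, m ≤ n → r n = algebraMap ℂ[X] (RatFunc ℂ) (p n) /
      algebraMap ℂ[X] (RatFunc ℂ) (ofFn (m + 1) (v n))) {z a : ℂ} (hz : W z < τ)
    (hQ : (ofFn (m + 1) u).eval z ≠ 0)
    (ha : Tendsto (fun n => ratEval (r n) z) atTop (𝓝 a)) :
    AnalyticAt ℂ (quotientOn h (ofFn (m + 1) u) {z | W z < τ}) z ∧
      quotientOn h (ofFn (m + 1) u) {z | W z < τ} z = a := by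
  have h1 := SigmaContent.quotientOn_eq hs.analytic hz hQ
  refine ⟨h1.1, h1.2.trans ?_⟩
  have h2 := tendsto_eval_ofFn hs.tendsto z
  refine tendsto_nhds_unique ((hs.tendsto_eval z hz).div h2 hQ)
    ((ha.comp hs.strictMono.tendsto_atTop).congr' ?_)
  filter_upwards [h2.eventually_ne hQ, hs.strictMono.tendsto_atTop.eventually_ge_atTop m]
    with k hk hkm
  rw [Function.comp_apply, Pi.div_apply, eq_div_iff hk, mul_comm]
  exact eval_mul_ratEval (ofFn_ne_zero_of_norm_eq_one (hv _)) (hr _ hkm)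
    (denom_eval_ne_zero (hr _ hkm) hk)

end SigmaContent

end

open SigmaContent

theorem mainTheorem7 (K : Set ℂ) (hK : SigmaContent.IsRegularCompact K)
    (μ : Measure ℂ) (hμ : SigmaContent.IsEquilibriumMeasure K μ)
    (f : ℂ → ℂ) (m : ℕ) (r : ℕ → RatFunc ℂ)
    (hr : ∀ n, m ≤ n → r n ∈ SigmaContent.ratClass (n - m) m)
    (θ : ℝ) (hθ : 0 < θ) (hθ1 : SigmaContent.logCap K / θ < 1)
    (hlim : limsup (fun n : ℕ => SigmaContent.supDist K f (r n) ^ (1 / (n : ℝ))) atTop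
      ≤ ENNReal.ofReal (SigmaContent.logCap K / θ)) :
    K ⊆ SigmaContent.levelSet μ θ ∧
    ∃ F : ℂ → ℂ,
      SigmaContent.IsMeromorphicWithPoles F (SigmaContent.levelSet μ θ) m ∧
      {z | z ∈ K ∧ ¬ (AnalyticAt ℂ F z ∧ F z = f z)}.Finite ∧
      (∀ z ∈ K, AccPt z (𝓟 K) → AnalyticAt ℂ F z ∧ F z = f z) ∧
      SigmaContent.TendstoInSigmaContent (fun n => SigmaContent.ratEval (r n)) F
        (SigmaContent.levelSet μ θ) := by
  obtain ⟨V, hV, hint, hmin⟩ := exists_robin hK.isCompact hK.logCap_pos hμ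
  have hpot : IsBoundedPotential K μ V :=
    ⟨hK.isCompact, hμ.1, fun z => (hint z).2, fun z => (hint z).1⟩
  have ht : 0 < logCap K / θ := div_pos hK.logCap_pos hθ
  have hlevel : levelSet μ θ = {z | Real.exp (V + logMean μ z) < (logCap K / θ)⁻¹} := by
    ext z
    rw [mem_levelSet_iff (hint z).1 hθ, mem_ofPred_eq, hV, inv_div, ← Real.exp_log hθ,
      ← Real.exp_sub, Real.exp_lt_exp, Real.log_exp]
    constructor <;> intro h <;> linarith
  have hKE : K ⊆ {z | Real.exp (V + logMean μ z) < (logCap K / θ)⁻¹} := fun z hz => by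
    have h1 := logMean_le_of_mem hpot hmin hK.dirichlet hz
    exact (Real.exp_le_one_iff.2 (by linarith)).trans_lt ((one_lt_inv₀ ht).2 hθ1)
  have hrep : ∀ n, ∃ (p : ℂ[X]) (v : Fin (m + 1) → ℂ), ‖v‖ = 1 ∧ (m ≤ n → p.natDegree ≤ n - m ∧
      r n = algebraMap ℂ[X] (RatFunc ℂ) p / algebraMap ℂ[X] (RatFunc ℂ) (ofFn (m + 1) v)) := by
    intro n
    by_cases hn : m ≤ n
    · obtain ⟨p, v, h1, h2, h3⟩ := exists_normalized_of_mem_ratClass (hr n hn)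
      exact ⟨p, v, h2, fun _ => ⟨h1, h3⟩⟩
    -- For n < m nothing is known about r_n; only the normalization of the denominator is kept.
    · exact ⟨0, fun _ => 1, by simp, fun h => absurd h hn⟩
  choose p v hv hpv using hrep
  have hg := hpot.isGeometric ht hlim hv (fun n hn => (hpv n hn).1) fun n hn => (hpv n hn).2
  obtain ⟨φ, u, h, hs⟩ := hg.exists_isSubseqLimit
  have hQ := ofFn_ne_zero_of_norm_eq_one hs.norm_eq
  obtain ⟨hfc, hft⟩ := continuousOn_of_limsup_lt hlim ht.le hθ1
  have heq := fun z (hz : z ∈ K) hQz =>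
    hs.quotientOn_eq hv (fun n hn => (hpv n hn).2) (hKE hz) hQz (hft z hz)
  have hmero := isMeromorphicWithPoles_quotientOn hs.analytic hQ (natDegree_ofFn_le u)
  have hroots : {z | (ofFn (m + 1) u).eval z = 0}.Finite := finite_setOfPred_isRoot hQ
  rw [hlevel]
  refine ⟨hKE, quotientOn h (ofFn (m + 1) u) _, hmero, ?_, fun z hz hacc => ?_,
    hg.tendstoInSigmaContent hs fun n hn => (hpv n hn).2⟩
  · refine hroots.subset fun z hz => ?_
    by_contra hQz
    exact hz.2 (heq z hz.1 hQz)
  · refine analyticAt_of_accPt (hmero.1 (hKE hz)) (hfc z hz) hacc ?_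
    -- Q has finitely many zeros, so F = f on K in a punctured neighborhood of z even if Q(z) = 0.
    have h1 : ∀ᶠ w in 𝓝[≠] z, (ofFn (m + 1) u).eval w ≠ 0 := by
      have h2 := (hroots.sdiff (t := {z})).isClosed.isOpen_compl.mem_nhds (x := z)
        fun h => h.2 rfl
      filter_upwards [mem_nhdsWithin_of_mem_nhds h2, self_mem_nhdsWithin] with w hw hwz h0
      exact hw ⟨h0, hwz⟩
    filter_upwards [h1] with w hw hwK
    exact (heq w hwK hw).2
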